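/- Let $S$ be a finite set with $n$ elements and let $C_1, C_2$ be permutations of $S$. Take one closed unit square $[0,1]\times[0,1]$ for each element of $S$, and for every $i\in S$ glue, by translation, the right edge of the $i$-th square to the left edge of the $C_1(i)$-th square, and the bottom edge of the $i$-th square to the top edge of the $C_2(i)$-th square. Let $\widehat\Sigma_0$ be the resulting closed surface, let $\widehat\pi:\widehat\Sigma_0\to\mathbb T=\mathbb C/(\mathbb Z\oplus i\mathbb Z)$ be the map which sends the point $(x,y)$ of any square to the class of $x+iy$ (a branched covering, ramified at most over $0$), and let $\Sigma_0=\widehat\pi^{-1}(\mathbb T\setminus\{0\})$, which is the complement of the corners of the squares. Assume that $\Sigma_0$ is connected. Let $b_k$ be the number of $k$-cycles in the decomposition of the commutator $[C_1,C_2]$ into disjoint cycles (fixed points are $1$-cycles), and let $b=\sum_{k=1}^n b_k$. Let $g$ be the genus of $\widehat\Sigma_0$, so that $\dim H_1(\widehat\Sigma_0;\mathbb Q)=2g$. Then the number of points in $\widehat\Sigma_0\setminus\Sigma_0$ is equal to $b$, the Euler characteristic of $\Sigma_0$ is $\chi(\Sigma_0)=-n$, and \[ \chi(\Sigma_0)=2-2g-b=-n.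 \] In particular, $g=1$ if and only if $C_1$ and $C_2$ commute. -/

import Mathlib

noncomputable section

namespace SquareTiled

/-- The square torus `ℂ / (ℤ ⊕ iℤ)`. -/
abbrev Torus : Type := ℂ ⧸ AddSubgroup.closure ({1, Complex.I} : Set ℂ)

/-- The disjoint union of copies of the closed unit square `[0,1] × [0,1]`, one for each element
of `S`. -/
abbrev Squares (S : Type) : Type := Σ _ : S, unitInterval × unitInterval

/-- The elementary edge identifications: the right edge of the square `i` is identified with the
left edge of the square `C₁ i`, and the bottom edge of the square `i` with the top edge of the
square `C₂ i`. -/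
inductive Glue {S : Type} (C₁ C₂ : Equiv.Perm S) : Squares S → Squares S → Prop
  | right_left (i : S) (t : unitInterval) : Glue C₁ C₂ ⟨i, (1, t)⟩ ⟨C₁ i, (0, t)⟩
  | bottom_top (i : S) (t : unitInterval) : Glue C₁ C₂ ⟨i, (t, 0)⟩ ⟨C₂ i, (t, 1)⟩

/-- The completed surface: the closed squares glued along their edges, with the quotient topology
(`Quot` divides by the equivalence relation generated by `Glue`). -/
abbrev ClosedSurface {S : Type} (C₁ C₂ : Equiv.Perm S) : Type := Quot (Glue C₁ C₂)

/-- The branched covering of the torus by the completed surface: the point `(x, y)` of any of the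
squares is sent to the class of `x + iy`. -/
def proj {S : Type} (C₁ C₂ : Equiv.Perm S) : ClosedSurface C₁ C₂ → Torus :=
  Quot.lift
    (fun p : Squares S =>
      QuotientAddGroup.mk (((p.2.1 : ℝ) : ℂ) + ((p.2.2 : ℝ) : ℂ) * Complex.I))
    (by
      rintro _ _ (⟨i, t⟩ | ⟨i, t⟩)
      · refine (QuotientAddGroup.eq (s := AddSubgroup.closure ({1, Complex.I} : Set ℂ))).2 ?_
        have h : (1 : ℂ) ∈ AddSubgroup.closure ({1, Complex.I} : Set ℂ) :=
          AddSubgroup.subset_closure (by simp)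
        convert neg_mem h using 1
        simp
      · refine (QuotientAddGroup.eq (s := AddSubgroup.closure ({1, Complex.I} : Set ℂ))).2 ?_
        have h : Complex.I ∈ AddSubgroup.closure ({1, Complex.I} : Set ℂ) :=
          AddSubgroup.subset_closure (by simp)
        convert h using 1
        simp)

/-- The square-tiled surface `Σ₀`: the preimage of the punctured torus. This is the complement of
the corners of the squares, that is, the squares with corners removed, glued along their edges. -/
def openSurface {S : Type} (C₁ C₂ : Equiv.Perm S) : Set (ClosedSurface C₁ C₂) :=
  proj C₁ C₂ ⁻¹' {0}ᶜ

/-- The number `b_k` of `k`-cycles in the decomposition of `σ` into disjoint cycles, where fixed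
points count as `1`-cycles. -/
def numCycles {S : Type} [Fintype S] [DecidableEq S] (σ : Equiv.Perm S) (k : ℕ) : ℕ :=
  σ.partition.parts.count k

/-- The singular chain complex of a space with rational coefficients. -/
abbrev singularChains (X : Type) [TopologicalSpace X] : ChainComplex (ModuleCat.{0} ℚ) ℕ :=
  ((AlgebraicTopology.singularChainComplexFunctor (ModuleCat.{0} ℚ)).obj
    (ModuleCat.of ℚ ℚ)).obj (TopCat.of X)

/-- The rational singular homology `H_i(X; ℚ)`. -/
abbrev H (i : ℕ) (X : Type) [TopologicalSpace X] : ModuleCat.{0} ℚ :=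
  (singularChains X).homology i

/-- The total rational homology of `X` is finite-dimensional, and the Euler characteristic
`∑ (-1)^i dim H_i(X; ℚ)` equals `m`. -/
def HasEulerChar (X : Type) [TopologicalSpace X] (m : ℤ) : Prop :=
  (∀ i, Module.Finite ℚ (H i X)) ∧ {i | Nontrivial (H i X)}.Finite ∧
    (singularChains X).homologyEulerChar = m

/-- The genus of a closed connected oriented surface: `H_1(X; ℚ)` has (finite) dimension `2g`. -/
def HasGenus (X : Type) [TopologicalSpace X] (g : ℕ) : Prop :=
  Module.Finite ℚ (H 1 X) ∧ Module.finrank ℚ (H 1 X) = 2 * g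

end SquareTiled

end

/-! Cover the closed surface by three open sets adapted to its cell structure: `interiorPattern`
(open squares, one piece per face), `diagonalPattern` (squares minus their diagonals; its components
are neighbourhoods of the edges without endpoints) and `middlePattern` (squares minus their middle
lines; its components are stars of the corners). Each of these sets, and each of their
intersections, is cut inside a square into convex pieces which contract along straight segments,
compatibly with the gluing. All of them therefore deform onto discrete sets, and only their H₀
survives.

For such a cover, the exact sequence 0 → C(A∩B∩D) → ⊕ C(pairs) → C(A) ⊕ C(B) ⊕ C(D) → C({A,B,D}) → 0
of small singular chains reduces everything to linear algebra (`homology_of_resolution`), once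
barycentric subdivision shows that small chains compute singular homology
(`homology_of_three_sets`). It yields h₀ - h₁ + h₂ as an alternating count of components, and H₂ as
the kernel of the maps from the components of the triple intersection to those of the pairwise ones.

For the closed surface the count is (n + 2n + b) - (4n + 4n + 4n) + 8n = b - n. The corners are the
cycles of the commutator, because turning once around the top left corner of a square applies the
commutator (`middleCenters`). Connectedness gives h₀ = 1 and makes the kernel the line spanned by an
alternating orientation cycle, so h₂ = 1 and h₁ = n - b + 2 (`homology_closedSurface`). The open
surface is the union of the first two sets alone, so its Euler characteristic is (n + 2n) - 4n = -n
(`hasEulerChar_openSurface`), and its complement is the set of corners (`encard_compl_openSurface`).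

Finally n - b is even because a commutator is an even permutation, and it vanishes only for the
identity, all cycles then having length one (`exists_card_eq`). With n - b = 2m the genus is m + 1,
which equals 1 exactly when the commutator is trivial. -/

noncomputable section

open CategoryTheory

/-! ### Singular chains as finitely supported functions on simplices, and small chains -/

namespace SquareTiled

/-- Singular `n`-simplices of `T`. -/
abbrev Sing (n : ℕ) (T : Type) [TopologicalSpace T] : Type :=
  C(stdSimplex ℝ (Fin (n + 1)), T)

variable {T : Type} [TopologicalSpace T]

/-- The `i`-th face of a singular simplex. -/
def face {n : ℕ} (σ : Sing (n + 1) T) (i : Fin (n + 2)) : Sing n T :=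
  σ.comp ⟨stdSimplex.map i.succAbove, stdSimplex.continuous_map _⟩

/-- The boundary operator on singular chains. -/
def bd (T : Type) [TopologicalSpace T] (n : ℕ) : (Sing (n + 1) T →₀ ℚ) →ₗ[ℚ] (Sing n T →₀ ℚ) :=
  Finsupp.linearCombination ℚ
    (fun σ => ∑ i : Fin (n + 2), (-1 : ℚ) ^ (i : ℕ) • Finsupp.single (face σ i) (1 : ℚ))

lemma bd_single {n : ℕ} (σ : Sing (n + 1) T) :
    bd T n (Finsupp.single σ 1) =
      ∑ i : Fin (n + 2), (-1 : ℚ) ^ (i : ℕ) • Finsupp.single (face σ i) (1 : ℚ) := by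
  simp [bd]

/-- The simplices of the singular simplicial set are the continuous maps from the standard
simplex. -/
def singEquiv (T : Type) [TopologicalSpace T] (n : ℕ) :
    (TopCat.toSSet.obj (TopCat.of T)).obj (Opposite.op (SimplexCategory.mk n)) ≃ Sing n T :=
  TopCat.toSSetObjEquiv (TopCat.of T) _

lemma singEquiv_δ {n : ℕ}
    (x : (TopCat.toSSet.obj (TopCat.of T)).obj (Opposite.op (SimplexCategory.mk (n + 1))))
    (i : Fin (n + 2)) :
    singEquiv T n (SimplicialObject.δ (TopCat.toSSet.obj (TopCat.of T)) i x) =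
      face (singEquiv T (n + 1) x) i := by
  rfl

/-- The chain complex of the singular simplicial set. -/
abbrev ssetChains (T : Type) [TopologicalSpace T] : ChainComplex (ModuleCat.{0} ℚ) ℕ :=
  (TopCat.toSSet.obj (TopCat.of T)).chainComplex (ModuleCat.of ℚ ℚ)

/-- The generator of the singular chains given by a simplex. -/
abbrev ιSing {n : ℕ}
    (x : (TopCat.toSSet.obj (TopCat.of T)).obj (Opposite.op (SimplexCategory.mk n))) :
    ModuleCat.of ℚ ℚ ⟶ (ssetChains T).X n :=
  (TopCat.toSSet.obj (TopCat.of T)).ιChainComplex x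

/-- The comparison map from Mathlib's singular chains to finitely supported functions. -/
def chainsHom (T : Type) [TopologicalSpace T] (n : ℕ) :
    (ssetChains T).X n ⟶ ModuleCat.of ℚ (Sing n T →₀ ℚ) :=
  Limits.Sigma.desc (fun σ => ModuleCat.ofHom (Finsupp.lsingle (singEquiv T n σ)))

lemma ι_chainsHom (n : ℕ) (x) :
    ιSing x ≫ chainsHom T n = ModuleCat.ofHom (Finsupp.lsingle (singEquiv T n x)) :=
  Limits.colimit.ι_desc _ _

/-- The morphism from a free module given by the images of the basis vectors. -/
def freeDesc {ι : Type} (M : ModuleCat.{0} ℚ) (v : ι → M) : ModuleCat.of ℚ (ι →₀ ℚ) ⟶ M :=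
  ModuleCat.ofHom (Finsupp.linearCombination ℚ v)

lemma freeDesc_single {ι : Type} (M : ModuleCat.{0} ℚ) (v : ι → M) (i : ι) :
    (freeDesc M v).hom (Finsupp.single i (1 : ℚ)) = v i := by
  simp [freeDesc]

/-- The inverse of `chainsHom`. -/
def chainsInv (T : Type) [TopologicalSpace T] (n : ℕ) :
    ModuleCat.of ℚ (Sing n T →₀ ℚ) ⟶ (ssetChains T).X n :=
  freeDesc _ (fun σ => (ιSing ((singEquiv T n).symm σ)).hom (1 : ℚ))

lemma chainsInv_single {n : ℕ} (σ : Sing n T) :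
    (chainsInv T n).hom (Finsupp.single σ (1 : ℚ)) =
      (ιSing ((singEquiv T n).symm σ)).hom (1 : ℚ) :=
  freeDesc_single _ _ _

/-- Singular chains in Mathlib's sense are finitely supported functions on singular simplices. -/
def chainsIso (T : Type) [TopologicalSpace T] (n : ℕ) :
    (ssetChains T).X n ≅ ModuleCat.of ℚ (Sing n T →₀ ℚ) where
  hom := chainsHom T n
  inv := chainsInv T n
  hom_inv_id := by
    refine SSet.chainComplex_hom_ext fun x => ?_
    rw [← Category.assoc, ι_chainsHom, Category.comp_id]
    refine ModuleCat.hom_ext (LinearMap.ext_ring ?_)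
    refine (chainsInv_single _).trans ?_
    rw [Equiv.symm_apply_apply]
  inv_hom_id := by
    ext σ : 3
    have := congrArg (fun f => f.hom (1 : ℚ)) (ι_chainsHom n ((singEquiv T n).symm σ))
    rw [ModuleCat.hom_comp] at this
    refine (congrArg (chainsHom T n).hom (chainsInv_single σ)).trans ?_
    simpa using this

/-- Both differentials are the alternating sum of faces; it suffices to compare them on the
generator of each simplex. -/
lemma chainsIso_comm (n : ℕ) :
    (chainsIso T (n + 1)).hom ≫ ModuleCat.ofHom (bd T n) =
      (ssetChains T).d (n + 1) n ≫ (chainsIso T n).hom := by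
  refine SSet.chainComplex_hom_ext fun x => ?_
  rw [SSet.ιChainComplex_d_assoc]
  change _ ≫ chainsHom T (n + 1) ≫ _ = _ ≫ chainsHom T n
  rw [← Category.assoc, ι_chainsHom, Preadditive.sum_comp]
  simp_rw [Preadditive.zsmul_comp, ι_chainsHom]
  ext
  simp [bd_single, singEquiv_δ]

/-- Transported from the singular complex along `chainsIso`, so the cancellation of signs need not
be repeated. -/
lemma bd_bd (n : ℕ) : bd T n ∘ₗ bd T (n + 1) = 0 := by
  have h : ModuleCat.ofHom (bd T (n + 1)) ≫ ModuleCat.ofHom (bd T n) = 0 := by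
    rw [← cancel_epi (chainsIso T (n + 1 + 1)).hom, reassoc_of% (chainsIso_comm (T := T) (n + 1)),
      chainsIso_comm, HomologicalComplex.d_comp_d_assoc]
    simp
  exact congrArg ModuleCat.Hom.hom h

/-- The simplices whose range is contained in some member of `𝒰`. -/
def smallSing (𝒰 : Set (Set T)) (n : ℕ) : Set (Sing n T) :=
  {σ | ∃ P ∈ 𝒰, Set.range σ ⊆ P}

/-- The chains built from simplices contained in some member of `𝒰`. -/
abbrev smallChains (𝒰 : Set (Set T)) (n : ℕ) : Submodule ℚ (Sing n T →₀ ℚ) :=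
  Finsupp.supported ℚ ℚ (smallSing 𝒰 n)

lemma face_mem_smallSing {𝒰 : Set (Set T)} {n : ℕ} {σ : Sing (n + 1) T}
    (h : σ ∈ smallSing 𝒰 (n + 1)) (i : Fin (n + 2)) : face σ i ∈ smallSing 𝒰 n := by
  obtain ⟨P, hP, h⟩ := h
  refine ⟨P, hP, ?_⟩
  rintro _ ⟨x, rfl⟩
  exact h ⟨_, rfl⟩

lemma single_mem_smallChains {𝒰 : Set (Set T)} {n : ℕ} {σ : Sing n T}
    (h : σ ∈ smallSing 𝒰 n) (a : ℚ) : Finsupp.single σ a ∈ smallChains 𝒰 n :=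
  Finsupp.single_mem_supported ℚ a h

/-- Linear maps preserve small chains if they do so on small simplices. -/
lemma map_mem_of_single {𝒰 : Set (Set T)} {n : ℕ} {M : Type*} [AddCommGroup M] [Module ℚ M]
    {f : (Sing n T →₀ ℚ) →ₗ[ℚ] M} {N : Submodule ℚ M}
    (h : ∀ σ ∈ smallSing 𝒰 n, f (Finsupp.single σ 1) ∈ N) {c : Sing n T →₀ ℚ}
    (hc : c ∈ smallChains 𝒰 n) : f c ∈ N := by
  have : smallChains 𝒰 n ≤ N.comap f := by
    rw [smallChains, Finsupp.supported_eq_span_single, Submodule.span_le]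
    rintro _ ⟨σ, hσ, rfl⟩
    exact h σ hσ
  exact this hc

lemma bd_mem_smallChains {𝒰 : Set (Set T)} {n : ℕ} {c : Sing (n + 1) T →₀ ℚ}
    (hc : c ∈ smallChains 𝒰 (n + 1)) : bd T n c ∈ smallChains 𝒰 n := by
  refine map_mem_of_single (fun σ hσ => ?_) hc
  rw [bd_single]
  exact Submodule.sum_mem _ fun i _ => Submodule.smul_mem _ _
    (single_mem_smallChains (face_mem_smallSing hσ i) _)

/-- The complex of chains built from simplices contained in some member of `𝒰`. -/
def smallComplex (𝒰 : Set (Set T)) : ChainComplex (ModuleCat.{0} ℚ) ℕ :=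
  ChainComplex.of (fun n => ModuleCat.of ℚ (smallChains 𝒰 n))
    (fun n => ModuleCat.ofHom ((bd T n).restrict fun _ h => bd_mem_smallChains h))
    (fun n => by
      ext x : 2
      exact Subtype.ext (LinearMap.congr_fun (bd_bd (T := T) n) x.1))

/-- The inclusion of the chains of a subspace. -/
def subspaceEquiv (P : Set T) (n : ℕ) : Sing n P ≃ smallSing {P} n where
  toFun σ := ⟨(ContinuousMap.mk Subtype.val continuous_subtype_val).comp σ, P, rfl, by
    rintro _ ⟨x, rfl⟩
    exact (σ x).2⟩
  invFun σ := ⟨fun x => ⟨σ.1 x, by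
    obtain ⟨_, rfl, h⟩ := σ.2
    exact h ⟨x, rfl⟩⟩, by fun_prop⟩
  left_inv σ := rfl
  right_inv σ := rfl

/-- The chains of a subspace are the chains of the ambient space with support in it. -/
def subspaceChainsEquiv (P : Set T) (n : ℕ) : (Sing n P →₀ ℚ) ≃ₗ[ℚ] smallChains {P} n :=
  (Finsupp.domLCongr (subspaceEquiv P n)).trans (Finsupp.supportedEquivFinsupp _).symm

lemma coe_subspaceChainsEquiv_single (P : Set T) {n : ℕ} (σ : Sing n P) (a : ℚ) :
    (subspaceChainsEquiv P n (Finsupp.single σ a) : Sing n T →₀ ℚ) =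
      Finsupp.single (subspaceEquiv P n σ : Sing n T) a := by
  rw [subspaceChainsEquiv, LinearEquiv.trans_apply, Finsupp.domLCongr_single,
    Finsupp.supportedEquivFinsupp_symm_single]

lemma bd_subspaceChainsEquiv (P : Set T) {n : ℕ} (c : Sing (n + 1) P →₀ ℚ) :
    bd T n (subspaceChainsEquiv P (n + 1) c : Sing (n + 1) T →₀ ℚ) =
      (subspaceChainsEquiv P n (bd P n c) : Sing n T →₀ ℚ) := by
  induction c using Finsupp.induction_linear with
  | zero => simp
  | add x y hx hy => simp [hx, hy]
  | single σ a =>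
    have : Finsupp.single σ a = a • Finsupp.single σ (1 : ℚ) := by simp
    rw [this]
    simp only [map_smul, Submodule.coe_smul, coe_subspaceChainsEquiv_single, bd_single]
    simp [coe_subspaceChainsEquiv_single]
    rfl

/-- The singular chain complex of a subspace, seen inside the ambient space. -/
def ssetChainsIso (P : Set T) : ssetChains P ≅ smallComplex {P} :=
  HomologicalComplex.Hom.isoOfComponents
    (fun n => chainsIso P n ≪≫ (subspaceChainsEquiv P n).toModuleIso)
    (by
      rintro _ n rfl
      dsimp only [Iso.trans_hom, smallComplex]
      rw [ChainComplex.of_d, Category.assoc, ← reassoc_of% (chainsIso_comm (T := P) n)]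
      congr 1
      refine ModuleCat.hom_ext (LinearMap.ext fun x => ?_)
      exact Subtype.ext (bd_subspaceChainsEquiv P x))

/-- The singular chain complex of a subspace, seen inside the ambient space. -/
def singularChainsIso (P : Set T) : singularChains P ≅ smallComplex {P} :=
  ssetChainsIso P

end SquareTiled

end

/-! ### Formal subdivision of tuples of points -/

noncomputable section

open CategoryTheory

namespace SquareTiled

section Tuples

variable {P Q : Type}

/-- The boundary operator on formal combinations of tuples. -/
def tupleBd (P : Type) (k : ℕ) : ((Fin (k + 1) → P) →₀ ℚ) →ₗ[ℚ] ((Fin k → P) →₀ ℚ) :=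
  Finsupp.linearCombination ℚ
    (fun v => ∑ i : Fin (k + 1), (-1 : ℚ) ^ (i : ℕ) • Finsupp.single (v ∘ i.succAbove) (1 : ℚ))

lemma tupleBd_single {k : ℕ} (v : Fin (k + 1) → P) :
    tupleBd P k (Finsupp.single v 1) =
      ∑ i : Fin (k + 1), (-1 : ℚ) ^ (i : ℕ) • Finsupp.single (v ∘ i.succAbove) (1 : ℚ) := by
  simp [tupleBd]

/-- The cone with apex `p` on a combination of tuples. -/
def tupleCone (p : P) (k : ℕ) : ((Fin k → P) →₀ ℚ) →ₗ[ℚ] ((Fin (k + 1) → P) →₀ ℚ) :=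
  Finsupp.lmapDomain ℚ ℚ (fun v => (Fin.cons p v : Fin (k + 1) → P))

@[simp]
lemma tupleCone_single (p : P) {k : ℕ} (v : Fin k → P) (a : ℚ) :
    tupleCone p k (Finsupp.single v a) = Finsupp.single (Fin.cons p v : Fin (k + 1) → P) a := by
  simp [tupleCone]

/-- Indexing by the length of the tuple includes the empty tuple, so the tuple complex is augmented
and coning works down to the bottom. -/
lemma tupleBd_tupleCone_zero (p : P) (w : (Fin 0 → P) →₀ ℚ) :
    tupleBd P 0 (tupleCone p 0 w) = w := by
  suffices h : tupleBd P 0 ∘ₗ tupleCone p 0 = LinearMap.id from LinearMap.congr_fun h w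
  ext v : 2
  simp only [LinearMap.comp_apply, Finsupp.lsingle_apply, tupleCone_single, tupleBd_single]
  simp [Subsingleton.elim _ v]

lemma cons_comp_succAbove_succ (p : P) {k : ℕ} (v : Fin (k + 1) → P) (i : Fin (k + 1)) :
    (Fin.cons p v : Fin (k + 2) → P) ∘ i.succ.succAbove =
      (Fin.cons p (v ∘ i.succAbove) : Fin (k + 1) → P) := by
  ext j
  refine Fin.cases ?_ (fun j => ?_) j <;> simp

/-- Omitting the apex returns the base; every other face is the cone over a face of the base, with
the sign shifted by one. The whole formalism of subdivision rests on this formula. -/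
lemma tupleBd_tupleCone_succ (p : P) {k : ℕ} (w : (Fin (k + 1) → P) →₀ ℚ) :
    tupleBd P (k + 1) (tupleCone p (k + 1) w) = w - tupleCone p k (tupleBd P k w) := by
  suffices h : tupleBd P (k + 1) ∘ₗ tupleCone p (k + 1) =
      LinearMap.id - tupleCone p k ∘ₗ tupleBd P k from LinearMap.congr_fun h w
  ext v : 2
  simp only [LinearMap.comp_apply, Finsupp.lsingle_apply, tupleCone_single, LinearMap.sub_apply,
    LinearMap.id_apply, tupleBd_single, map_sum, map_smul]
  rw [Fin.sum_univ_succ]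
  simp only [cons_comp_succAbove_succ, Fin.val_succ, pow_succ]
  simp [sub_eq_add_neg, Finset.sum_neg_distrib]

/-- Every tuple is the cone from its first entry over its tail, so the cone formula and induction
replace the usual double sum. -/
lemma tupleBd_tupleBd {k : ℕ} (w : (Fin (k + 2) → P) →₀ ℚ) :
    tupleBd P k (tupleBd P (k + 1) w) = 0 := by
  suffices h : tupleBd P k ∘ₗ tupleBd P (k + 1) = 0 from LinearMap.congr_fun h w
  induction k with
  | zero =>
    ext v : 2
    have : Finsupp.single v (1 : ℚ) = tupleCone (v 0) 1 (Finsupp.single (Fin.tail v) 1) := by simp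
    simp only [LinearMap.comp_apply, Finsupp.lsingle_apply]
    rw [this, tupleBd_tupleCone_succ, map_sub, tupleBd_tupleCone_zero]
    simp
  | succ k ih =>
    ext v : 2
    have : Finsupp.single v (1 : ℚ) = tupleCone (v 0) _ (Finsupp.single (Fin.tail v) 1) := by simp
    simp only [LinearMap.comp_apply, Finsupp.lsingle_apply]
    rw [this, tupleBd_tupleCone_succ, map_sub, tupleBd_tupleCone_succ]
    have := LinearMap.congr_fun (ih 0) (Finsupp.single (Fin.tail v) 1)
    rw [LinearMap.comp_apply] at this
    simp [this]

variable (β : ∀ k : ℕ, (Fin (k + 1) → P) → P) (β' : ∀ k : ℕ, (Fin (k + 1) → Q) → Q)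

/-- The subdivision operator on tuples, for the choice `β` of the centers. -/
def tupleSubdiv : ∀ k : ℕ, ((Fin k → P) →₀ ℚ) →ₗ[ℚ] ((Fin k → P) →₀ ℚ)
  | 0 => LinearMap.id
  | k + 1 => Finsupp.linearCombination ℚ
      (fun v => tupleCone (β k v) k (tupleSubdiv k (tupleBd P k (Finsupp.single v 1))))

/-- The homotopy between the identity and the subdivision operator on tuples. -/
def tupleHomotopy : ∀ k : ℕ, ((Fin k → P) →₀ ℚ) →ₗ[ℚ] ((Fin (k + 1) → P) →₀ ℚ)
  | 0 => 0
  | k + 1 => Finsupp.linearCombination ℚ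
      (fun v => tupleCone (β k v) (k + 1)
        (Finsupp.single v 1 - tupleHomotopy k (tupleBd P k (Finsupp.single v 1))))

lemma tupleSubdiv_succ {k : ℕ} (v : Fin (k + 1) → P) :
    tupleSubdiv β (k + 1) (Finsupp.single v 1) =
      tupleCone (β k v) k (tupleSubdiv β k (tupleBd P k (Finsupp.single v 1))) := by
  simp [tupleSubdiv]

lemma tupleHomotopy_succ {k : ℕ} (v : Fin (k + 1) → P) :
    tupleHomotopy β (k + 1) (Finsupp.single v 1) = tupleCone (β k v) (k + 1)
      (Finsupp.single v 1 - tupleHomotopy β k (tupleBd P k (Finsupp.single v 1))) := by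
  simp [tupleHomotopy]

/-- Write D for the homotopy, S for the subdivision and b for the center of v. By the cone formula,
∂Dv = v - D∂v - b·∂(v - D∂v). By induction ∂D∂v = ∂v - S∂v, so the last cone is b·S∂v = Sv. -/
lemma tupleBd_tupleHomotopy {k : ℕ} (w : (Fin (k + 1) → P) →₀ ℚ) :
    tupleBd P (k + 1) (tupleHomotopy β (k + 1) w) =
      w - tupleSubdiv β (k + 1) w - tupleHomotopy β k (tupleBd P k w) := by
  suffices h : tupleBd P (k + 1) ∘ₗ tupleHomotopy β (k + 1) =
      LinearMap.id - tupleSubdiv β (k + 1) - tupleHomotopy β k ∘ₗ tupleBd P k from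
    LinearMap.congr_fun h w
  induction k with
  | zero =>
    ext v : 2
    simp only [LinearMap.comp_apply, Finsupp.lsingle_apply, LinearMap.sub_apply,
      LinearMap.id_apply, tupleHomotopy_succ, tupleSubdiv_succ, tupleBd_tupleCone_succ]
    simp [tupleHomotopy, tupleSubdiv]
  | succ k ih =>
    ext v : 2
    simp only [LinearMap.comp_apply, Finsupp.lsingle_apply, LinearMap.sub_apply,
      LinearMap.id_apply, tupleHomotopy_succ, tupleSubdiv_succ, tupleBd_tupleCone_succ]
    have := LinearMap.congr_fun (ih 0) (tupleBd P (k + 1) (Finsupp.single v 1))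
    simp only [LinearMap.comp_apply, LinearMap.sub_apply, LinearMap.id_apply,
      tupleBd_tupleBd, map_zero, sub_zero] at this
    rw [map_sub, this]
    simp only [map_sub]
    abel

/-- The map on combinations of tuples induced by a map of points. -/
def tupleMap (φ : P → Q) (k : ℕ) : ((Fin k → P) →₀ ℚ) →ₗ[ℚ] ((Fin k → Q) →₀ ℚ) :=
  Finsupp.lmapDomain ℚ ℚ (fun v => φ ∘ v)

@[simp]
lemma tupleMap_single (φ : P → Q) {k : ℕ} (v : Fin k → P) (a : ℚ) :
    tupleMap φ k (Finsupp.single v a) = Finsupp.single (φ ∘ v) a := by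
  simp [tupleMap]

lemma tupleMap_tupleBd (φ : P → Q) {k : ℕ} (w : (Fin (k + 1) → P) →₀ ℚ) :
    tupleMap φ k (tupleBd P k w) = tupleBd Q k (tupleMap φ (k + 1) w) := by
  suffices h : tupleMap φ k ∘ₗ tupleBd P k = tupleBd Q k ∘ₗ tupleMap φ (k + 1) from
    LinearMap.congr_fun h w
  ext v : 2
  simp [tupleBd_single, Function.comp_assoc]

lemma tupleMap_tupleCone (φ : P → Q) (p : P) {k : ℕ} (w : (Fin k → P) →₀ ℚ) :
    tupleMap φ (k + 1) (tupleCone p k w) = tupleCone (φ p) k (tupleMap φ k w) := by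
  suffices h : tupleMap φ (k + 1) ∘ₗ tupleCone p k = tupleCone (φ p) k ∘ₗ tupleMap φ k from
    LinearMap.congr_fun h w
  ext v : 2
  simp [Fin.comp_cons]

variable {β β'}

/-- Subdivision is built from faces and cones only, so it commutes with every map that respects the
chosen centers. Affine maps respect barycenters, and this is what lets the construction descend to
singular chains. -/
lemma tupleMap_tupleSubdiv {φ : P → Q}
    (hφ : ∀ k v, φ (β k v) = β' k (φ ∘ v)) {k : ℕ} (w : (Fin k → P) →₀ ℚ) :
    tupleMap φ k (tupleSubdiv β k w) = tupleSubdiv β' k (tupleMap φ k w) := by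
  suffices h : tupleMap φ k ∘ₗ tupleSubdiv β k = tupleSubdiv β' k ∘ₗ tupleMap φ k from
    LinearMap.congr_fun h w
  induction k with
  | zero => rfl
  | succ k ih =>
    ext v : 2
    have := LinearMap.congr_fun (ih 0) (tupleBd P k (Finsupp.single v 1))
    simp only [LinearMap.comp_apply] at this
    simp only [LinearMap.comp_apply, Finsupp.lsingle_apply, tupleMap_single, tupleSubdiv_succ,
      tupleMap_tupleCone, this, tupleMap_tupleBd, hφ]

lemma tupleMap_tupleHomotopy {φ : P → Q}
    (hφ : ∀ k v, φ (β k v) = β' k (φ ∘ v)) {k : ℕ} (w : (Fin k → P) →₀ ℚ) :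
    tupleMap φ (k + 1) (tupleHomotopy β k w) = tupleHomotopy β' k (tupleMap φ k w) := by
  suffices h : tupleMap φ (k + 1) ∘ₗ tupleHomotopy β k = tupleHomotopy β' k ∘ₗ tupleMap φ k from
    LinearMap.congr_fun h w
  induction k with
  | zero => simp [tupleHomotopy]
  | succ k ih =>
    ext v : 2
    have := LinearMap.congr_fun (ih 0) (tupleBd P k (Finsupp.single v 1))
    simp only [LinearMap.comp_apply] at this
    simp only [LinearMap.comp_apply, Finsupp.lsingle_apply, tupleMap_single, tupleHomotopy_succ,
      tupleMap_tupleCone, this, tupleMap_tupleBd, hφ, map_sub]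

end Tuples

end SquareTiled

end

/-! ### Barycentric subdivision of singular chains -/

noncomputable section

open CategoryTheory

namespace SquareTiled

/-- The affine map between standard simplices with prescribed images of the vertices. -/
def affineSimplex {k n : ℕ} (v : Fin (k + 1) → stdSimplex ℝ (Fin (n + 1))) :
    C(stdSimplex ℝ (Fin (k + 1)), stdSimplex ℝ (Fin (n + 1))) where
  toFun t := ⟨∑ j, t j • (v j : Fin (n + 1) → ℝ),
    (convex_stdSimplex ℝ (Fin (n + 1))).sum_mem (fun j _ => t.2.1 j) t.2.2 fun j _ => (v j).2⟩
  continuous_toFun := by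
    refine Continuous.subtype_mk (continuous_finsetSum _ fun j _ => ?_) _
    exact ((continuous_apply j).comp continuous_subtype_val).smul continuous_const

lemma affineSimplex_val {k n : ℕ} (v : Fin (k + 1) → stdSimplex ℝ (Fin (n + 1)))
    (t : stdSimplex ℝ (Fin (k + 1))) :
    (affineSimplex v t).1 = ∑ j, t j • (v j).1 := rfl

lemma affineSimplex_apply {k n : ℕ} (v : Fin (k + 1) → stdSimplex ℝ (Fin (n + 1)))
    (t : stdSimplex ℝ (Fin (k + 1))) (i : Fin (n + 1)) :
    affineSimplex v t i = ∑ j, t j * v j i := by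
  change (∑ j, t j • (v j).1) i = _
  rw [Finset.sum_apply]
  rfl

lemma affineSimplex_map {k l n : ℕ} (v : Fin (k + 1) → stdSimplex ℝ (Fin (n + 1)))
    (f : Fin (l + 1) → Fin (k + 1)) (t : stdSimplex ℝ (Fin (l + 1))) :
    affineSimplex v (stdSimplex.map f t) = affineSimplex (v ∘ f) t := by
  ext i
  simp only [affineSimplex_apply, stdSimplex.map_coe, Function.comp,
    FunOnFinite.linearMap_apply_apply, Finset.sum_mul]
  rw [← Finset.sum_fiberwise Finset.univ f]
  refine Finset.sum_congr rfl fun j _ => Finset.sum_congr ?_ fun x hx => ?_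
  · ext; simp
  · rw [(Finset.mem_filter.1 hx).2]

lemma affineSimplex_comp {k l n : ℕ} (v : Fin (k + 1) → stdSimplex ℝ (Fin (n + 1)))
    (w : Fin (l + 1) → stdSimplex ℝ (Fin (k + 1))) :
    affineSimplex (affineSimplex v ∘ w) = (affineSimplex v).comp (affineSimplex w) := by
  ext t i
  simp only [affineSimplex_apply, ContinuousMap.comp_apply, Function.comp, Finset.mul_sum,
    Finset.sum_mul, mul_assoc]
  exact Finset.sum_comm

/-- The vertices of the standard simplex. -/
def vertices (n : ℕ) (j : Fin (n + 1)) : stdSimplex ℝ (Fin (n + 1)) := stdSimplex.vertex j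

lemma affineSimplex_comp_vertices {k n : ℕ} (v : Fin (k + 1) → stdSimplex ℝ (Fin (n + 1))) :
    affineSimplex v ∘ vertices k = v := by
  ext j i
  simp only [Function.comp, vertices, affineSimplex_apply, stdSimplex.vertex_coe]
  simp [Pi.single_apply]

lemma affineSimplex_vertices (n : ℕ) : affineSimplex (vertices n) = ContinuousMap.id _ := by
  ext t i
  simp [vertices, affineSimplex_apply, stdSimplex.vertex_coe, Pi.single_apply]

/-- The barycenter of a tuple of points of the standard simplex. -/
def tupleBarycenter (n k : ℕ) (v : Fin (k + 1) → stdSimplex ℝ (Fin (n + 1))) :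
    stdSimplex ℝ (Fin (n + 1)) :=
  affineSimplex v stdSimplex.barycenter

lemma affineSimplex_tupleBarycenter {l n : ℕ} (u : Fin (l + 1) → stdSimplex ℝ (Fin (n + 1)))
    (k : ℕ) (v : Fin (k + 1) → stdSimplex ℝ (Fin (l + 1))) :
    affineSimplex u (tupleBarycenter l k v) = tupleBarycenter n k (affineSimplex u ∘ v) := by
  rw [tupleBarycenter, tupleBarycenter, affineSimplex_comp]
  rfl

lemma dist_affineSimplex_le {k n : ℕ} {v : Fin (k + 1) → stdSimplex ℝ (Fin (n + 1))}
    {a : stdSimplex ℝ (Fin (n + 1))} {r : ℝ} (h : ∀ j, dist (v j) a ≤ r)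
    (t : stdSimplex ℝ (Fin (k + 1))) : dist (affineSimplex v t) a ≤ r :=
  (convex_closedBall a.1 r).sum_mem (fun j _ => t.2.1 j) t.2.2 fun j _ => h j

/-- The difference between a vertex and the barycenter is the mean of its differences with all k + 1
vertices, one of which is zero; hence the contraction factor k / (k + 1). -/
lemma dist_tupleBarycenter_le {k n : ℕ} {v : Fin (k + 1) → stdSimplex ℝ (Fin (n + 1))}
    {δ : ℝ} (h : ∀ j l, dist (v j) (v l) ≤ δ) (j : Fin (k + 1)) :
    dist (v j) (tupleBarycenter n k v) ≤ k / (k + 1) * δ := by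
  have hk : (0 : ℝ) < k + 1 := by positivity
  have h1 : (v j).1 - (tupleBarycenter n k v).1 =
      ((k : ℝ) + 1)⁻¹ • ∑ l, ((v j).1 - (v l).1) := by
    have : (tupleBarycenter n k v).1 = ((k : ℝ) + 1)⁻¹ • ∑ l, (v l).1 := by
      rw [tupleBarycenter, affineSimplex_val, Finset.smul_sum]
      refine Finset.sum_congr rfl fun l _ => ?_
      congr 1
      change (stdSimplex.barycenter : stdSimplex ℝ (Fin (k + 1))).val l = _
      simp
    rw [this, Finset.sum_sub_distrib, smul_sub]
    congr 1
    rw [Finset.sum_const, Finset.card_univ, Fintype.card_fin, ← Nat.cast_smul_eq_nsmul ℝ,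
      smul_smul]
    push_cast
    rw [inv_mul_cancel₀ hk.ne', one_smul]
  rw [Subtype.dist_eq, dist_eq_norm, h1, norm_smul, Real.norm_of_nonneg (by positivity)]
  have h2 : ‖∑ l, ((v j).1 - (v l).1)‖ ≤ k * δ := by
    rw [← Finset.add_sum_erase _ _ (Finset.mem_univ j), sub_self, zero_add]
    refine (norm_sum_le_of_le _ (fun l _ => ?_)).trans (b := ∑ l ∈ Finset.univ.erase j, δ) ?_
    · rw [← dist_eq_norm]; exact h j l
    · simp
  calc ((k : ℝ) + 1)⁻¹ * _ ≤ ((k : ℝ) + 1)⁻¹ * (k * δ) := by gcongr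
    _ = _ := by field_simp

/-- Linear maps on tuples preserve supports if they do so on basis vectors. -/
lemma map_mem_supported {α γ : Type*} {s : Set α} {t : Submodule ℚ (γ →₀ ℚ)}
    {f : (α →₀ ℚ) →ₗ[ℚ] (γ →₀ ℚ)}
    (h : ∀ a ∈ s, f (Finsupp.single a 1) ∈ t) {c : α →₀ ℚ}
    (hc : c ∈ Finsupp.supported ℚ ℚ s) : f c ∈ t := by
  have : Finsupp.supported ℚ ℚ s ≤ t.comap f := by
    rw [Finsupp.supported_eq_span_single, Submodule.span_le]
    rintro _ ⟨σ, hσ, rfl⟩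
    exact h σ hσ
  exact this hc

lemma tupleBd_single_mem {P : Type} {k : ℕ} {v : Fin (k + 1) → P} {s : Set (Fin k → P)}
    (h : ∀ i : Fin (k + 1), v ∘ i.succAbove ∈ s) :
    tupleBd P k (Finsupp.single v 1) ∈ Finsupp.supported ℚ ℚ s := by
  rw [tupleBd_single]
  exact Submodule.sum_mem _ fun i _ => Submodule.smul_mem _ _
    (Finsupp.single_mem_supported ℚ _ (h i))

lemma tupleCone_mem {P : Type} {k : ℕ} {p : P} {s : Set (Fin k → P)} {t : Set (Fin (k + 1) → P)}
    (h : ∀ v ∈ s, (Fin.cons p v : Fin (k + 1) → P) ∈ t) {w : (Fin k → P) →₀ ℚ}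
    (hw : w ∈ Finsupp.supported ℚ ℚ s) : tupleCone p k w ∈ Finsupp.supported ℚ ℚ t := by
  refine map_mem_supported (fun v hv => ?_) hw
  rw [tupleCone_single]
  exact Finsupp.single_mem_supported ℚ _ (h v hv)

/-- Subdivision does not leave balls. -/
lemma tupleSubdiv_mem_ball (n : ℕ) (a : stdSimplex ℝ (Fin (n + 1))) (r : ℝ) (k : ℕ)
    (v : Fin k → stdSimplex ℝ (Fin (n + 1))) (hv : ∀ j, dist (v j) a ≤ r) :
    tupleSubdiv (tupleBarycenter n) k (Finsupp.single v 1) ∈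
      Finsupp.supported ℚ ℚ {w | ∀ j, dist (w j) a ≤ r} := by
  induction k with
  | zero => exact Finsupp.single_mem_supported ℚ _ (fun j => j.elim0)
  | succ k ih =>
    rw [tupleSubdiv_succ]
    refine tupleCone_mem (s := {w | ∀ j, dist (w j) a ≤ r}) (fun w hw => ?_)
      (map_mem_supported (fun w hw => ih w hw)
        (tupleBd_single_mem (s := {w | ∀ j, dist (w j) a ≤ r}) fun i j => hv _))
    intro j
    refine Fin.cases ?_ (fun j => ?_) j
    · exact dist_affineSimplex_le hv _
    · exact hw j

/-- Subdivision shrinks the diameter. -/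
lemma tupleSubdiv_mem_diam (n N : ℕ) (δ : ℝ) (k : ℕ) (hk : k ≤ N + 1)
    (v : Fin k → stdSimplex ℝ (Fin (n + 1))) (hv : ∀ j l, dist (v j) (v l) ≤ δ) :
    tupleSubdiv (tupleBarycenter n) k (Finsupp.single v 1) ∈
      Finsupp.supported ℚ ℚ {w | ∀ j l, dist (w j) (w l) ≤ N / (N + 1) * δ} := by
  induction k with
  | zero => exact Finsupp.single_mem_supported ℚ _ (fun j => j.elim0)
  | succ k ih =>
    have hδ : 0 ≤ δ := by simpa using hv 0 0
    -- The factor increases with the dimension, so the one for N serves all faces of lower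
    -- dimension.
    have hkN : (k : ℝ) / (k + 1) * δ ≤ N / (N + 1) * δ := by
      refine mul_le_mul_of_nonneg_right ?_ hδ
      have : (k : ℝ) ≤ N := by exact_mod_cast (by omega : k ≤ N)
      rw [div_le_div_iff₀ (by positivity) (by positivity)]
      nlinarith
    rw [tupleSubdiv_succ]
    -- Distances inside a subdivided face are controlled by induction. Distances to the new apex are
    -- controlled because the vertices of the face lie in a ball around the barycenter, and
    -- subdivision does not leave that ball.
    refine tupleCone_mem (s := {w | ∀ j l, dist (w j) (w l) ≤ N / (N + 1) * δ} ∩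
      {w | ∀ j, dist (w j) (tupleBarycenter n k v) ≤ N / (N + 1) * δ}) (fun w hw => ?_) ?_
    · intro j l
      refine Fin.cases ?_ (fun j => ?_) j <;> refine Fin.cases ?_ (fun l => ?_) l
      · simp only [Fin.cons_zero, dist_self]; positivity
      · simp only [Fin.cons_zero, Fin.cons_succ]; rw [dist_comm]; exact hw.2 l
      · exact hw.2 j
      · exact hw.1 j l
    · rw [Finsupp.supported_inter]
      have hb := tupleBd_single_mem (v := v) (s := {w | (∀ j l, dist (w j) (w l) ≤ δ) ∧
        ∀ j, dist (w j) (tupleBarycenter n k v) ≤ N / (N + 1) * δ})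
        fun i => ⟨fun j l => hv _ _, fun j => (dist_tupleBarycenter_le hv _).trans hkN⟩
      exact ⟨map_mem_supported (fun w hw => ih (by omega) w hw.1) hb,
        map_mem_supported (fun w hw => tupleSubdiv_mem_ball n _ _ k w hw.2) hb⟩

lemma tupleSubdiv_iterate_mem (n k : ℕ) (δ : ℝ) (v : Fin (k + 1) → stdSimplex ℝ (Fin (n + 1)))
    (hv : ∀ j l, dist (v j) (v l) ≤ δ) (m : ℕ) :
    (tupleSubdiv (tupleBarycenter n) (k + 1))^[m] (Finsupp.single v 1) ∈
      Finsupp.supported ℚ ℚ {w | ∀ j l, dist (w j) (w l) ≤ ((k : ℝ) / (k + 1)) ^ m * δ} := by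
  induction m with
  | zero => exact Finsupp.single_mem_supported ℚ _ (by simpa using hv)
  | succ m ih =>
    rw [Function.iterate_succ_apply']
    refine map_mem_supported (fun w hw => ?_) ih
    rw [pow_succ', mul_assoc]
    exact tupleSubdiv_mem_diam n k _ _ le_rfl w hw

variable {T : Type} [TopologicalSpace T]

/-- The singular chain obtained by composing a singular simplex with affine simplices. -/
def pushTuple {n : ℕ} (σ : Sing n T) (k : ℕ) :
    ((Fin (k + 1) → stdSimplex ℝ (Fin (n + 1))) →₀ ℚ) →ₗ[ℚ] (Sing k T →₀ ℚ) :=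
  Finsupp.lmapDomain ℚ ℚ (fun v => σ.comp (affineSimplex v))

@[simp]
lemma pushTuple_single {n : ℕ} (σ : Sing n T) {k : ℕ}
    (v : Fin (k + 1) → stdSimplex ℝ (Fin (n + 1))) (a : ℚ) :
    pushTuple σ k (Finsupp.single v a) = Finsupp.single (σ.comp (affineSimplex v)) a := by
  simp [pushTuple]

lemma pushTuple_vertices {n : ℕ} (σ : Sing n T) :
    pushTuple σ n (Finsupp.single (vertices n) 1) = Finsupp.single σ 1 := by
  rw [pushTuple_single, affineSimplex_vertices, ContinuousMap.comp_id]

lemma pushTuple_comp {n l : ℕ} (σ : Sing n T) (v : Fin (l + 1) → stdSimplex ℝ (Fin (n + 1)))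
    {k : ℕ} (w : (Fin (k + 1) → stdSimplex ℝ (Fin (l + 1))) →₀ ℚ) :
    pushTuple (σ.comp (affineSimplex v)) k w =
      pushTuple σ k (tupleMap (affineSimplex v) (k + 1) w) := by
  suffices h : pushTuple (σ.comp (affineSimplex v)) k =
      pushTuple σ k ∘ₗ tupleMap (affineSimplex v) (k + 1) from LinearMap.congr_fun h w
  ext u : 2
  simp [affineSimplex_comp, ContinuousMap.comp_assoc]

/-- Restricting an affine simplex to a face is the same as omitting a vertex, so identities for
tuples become identities for singular chains. -/
lemma bd_pushTuple {n : ℕ} (σ : Sing n T) {k : ℕ}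
    (w : (Fin (k + 2) → stdSimplex ℝ (Fin (n + 1))) →₀ ℚ) :
    bd T k (pushTuple σ (k + 1) w) = pushTuple σ k (tupleBd _ (k + 1) w) := by
  suffices h : bd T k ∘ₗ pushTuple σ (k + 1) = pushTuple σ k ∘ₗ tupleBd _ (k + 1) from
    LinearMap.congr_fun h w
  ext v : 2
  simp only [LinearMap.comp_apply, Finsupp.lsingle_apply, pushTuple_single, bd_single,
    tupleBd_single, map_sum, map_smul]
  refine Finset.sum_congr rfl fun i _ => ?_
  congr 2
  ext t : 1
  exact congrArg σ (affineSimplex_map v _ t)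

/-- Barycentric subdivision of singular chains. -/
def subdiv (T : Type) [TopologicalSpace T] (n : ℕ) : (Sing n T →₀ ℚ) →ₗ[ℚ] (Sing n T →₀ ℚ) :=
  Finsupp.linearCombination ℚ fun σ => pushTuple σ n
    (tupleSubdiv (tupleBarycenter n) (n + 1) (Finsupp.single (vertices n) 1))

/-- The homotopy between the identity and barycentric subdivision. -/
def subdivHomotopy (T : Type) [TopologicalSpace T] (n : ℕ) :
    (Sing n T →₀ ℚ) →ₗ[ℚ] (Sing (n + 1) T →₀ ℚ) :=
  Finsupp.linearCombination ℚ fun σ => pushTuple σ (n + 1)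
    (tupleHomotopy (tupleBarycenter n) (n + 1) (Finsupp.single (vertices n) 1))

lemma subdiv_single {n : ℕ} (σ : Sing n T) :
    subdiv T n (Finsupp.single σ 1) = pushTuple σ n
      (tupleSubdiv (tupleBarycenter n) (n + 1) (Finsupp.single (vertices n) 1)) := by
  simp [subdiv]

lemma subdivHomotopy_single {n : ℕ} (σ : Sing n T) :
    subdivHomotopy T n (Finsupp.single σ 1) = pushTuple σ (n + 1)
      (tupleHomotopy (tupleBarycenter n) (n + 1) (Finsupp.single (vertices n) 1)) := by
  simp [subdivHomotopy]

/-- Consequence of naturality under affine maps: iterated subdivision of a singular simplex can be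
carried out inside the standard simplex, where diameters make sense. -/
lemma subdiv_pushTuple {n : ℕ} (σ : Sing n T) {k : ℕ}
    (w : (Fin (k + 1) → stdSimplex ℝ (Fin (n + 1))) →₀ ℚ) :
    subdiv T k (pushTuple σ k w) = pushTuple σ k (tupleSubdiv (tupleBarycenter n) (k + 1) w) := by
  suffices h : subdiv T k ∘ₗ pushTuple σ k =
      pushTuple σ k ∘ₗ tupleSubdiv (tupleBarycenter n) (k + 1) from LinearMap.congr_fun h w
  ext v : 2
  simp only [LinearMap.comp_apply, Finsupp.lsingle_apply, pushTuple_single, subdiv_single,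
    pushTuple_comp]
  rw [tupleMap_tupleSubdiv (affineSimplex_tupleBarycenter v), tupleMap_single,
    affineSimplex_comp_vertices]

lemma subdivHomotopy_pushTuple {n : ℕ} (σ : Sing n T) {k : ℕ}
    (w : (Fin (k + 1) → stdSimplex ℝ (Fin (n + 1))) →₀ ℚ) :
    subdivHomotopy T k (pushTuple σ k w) =
      pushTuple σ (k + 1) (tupleHomotopy (tupleBarycenter n) (k + 1) w) := by
  suffices h : subdivHomotopy T k ∘ₗ pushTuple σ k =
      pushTuple σ (k + 1) ∘ₗ tupleHomotopy (tupleBarycenter n) (k + 1) from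
    LinearMap.congr_fun h w
  ext v : 2
  simp only [LinearMap.comp_apply, Finsupp.lsingle_apply, pushTuple_single, subdivHomotopy_single,
    pushTuple_comp]
  rw [tupleMap_tupleHomotopy (affineSimplex_tupleBarycenter v), tupleMap_single,
    affineSimplex_comp_vertices]

lemma bd_subdivHomotopy_zero (c : Sing 0 T →₀ ℚ) :
    bd T 0 (subdivHomotopy T 0 c) = c - subdiv T 0 c := by
  suffices h : bd T 0 ∘ₗ subdivHomotopy T 0 = LinearMap.id - subdiv T 0 from
    LinearMap.congr_fun h c
  ext σ : 2
  simp only [LinearMap.comp_apply, Finsupp.lsingle_apply, LinearMap.sub_apply, LinearMap.id_apply,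
    subdiv_single, subdivHomotopy_single, bd_pushTuple, tupleBd_tupleHomotopy, map_sub,
    pushTuple_vertices]
  simp [tupleHomotopy]

lemma bd_subdivHomotopy_succ {n : ℕ} (c : Sing (n + 1) T →₀ ℚ) :
    bd T (n + 1) (subdivHomotopy T (n + 1) c) =
      c - subdiv T (n + 1) c - subdivHomotopy T n (bd T n c) := by
  suffices h : bd T (n + 1) ∘ₗ subdivHomotopy T (n + 1) =
      LinearMap.id - subdiv T (n + 1) - subdivHomotopy T n ∘ₗ bd T n from LinearMap.congr_fun h c
  ext σ : 2
  simp only [LinearMap.comp_apply, Finsupp.lsingle_apply, LinearMap.sub_apply, LinearMap.id_apply,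
    subdiv_single, subdivHomotopy_single, bd_pushTuple, tupleBd_tupleHomotopy, map_sub,
    pushTuple_vertices]
  rw [← subdivHomotopy_pushTuple, ← bd_pushTuple, pushTuple_vertices]

lemma pushTuple_mem_smallChains {𝒰 : Set (Set T)} {n : ℕ} {σ : Sing n T} (hσ : σ ∈ smallSing 𝒰 n)
    {k : ℕ} (w : (Fin (k + 1) → stdSimplex ℝ (Fin (n + 1))) →₀ ℚ) :
    pushTuple σ k w ∈ smallChains 𝒰 k := by
  refine map_mem_supported (s := Set.univ) (fun v _ => ?_) (by simp [Finsupp.supported_univ])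
  obtain ⟨P, hP, h⟩ := hσ
  rw [pushTuple_single]
  refine single_mem_smallChains ⟨P, hP, ?_⟩ _
  rintro _ ⟨x, rfl⟩
  exact h ⟨_, rfl⟩

lemma subdiv_mem_smallChains {𝒰 : Set (Set T)} {n : ℕ} {c : Sing n T →₀ ℚ}
    (hc : c ∈ smallChains 𝒰 n) : subdiv T n c ∈ smallChains 𝒰 n :=
  map_mem_of_single (fun σ hσ => by
    rw [subdiv_single]; exact pushTuple_mem_smallChains hσ _) hc

lemma subdivHomotopy_mem_smallChains {𝒰 : Set (Set T)} {n : ℕ} {c : Sing n T →₀ ℚ}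
    (hc : c ∈ smallChains 𝒰 n) : subdivHomotopy T n c ∈ smallChains 𝒰 (n + 1) :=
  map_mem_of_single (fun σ hσ => by
    rw [subdivHomotopy_single]; exact pushTuple_mem_smallChains hσ _) hc

lemma subdiv_iterate_mem_of_le {𝒰 : Set (Set T)} {n : ℕ} {c : Sing n T →₀ ℚ} {m m' : ℕ}
    (hm : m ≤ m') (hc : (subdiv T n)^[m] c ∈ smallChains 𝒰 n) :
    (subdiv T n)^[m'] c ∈ smallChains 𝒰 n := by
  induction m', hm using Nat.le_induction with
  | base => exact hc
  | succ m' _ ih =>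
    rw [Function.iterate_succ_apply']
    exact subdiv_mem_smallChains ih

/-- The preimages of the members of the cover have a Lebesgue number on the compact simplex, and
iterated subdivision makes the pieces smaller than it. -/
lemma exists_subdiv_iterate_single_mem {𝒰 : Set (Set T)} (h𝒰 : ∀ P ∈ 𝒰, IsOpen P) {n : ℕ}
    {σ : Sing n T} (hσ : Set.range σ ⊆ ⋃₀ 𝒰) :
    ∃ m, (subdiv T n)^[m] (Finsupp.single σ 1) ∈ smallChains 𝒰 n := by
  obtain ⟨ε, hε, h⟩ := lebesgue_number_lemma_of_metric_sUnion
    (s := (Set.univ : Set (stdSimplex ℝ (Fin (n + 1))))) (c := (fun P => σ ⁻¹' P) '' 𝒰)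
    isCompact_univ
    (by rintro _ ⟨P, hP, rfl⟩; exact (h𝒰 P hP).preimage σ.continuous)
    (by
      intro x _
      obtain ⟨P, hP, hx⟩ := hσ ⟨x, rfl⟩
      exact ⟨_, ⟨P, hP, rfl⟩, hx⟩)
  have hq : (n : ℝ) / (n + 1) < 1 := by rw [div_lt_one (by positivity)]; linarith
  have hq0 : (0 : ℝ) ≤ (n : ℝ) / (n + 1) := by positivity
  obtain ⟨δ, hδ⟩ : ∃ δ : ℝ, ∀ j l, dist (vertices n j) (vertices n l) ≤ δ :=
    ⟨Metric.diam (Set.univ : Set (stdSimplex ℝ (Fin (n + 1)))), fun j l =>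
      Metric.dist_le_diam_of_mem isCompact_univ.isBounded trivial trivial⟩
  obtain ⟨m, hm⟩ : ∃ m : ℕ, ((n : ℝ) / (n + 1)) ^ m * δ < ε := by
    have := (tendsto_pow_atTop_nhds_zero_of_lt_one hq0 hq).mul_const δ
    rw [zero_mul] at this
    exact (this.eventually (gt_mem_nhds hε)).exists
  refine ⟨m, ?_⟩
  have hs : ∀ m, (subdiv T n)^[m] (Finsupp.single σ 1) = pushTuple σ n
      ((tupleSubdiv (tupleBarycenter n) (n + 1))^[m] (Finsupp.single (vertices n) 1)) := by
    intro m
    induction m with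
    | zero => exact (pushTuple_vertices σ).symm
    | succ m ih => rw [Function.iterate_succ_apply', Function.iterate_succ_apply', ih,
        subdiv_pushTuple]
  rw [hs]
  refine map_mem_supported (fun w hw => ?_) (tupleSubdiv_iterate_mem n n δ _ hδ m)
  rw [pushTuple_single]
  obtain ⟨_, ⟨P, hP, rfl⟩, hx⟩ := h (w 0) trivial
  refine single_mem_smallChains ⟨P, hP, ?_⟩ _
  rintro _ ⟨t, rfl⟩
  -- All vertices are within ε of the vertex `w 0`, hence so is the whole affine simplex by
  -- convexity of balls.
  exact hx ((dist_affineSimplex_le (fun j => hw j 0) t).trans_lt hm)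

/-- A chain involves finitely many simplices, and further subdivision keeps small chains small; the
maximum of the required numbers of steps works. -/
lemma exists_subdiv_iterate_mem {𝒰 : Set (Set T)} (h𝒰 : ∀ P ∈ 𝒰, IsOpen P) {n : ℕ}
    {c : Sing n T →₀ ℚ} (hc : c ∈ smallChains {⋃₀ 𝒰} n) :
    ∃ m, (subdiv T n)^[m] c ∈ smallChains 𝒰 n := by
  rw [smallChains, Finsupp.supported_eq_span_single] at hc
  have hiter : ∀ m, ⇑((subdiv T n) ^ m) = (subdiv T n)^[m] := fun m => Module.End.coe_pow _ m
  induction hc using Submodule.span_induction with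
  | mem x hx =>
    obtain ⟨σ, ⟨_, rfl, hσ⟩, rfl⟩ := hx
    exact exists_subdiv_iterate_single_mem h𝒰 hσ
  | zero => exact ⟨0, Submodule.zero_mem _⟩
  | add x y _ _ hx hy =>
    obtain ⟨m, hx⟩ := hx
    obtain ⟨m', hy⟩ := hy
    refine ⟨max m m', ?_⟩
    rw [← hiter, map_add, hiter]
    exact Submodule.add_mem _ (subdiv_iterate_mem_of_le (le_max_left _ _) hx)
      (subdiv_iterate_mem_of_le (le_max_right _ _) hy)
  | smul a x _ hx =>
    obtain ⟨m, hx⟩ := hx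
    refine ⟨m, ?_⟩
    rw [← hiter, map_smul, hiter]
    exact Submodule.smul_mem _ _ hx

/-- Chains in degree zero are homologous to small chains. -/
lemma exists_sub_bd_mem_zero {𝒰 : Set (Set T)} (h𝒰 : ∀ P ∈ 𝒰, IsOpen P)
    {c : Sing 0 T →₀ ℚ} (hc : c ∈ smallChains {⋃₀ 𝒰} 0) :
    ∃ e ∈ smallChains {⋃₀ 𝒰} 1, c - bd T 0 e ∈ smallChains 𝒰 0 := by
  obtain ⟨m, hm⟩ := exists_subdiv_iterate_mem h𝒰 hc
  induction m generalizing c with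
  | zero => exact ⟨0, Submodule.zero_mem _, by simpa using hm⟩
  | succ m ih =>
    obtain ⟨e, he, h⟩ := ih (subdiv_mem_smallChains hc) hm
    refine ⟨e + subdivHomotopy T 0 c,
      Submodule.add_mem _ he (subdivHomotopy_mem_smallChains hc), ?_⟩
    rw [map_add, bd_subdivHomotopy_zero]
    convert h using 1
    abel

/-- A chain with small boundary is homologous to a small chain. -/
lemma exists_sub_bd_mem_succ {𝒰 : Set (Set T)} (h𝒰 : ∀ P ∈ 𝒰, IsOpen P) {n : ℕ}
    {c : Sing (n + 1) T →₀ ℚ} (hc : c ∈ smallChains {⋃₀ 𝒰} (n + 1))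
    (hbc : bd T n c ∈ smallChains 𝒰 n) :
    ∃ e ∈ smallChains {⋃₀ 𝒰} (n + 2), c - bd T (n + 1) e ∈ smallChains 𝒰 (n + 1) := by
  obtain ⟨m, hm⟩ := exists_subdiv_iterate_mem h𝒰 hc
  induction m generalizing c with
  | zero => exact ⟨0, Submodule.zero_mem _, by simpa using hm⟩
  | succ m ih =>
    have h1 := bd_subdivHomotopy_succ c
    -- The homotopy formula gives ∂Sc = ∂c - ∂D∂c, which is small since ∂c is; so the induction
    -- hypothesis applies to the subdivided chain.
    have h2 : bd T n (subdiv T (n + 1) c) ∈ smallChains 𝒰 n := by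
      have h3 : subdiv T (n + 1) c = c - subdivHomotopy T n (bd T n c) -
          bd T (n + 1) (subdivHomotopy T (n + 1) c) := by rw [h1]; abel
      have h4 : bd T n (bd T (n + 1) (subdivHomotopy T (n + 1) c)) = 0 :=
        LinearMap.congr_fun (bd_bd n) _
      rw [h3, map_sub, map_sub, h4, sub_zero]
      exact Submodule.sub_mem _ hbc (bd_mem_smallChains (subdivHomotopy_mem_smallChains hbc))
    obtain ⟨e, he, h⟩ := ih (subdiv_mem_smallChains hc) h2 hm
    refine ⟨e + subdivHomotopy T (n + 1) c,
      Submodule.add_mem _ he (subdivHomotopy_mem_smallChains hc), ?_⟩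
    rw [map_add, h1]
    -- Here c - ∂Dc = Sc + D∂c, and the correction D∂c is already small.
    convert Submodule.add_mem _ h (subdivHomotopy_mem_smallChains hbc) using 1
    abel

end SquareTiled

end

/-! ### Homological algebra of complexes with homology in degree zero -/

noncomputable section

open CategoryTheory

namespace SquareTiled

section Algebra

variable {F G : ChainComplex (ModuleCat.{0} ℚ) ℕ}

/-- The projection from the chains in degree zero to homology. -/
def toH0 (F : ChainComplex (ModuleCat.{0} ℚ) ℕ) : F.X 0 ⟶ F.homology 0 :=
  F.pOpcycles 0 ≫ inv (F.homologyι 0)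

lemma toH0_surjective (F : ChainComplex (ModuleCat.{0} ℚ) ℕ) :
    Function.Surjective (toH0 F).hom := by
  have : Epi (toH0 F) := by unfold toH0; infer_instance
  exact (ModuleCat.epi_iff_surjective _).1 this

lemma toH0_naturality (φ : F ⟶ G) :
    toH0 F ≫ HomologicalComplex.homologyMap φ 0 = φ.f 0 ≫ toH0 G := by
  rw [toH0, toH0, ← cancel_mono (G.homologyι 0)]
  simp

/-- In degree zero everything is a cycle, so homology is the cokernel of the last differential. -/
lemma ker_toH0 (F : ChainComplex (ModuleCat.{0} ℚ) ℕ) :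
    LinearMap.ker (toH0 F).hom = LinearMap.range (F.d 1 0).hom := by
  have h : (ShortComplex.mk _ _ (F.d_pOpcycles 1 0)).Exact :=
    ShortComplex.exact_of_g_is_cokernel _ (F.opcyclesIsCokernel 1 0 (by simp))
  rw [h.moduleCat_range_eq_ker]
  ext x
  have h1 : (F.pOpcycles 0).hom x = (F.homologyι 0).hom ((toH0 F).hom x) := by
    have : F.pOpcycles 0 = toH0 F ≫ F.homologyι 0 := by simp [toH0]
    exact congrArg (fun f => f.hom x) this
  have h2 : Function.Injective (F.homologyι 0).hom :=
    (ModuleCat.mono_iff_injective _).1 inferInstance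
  rw [LinearMap.mem_ker, LinearMap.mem_ker]
  refine Iff.trans ?_ (Eq.congr_left h1).symm
  rw [map_eq_zero_iff _ h2]

lemma exactAt_succ_iff (F : ChainComplex (ModuleCat.{0} ℚ) ℕ) (n : ℕ) :
    F.ExactAt (n + 1) ↔ ∀ x : F.X (n + 1), F.d (n + 1) n x = 0 →
      ∃ y : F.X (n + 2), F.d (n + 2) (n + 1) y = x := by
  rw [HomologicalComplex.exactAt_iff' F (n + 2) (n + 1) n (by simp) (by simp),
    ShortComplex.moduleCat_exact_iff]
  rfl

/-- A complex which resolves `E`: its homology is concentrated in degree zero, where it is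
identified with `E` by `ε`. -/
structure Resolves (F : ChainComplex (ModuleCat.{0} ℚ) ℕ) (E : Type) [AddCommGroup E] [Module ℚ E]
    (ε : F.X 0 →ₗ[ℚ] E) : Prop where
  exactAt : ∀ n, F.ExactAt (n + 1)
  ker_eq : LinearMap.ker ε = LinearMap.range (F.d 1 0).hom
  surjective : Function.Surjective ε

variable {E E' : Type} [AddCommGroup E] [Module ℚ E] [AddCommGroup E'] [Module ℚ E']

/-- The homology in degree zero of a resolution. -/
def Resolves.equiv {ε : F.X 0 →ₗ[ℚ] E} (h : Resolves F E ε) : F.homology 0 ≃ₗ[ℚ] E :=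
  ((toH0 F).hom.quotKerEquivOfSurjective (toH0_surjective F)).symm ≪≫ₗ
    Submodule.quotEquivOfEq _ _ ((ker_toH0 F).trans h.ker_eq.symm) ≪≫ₗ
      ε.quotKerEquivOfSurjective h.surjective

lemma Resolves.equiv_toH0 {ε : F.X 0 →ₗ[ℚ] E} (h : Resolves F E ε) (x : F.X 0) :
    h.equiv ((toH0 F).hom x) = ε x := by
  have : ((toH0 F).hom.quotKerEquivOfSurjective (toH0_surjective F)).symm ((toH0 F).hom x) =
      Submodule.Quotient.mk x := by
    rw [LinearEquiv.symm_apply_eq]; rfl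
  rw [Resolves.equiv, LinearEquiv.trans_apply, LinearEquiv.trans_apply, this]
  rfl

/-- Makes the map on H₀ computable from labels of points: the augmentations turn it into an explicit
linear map. -/
lemma Resolves.equiv_homologyMap {ε : F.X 0 →ₗ[ℚ] E} {ε' : G.X 0 →ₗ[ℚ] E'}
    (h : Resolves F E ε) (h' : Resolves G E' ε') (φ : F ⟶ G) (m : E →ₗ[ℚ] E')
    (hm : ∀ x, m (ε x) = ε' ((φ.f 0).hom x)) (y : F.homology 0) :
    h'.equiv ((HomologicalComplex.homologyMap φ 0).hom y) = m (h.equiv y) := by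
  obtain ⟨x, rfl⟩ := toH0_surjective F y
  rw [h.equiv_toH0, hm, ← h'.equiv_toH0]
  congr 1
  exact congrArg (fun f => f.hom x) (toH0_naturality φ)

lemma surjective_homologyMap_zero (φ : F ⟶ G) (hφ : Function.Surjective (φ.f 0).hom) :
    Function.Surjective (HomologicalComplex.homologyMap φ 0).hom := by
  intro y
  obtain ⟨x, rfl⟩ := toH0_surjective G y
  obtain ⟨z, rfl⟩ := hφ x
  exact ⟨(toH0 F).hom z, congrArg (fun f => f.hom z) (toH0_naturality φ)⟩

/-- The bottom of the long exact sequence of a short exact sequence of complexes whose middle term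
has homology concentrated in degree zero. -/
lemma homology_of_acyclic_middle {S : ShortComplex (ChainComplex (ModuleCat.{0} ℚ) ℕ)}
    (hS : S.ShortExact) (h₂ : ∀ n, S.X₂.ExactAt (n + 1))
    [Module.Finite ℚ (S.X₁.homology 0)] [Module.Finite ℚ (S.X₂.homology 0)] :
    (∀ n, Nonempty (S.X₃.homology (n + 2) ≅ S.X₁.homology (n + 1))) ∧
    Module.Finite ℚ (S.X₃.homology 0) ∧ Module.Finite ℚ (S.X₃.homology 1) ∧
    Module.finrank ℚ (S.X₃.homology 1) =
      Module.finrank ℚ (LinearMap.ker (HomologicalComplex.homologyMap S.f 0).hom) ∧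
    Module.finrank ℚ (S.X₃.homology 0) + Module.finrank ℚ (S.X₁.homology 0) =
      Module.finrank ℚ (S.X₂.homology 0) + Module.finrank ℚ (S.X₃.homology 1) := by
  have hz : ∀ n, Limits.IsZero (S.X₂.homology (n + 1)) := fun n => (h₂ n).isZero_homology
  have hδ := hS.mono_δ 1 0 (by simp) (hz 0)
  have hinj := (ModuleCat.mono_iff_injective _).1 hδ
  have h1 := (hS.homology_exact₁ 1 0 (by simp)).moduleCat_range_eq_ker
  have h2 := (hS.homology_exact₂ 0).moduleCat_range_eq_ker
  dsimp only at h1 h2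
  have hepi := hS.epi_g
  have hsurj : Function.Surjective (HomologicalComplex.homologyMap S.g 0).hom :=
    surjective_homologyMap_zero S.g ((ModuleCat.epi_iff_surjective _).1 inferInstance)
  have e : S.X₃.homology 1 ≃ₗ[ℚ]
      LinearMap.ker (HomologicalComplex.homologyMap S.f 0).hom :=
    (LinearEquiv.ofInjective _ hinj).trans (LinearEquiv.ofEq _ _ h1)
  have hf0 : Module.Finite ℚ (S.X₃.homology 0) := Module.Finite.of_surjective _ hsurj
  refine ⟨fun n => ⟨hS.δIso _ _ (by simp) (hz _) (hz _)⟩, hf0,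
    Module.Finite.equiv e.symm, e.finrank_eq, ?_⟩
  rw [e.finrank_eq]
  have r1 := LinearMap.finrank_range_add_finrank_ker (HomologicalComplex.homologyMap S.f 0).hom
  have r2 := LinearMap.finrank_range_add_finrank_ker (HomologicalComplex.homologyMap S.g 0).hom
  rw [LinearMap.range_eq_top.2 hsurj, finrank_top, ← h2] at r2
  omega

/-- The homology of a complex `W` with a resolution `0 → F₀ → F₁ → F₂ → W → 0` by complexes
with homology concentrated in degree zero. -/
theorem homology_of_resolution {F₀ F₁ F₂ W : ChainComplex (ModuleCat.{0} ℚ) ℕ}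
    {i : F₀ ⟶ F₁} {j : F₁ ⟶ F₂} {p : F₂ ⟶ W} (hij : i ≫ j = 0) (hjp : j ≫ p = 0)
    (hi : Mono i) (hp : Epi p) (h₁ : (ShortComplex.mk i j hij).Exact)
    (h₂ : (ShortComplex.mk j p hjp).Exact)
    {E₀ E₁ E₂ : Type} [AddCommGroup E₀] [Module ℚ E₀] [AddCommGroup E₁] [Module ℚ E₁]
    [AddCommGroup E₂] [Module ℚ E₂] [Module.Finite ℚ E₀] [Module.Finite ℚ E₁] [Module.Finite ℚ E₂]
    {ε₀ : F₀.X 0 →ₗ[ℚ] E₀} {ε₁ : F₁.X 0 →ₗ[ℚ] E₁} {ε₂ : F₂.X 0 →ₗ[ℚ] E₂}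
    (r₀ : Resolves F₀ E₀ ε₀) (r₁ : Resolves F₁ E₁ ε₁) (r₂ : Resolves F₂ E₂ ε₂)
    (m : E₀ →ₗ[ℚ] E₁) (hm : ∀ x, m (ε₀ x) = ε₁ ((i.f 0).hom x)) :
    (∀ n, Module.Finite ℚ (W.homology n)) ∧ (∀ n, Subsingleton (W.homology (n + 3))) ∧
    Module.finrank ℚ (W.homology 2) = Module.finrank ℚ (LinearMap.ker m) ∧
    Module.finrank ℚ (W.homology 0) + Module.finrank ℚ (W.homology 2) + Module.finrank ℚ E₁ =
      Module.finrank ℚ (W.homology 1) + Module.finrank ℚ E₀ + Module.finrank ℚ E₂ := by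
  have f₀ : Module.Finite ℚ (F₀.homology 0) := Module.Finite.equiv r₀.equiv.symm
  have f₁ : Module.Finite ℚ (F₁.homology 0) := Module.Finite.equiv r₁.equiv.symm
  have f₂ : Module.Finite ℚ (F₂.homology 0) := Module.Finite.equiv r₂.equiv.symm
  -- The resolution is cut at K = ker p into 0 → F₀ → F₁ → K → 0 and 0 → K → F₂ → W → 0. In both,
  -- the middle term has homology only in degree zero.
  let S₁ : ShortComplex (ChainComplex (ModuleCat.{0} ℚ) ℕ) :=
    ShortComplex.mk i (Limits.kernel.lift p j hjp) (by
      rw [← cancel_mono (Limits.kernel.ι p)]; simpa using hij)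
  let S₂ : ShortComplex (ChainComplex (ModuleCat.{0} ℚ) ℕ) :=
    ShortComplex.mk (Limits.kernel.ι p) p (Limits.kernel.condition p)
  have hS₁ : S₁.ShortExact :=
    { exact := by
        let φ : S₁ ⟶ ShortComplex.mk i j hij :=
          { τ₁ := 𝟙 _, τ₂ := 𝟙 _, τ₃ := Limits.kernel.ι p }
        have : Epi φ.τ₁ := inferInstanceAs (Epi (𝟙 _))
        have : IsIso φ.τ₂ := inferInstanceAs (IsIso (𝟙 _))
        have : Mono φ.τ₃ := inferInstanceAs (Mono (Limits.kernel.ι p))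
        exact (ShortComplex.exact_iff_of_epi_of_isIso_of_mono φ).2 h₁
      mono_f := hi
      epi_g := h₂.epi_kernelLift }
  have hS₂ : S₂.ShortExact :=
    { exact := ShortComplex.exact_of_f_is_kernel _ (Limits.kernelIsKernel p)
      mono_f := inferInstanceAs (Mono (Limits.kernel.ι p))
      epi_g := hp }
  have : Module.Finite ℚ (S₁.X₁.homology 0) := f₀
  have : Module.Finite ℚ (S₁.X₂.homology 0) := f₁
  obtain ⟨a1, a2, a3, a4, a5⟩ := homology_of_acyclic_middle hS₁ r₁.exactAt
  have : Module.Finite ℚ (S₂.X₁.homology 0) := a2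
  have : Module.Finite ℚ (S₂.X₂.homology 0) := f₂
  obtain ⟨b1, b2, b3, b4, b5⟩ := homology_of_acyclic_middle hS₂ r₂.exactAt
  -- Each short exact sequence shifts degrees by one: K can have homology only in degrees 0 and 1,
  -- so W only in degrees 0, 1 and 2.
  have hK : ∀ n, Subsingleton (S₂.X₁.homology (n + 2)) := by
    intro n
    obtain ⟨e⟩ := a1 n
    have := (r₀.exactAt n).isZero_homology
    have := ModuleCat.subsingleton_of_isZero this
    exact e.toLinearEquiv.toEquiv.subsingleton
  have hW : ∀ n, Subsingleton (S₂.X₃.homology (n + 3)) := by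
    intro n
    obtain ⟨e⟩ := b1 (n + 1)
    have := hK n
    exact e.toLinearEquiv.toEquiv.subsingleton
  -- H₂(W) ≅ H₁(K), and H₁(K) is the kernel of H₀(F₀) → H₀(F₁), that is, of m.
  obtain ⟨e2⟩ := b1 0
  have e2' : S₂.X₃.homology 2 ≃ₗ[ℚ] S₁.X₃.homology 1 := e2.toLinearEquiv
  have hker : Module.finrank ℚ (LinearMap.ker (HomologicalComplex.homologyMap S₁.f 0).hom) =
      Module.finrank ℚ (LinearMap.ker m) := by
    refine LinearEquiv.finrank_eq (LinearEquiv.ofSubmodules r₀.equiv _ _ ?_)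
    ext y
    obtain ⟨y, rfl⟩ := r₀.equiv.surjective y
    rw [Submodule.map_equiv_eq_comap_symm]
    simp only [Submodule.mem_comap, LinearMap.mem_ker]
    rw [← r₀.equiv_homologyMap r₁ i m hm]
    simp only [LinearEquiv.coe_coe, LinearEquiv.symm_apply_apply]
    exact (LinearEquiv.map_eq_zero_iff r₁.equiv).symm
  refine ⟨fun n => ?_, hW, ?_, ?_⟩
  · match n with
    | 0 => exact b2
    | 1 => exact b3
    | 2 => exact Module.Finite.equiv e2'.symm
    | n + 3 => have : Subsingleton (W.homology (n + 3)) := hW n; infer_instance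
  · exact e2'.finrank_eq.trans (a4.trans hker)
  · have g0 : Module.finrank ℚ (S₁.X₁.homology 0) = _ := r₀.equiv.finrank_eq
    have g1 : Module.finrank ℚ (S₁.X₂.homology 0) = _ := r₁.equiv.finrank_eq
    have g2 : Module.finrank ℚ (S₂.X₂.homology 0) = _ := r₂.equiv.finrank_eq
    have e3 := e2'.finrank_eq
    have g3 : Module.finrank ℚ (S₂.X₁.homology 0) = Module.finrank ℚ (S₁.X₃.homology 0) := rfl
    change Module.finrank ℚ (S₂.X₃.homology 0) + Module.finrank ℚ (S₂.X₃.homology 2) + _ =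
      Module.finrank ℚ (S₂.X₃.homology 1) + _ + _
    omega

end Algebra

end SquareTiled

end

/-! ### The Mayer–Vietoris resolution for three subsets -/

noncomputable section

open CategoryTheory

namespace SquareTiled

variable {T : Type} [TopologicalSpace T]

/-- The boundary operator on small chains. -/
def smallBd (𝒰 : Set (Set T)) (n : ℕ) : smallChains 𝒰 (n + 1) →ₗ[ℚ] smallChains 𝒰 n :=
  (bd T n).restrict fun _ h => bd_mem_smallChains h

@[simp]
lemma coe_smallBd {𝒰 : Set (Set T)} {n : ℕ} (c : smallChains 𝒰 (n + 1)) :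
    (smallBd 𝒰 n c : Sing n T →₀ ℚ) = bd T n c := rfl

lemma smallBd_smallBd {𝒰 : Set (Set T)} {n : ℕ} (c : smallChains 𝒰 (n + 2)) :
    smallBd 𝒰 n (smallBd 𝒰 (n + 1) c) = 0 :=
  Subtype.ext (LinearMap.congr_fun (bd_bd (T := T) n) c.1)

lemma smallComplex_d (𝒰 : Set (Set T)) (n : ℕ) :
    (smallComplex 𝒰).d (n + 1) n = ModuleCat.ofHom (smallBd 𝒰 n) := by
  dsimp only [smallComplex]
  rw [ChainComplex.of_d]
  rfl

/-- The direct sum of three complexes of small chains. -/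
def tripleComplex (𝒰 𝒱 𝒲 : Set (Set T)) : ChainComplex (ModuleCat.{0} ℚ) ℕ :=
  ChainComplex.of
    (fun n => ModuleCat.of ℚ (smallChains 𝒰 n × smallChains 𝒱 n × smallChains 𝒲 n))
    (fun n => ModuleCat.ofHom
      ((smallBd 𝒰 n).prodMap ((smallBd 𝒱 n).prodMap (smallBd 𝒲 n))))
    (fun n => by
      refine ModuleCat.hom_ext (LinearMap.ext fun x => ?_)
      refine Prod.ext ?_ (Prod.ext ?_ ?_) <;> exact smallBd_smallBd _)

lemma tripleComplex_d (𝒰 𝒱 𝒲 : Set (Set T)) (n : ℕ) :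
    (tripleComplex 𝒰 𝒱 𝒲).d (n + 1) n = ModuleCat.ofHom
      ((smallBd 𝒰 n).prodMap ((smallBd 𝒱 n).prodMap (smallBd 𝒲 n))) := by
  dsimp only [tripleComplex]
  rw [ChainComplex.of_d]

/-- The augmentation of the chains in degree zero given by a function on points. -/
def pointEval {E : Type} [AddCommGroup E] [Module ℚ E] (f : T → E) : (Sing 0 T →₀ ℚ) →ₗ[ℚ] E :=
  Finsupp.linearCombination ℚ fun σ => f (σ default)

/-- The singular homology of `P` is concentrated in degree zero, where it is identified with `E`
by `f`. -/
structure AcyclicOver (P : Set T) (E : Type) [AddCommGroup E] [Module ℚ E] (f : T → E) :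
    Prop where
  exact : ∀ n, ∀ c : smallChains {P} (n + 1), smallBd {P} n c = 0 → ∃ e, smallBd {P} (n + 1) e = c
  bd_eq_zero : ∀ e : smallChains {P} 1, pointEval f (smallBd {P} 0 e) = 0
  exists_bd : ∀ c : smallChains {P} 0, pointEval f c = 0 → ∃ e, smallBd {P} 0 e = c
  surjective : ∀ y, ∃ c : smallChains {P} 0, pointEval f c = y

lemma AcyclicOver.resolves {P : Set T} {E : Type} [AddCommGroup E] [Module ℚ E] {f : T → E}
    (h : AcyclicOver P E f) :
    Resolves (smallComplex {P}) E (pointEval f ∘ₗ (smallChains {P} 0).subtype) where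
  exactAt n := by
    rw [exactAt_succ_iff, smallComplex_d, smallComplex_d]
    exact h.exact n
  ker_eq := by
    rw [smallComplex_d]
    refine le_antisymm (fun c hc => h.exists_bd c hc) ?_
    rintro _ ⟨e, rfl⟩
    exact h.bd_eq_zero e
  surjective := h.surjective

lemma AcyclicOver.resolves_triple {P₁ P₂ P₃ : Set T} {E₁ E₂ E₃ : Type} [AddCommGroup E₁]
    [Module ℚ E₁] [AddCommGroup E₂] [Module ℚ E₂] [AddCommGroup E₃] [Module ℚ E₃] {f₁ : T → E₁}
    {f₂ : T → E₂} {f₃ : T → E₃}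
    (h₁ : AcyclicOver P₁ E₁ f₁) (h₂ : AcyclicOver P₂ E₂ f₂) (h₃ : AcyclicOver P₃ E₃ f₃) :
    Resolves (tripleComplex {P₁} {P₂} {P₃}) (E₁ × E₂ × E₃)
      ((pointEval f₁ ∘ₗ (smallChains {P₁} 0).subtype).prodMap
        ((pointEval f₂ ∘ₗ (smallChains {P₂} 0).subtype).prodMap
          (pointEval f₃ ∘ₗ (smallChains {P₃} 0).subtype))) where
  exactAt n := by
    rw [exactAt_succ_iff, tripleComplex_d, tripleComplex_d]
    rintro ⟨c₁, c₂, c₃⟩ hc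
    have hc' : smallBd _ n c₁ = 0 ∧ smallBd _ n c₂ = 0 ∧ smallBd _ n c₃ = 0 :=
      ⟨congrArg Prod.fst hc, congrArg (fun x => x.2.1) hc, congrArg (fun x => x.2.2) hc⟩
    obtain ⟨e₁, rfl⟩ := h₁.exact n c₁ hc'.1
    obtain ⟨e₂, rfl⟩ := h₂.exact n c₂ hc'.2.1
    obtain ⟨e₃, rfl⟩ := h₃.exact n c₃ hc'.2.2
    exact ⟨(e₁, e₂, e₃), rfl⟩
  ker_eq := by
    rw [tripleComplex_d]
    refine le_antisymm ?_ ?_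
    · rintro ⟨c₁, c₂, c₃⟩ hc
      obtain ⟨e₁, rfl⟩ := h₁.exists_bd c₁ (congrArg Prod.fst hc)
      obtain ⟨e₂, rfl⟩ := h₂.exists_bd c₂ (congrArg (fun x => x.2.1) hc)
      obtain ⟨e₃, rfl⟩ := h₃.exists_bd c₃ (congrArg (fun x => x.2.2) hc)
      exact ⟨(e₁, e₂, e₃), rfl⟩
    · rintro _ ⟨⟨e₁, e₂, e₃⟩, rfl⟩
      exact Prod.ext (h₁.bd_eq_zero e₁) (Prod.ext (h₂.bd_eq_zero e₂) (h₃.bd_eq_zero e₃))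
  surjective := by
    rintro ⟨y₁, y₂, y₃⟩
    obtain ⟨c₁, rfl⟩ := h₁.surjective y₁
    obtain ⟨c₂, rfl⟩ := h₂.surjective y₂
    obtain ⟨c₃, rfl⟩ := h₃.surjective y₃
    exact ⟨(c₁, c₂, c₃), rfl⟩

lemma smallSing_mono {𝒰 𝒱 : Set (Set T)} (h : ∀ P ∈ 𝒰, ∃ Q ∈ 𝒱, P ⊆ Q) (n : ℕ) :
    smallSing 𝒰 n ⊆ smallSing 𝒱 n := by
  rintro σ ⟨P, hP, hσ⟩
  obtain ⟨Q, hQ, hPQ⟩ := h P hP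
  exact ⟨Q, hQ, hσ.trans hPQ⟩

lemma smallChains_mono {𝒰 𝒱 : Set (Set T)} (h : ∀ P ∈ 𝒰, ∃ Q ∈ 𝒱, P ⊆ Q) (n : ℕ) :
    smallChains 𝒰 n ≤ smallChains 𝒱 n :=
  Finsupp.supported_mono (smallSing_mono h n)

lemma exists_superset_singleton {X : Type} {P Q : Set X} (h : P ⊆ Q) :
    ∀ R ∈ ({P} : Set (Set X)), ∃ R' ∈ ({Q} : Set (Set X)), R ⊆ R' := by
  simpa using h

lemma smallChains_singleton_mono {P Q : Set T} (h : P ⊆ Q) (n : ℕ) :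
    smallChains {P} n ≤ smallChains {Q} n :=
  smallChains_mono (exists_superset_singleton h) n

/-- Small chains are spanned by basis vectors, so set operations on simplices become lattice
operations on submodules. Exactness of the resolution rests on this and its companions for unions.
-/
lemma smallChains_inter (P Q : Set T) (n : ℕ) :
    smallChains {P ∩ Q} n = smallChains {P} n ⊓ smallChains {Q} n := by
  rw [smallChains, smallChains, smallChains, ← Finsupp.supported_inter]
  congr 1
  ext σ
  simp [smallSing]

lemma smallChains_pair (P Q : Set T) (n : ℕ) :
    smallChains {P, Q} n = smallChains {P} n ⊔ smallChains {Q} n := by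
  rw [smallChains, smallChains, smallChains, ← Finsupp.supported_union]
  congr 1
  ext σ
  simp [smallSing]

lemma smallChains_triple (P Q R : Set T) (n : ℕ) :
    smallChains {P, Q, R} n = smallChains {P} n ⊔ smallChains {Q} n ⊔ smallChains {R} n := by
  rw [smallChains, smallChains, smallChains, smallChains, ← Finsupp.supported_union,
    ← Finsupp.supported_union]
  congr 1
  ext σ
  simp [smallSing, or_assoc]

/-- Since a = -b - d, every simplex occurring in a lies in A and in one of B, D; sort the simplices
accordingly. -/
lemma exists_add_of_mem_inter {A B D : Set T} {n : ℕ} {a b d : Sing n T →₀ ℚ}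
    (ha : a ∈ smallChains {A} n) (hb : b ∈ smallChains {B} n) (hd : d ∈ smallChains {D} n)
    (h : a + b + d = 0) :
    ∃ u ∈ smallChains {A ∩ B} n, ∃ v ∈ smallChains {A ∩ D} n, u + v = a := by
  have h1 : a ∈ smallChains {B, D} n := by
    rw [smallChains_pair]
    have : a = -b + -d := by rw [← sub_eq_zero, ← h]; abel
    rw [this]
    exact Submodule.add_mem_sup (Submodule.neg_mem _ hb) (Submodule.neg_mem _ hd)
  have h2 : a ∈ smallChains {A ∩ B, A ∩ D} n := by
    have : smallChains {A ∩ B, A ∩ D} n = smallChains {A} n ⊓ smallChains {B, D} n := by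
      rw [smallChains, smallChains, smallChains, ← Finsupp.supported_inter]
      congr 1
      ext σ
      simp [smallSing, and_or_left]
    rw [this]
    exact ⟨ha, h1⟩
  rw [smallChains_pair] at h2
  obtain ⟨u, hu, v, hv, h⟩ := Submodule.mem_sup.1 h2
  exact ⟨u, hu, v, hv, h⟩

/-- The inclusion of small chains. -/
def smallIncl {𝒰 𝒱 : Set (Set T)} (h : ∀ P ∈ 𝒰, ∃ Q ∈ 𝒱, P ⊆ Q) (n : ℕ) :
    smallChains 𝒰 n →ₗ[ℚ] smallChains 𝒱 n :=
  Submodule.inclusion (smallChains_mono h n)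

@[simp]
lemma coe_smallIncl {𝒰 𝒱 : Set (Set T)} (h : ∀ P ∈ 𝒰, ∃ Q ∈ 𝒱, P ⊆ Q) {n : ℕ}
    (c : smallChains 𝒰 n) : (smallIncl h n c : Sing n T →₀ ℚ) = c := rfl

/-- The inclusion of complexes of small chains. -/
def smallComplexIncl {𝒰 𝒱 : Set (Set T)} (h : ∀ P ∈ 𝒰, ∃ Q ∈ 𝒱, P ⊆ Q) :
    smallComplex 𝒰 ⟶ smallComplex 𝒱 where
  f n := ModuleCat.ofHom (smallIncl h n)
  comm' := by
    rintro _ n rfl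
    rw [smallComplex_d, smallComplex_d]
    rfl

section Resolution

variable (A B D : Set T)

/-- The first map of the resolution attached to three subsets, in degree `n`. -/
def linearI (n : ℕ) : smallChains {A ∩ B ∩ D} n →ₗ[ℚ]
    smallChains {A ∩ B} n × smallChains {A ∩ D} n × smallChains {B ∩ D} n :=
  (smallIncl (exists_superset_singleton Set.inter_subset_left) n).prod
    ((-smallIncl (exists_superset_singleton
      (Set.inter_subset_inter_left _ Set.inter_subset_left)) n).prod
      (smallIncl (exists_superset_singleton
        (Set.inter_subset_inter_left _ Set.inter_subset_right)) n))

/-- The second map of the resolution attached to three subsets, in degree `n`. -/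
def linearJ (n : ℕ) : smallChains {A ∩ B} n × smallChains {A ∩ D} n × smallChains {B ∩ D} n →ₗ[ℚ]
    smallChains {A} n × smallChains {B} n × smallChains {D} n :=
  ((smallIncl (by simp) n).coprod ((smallIncl (by simp) n).coprod 0)).prod
    (((-smallIncl (by simp) n).coprod (LinearMap.coprod 0 (smallIncl (by simp) n))).prod
      (LinearMap.coprod 0 ((-smallIncl (by simp) n).coprod (-smallIncl (by simp) n))))

/-- The last map of the resolution attached to three subsets, in degree `n`. -/
def linearP (n : ℕ) : smallChains {A} n × smallChains {B} n × smallChains {D} n →ₗ[ℚ]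
    smallChains {A, B, D} n :=
  (smallIncl (by simp) n).coprod ((smallIncl (by simp) n).coprod (smallIncl (by simp) n))

variable {A B D}

lemma linearI_1 {n : ℕ} (x) : ((linearI A B D n x).1 : Sing n T →₀ ℚ) = x := rfl
lemma linearI_2 {n : ℕ} (x) : ((linearI A B D n x).2.1 : Sing n T →₀ ℚ) = -x := rfl
lemma linearI_3 {n : ℕ} (x) : ((linearI A B D n x).2.2 : Sing n T →₀ ℚ) = x := rfl
lemma linearJ_1 {n : ℕ} (x) :
    ((linearJ A B D n x).1 : Sing n T →₀ ℚ) = x.1 + x.2.1 := by simp [linearJ]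
lemma linearJ_2 {n : ℕ} (x) :
    ((linearJ A B D n x).2.1 : Sing n T →₀ ℚ) = -x.1 + x.2.2 := by simp [linearJ]
lemma linearJ_3 {n : ℕ} (x) :
    ((linearJ A B D n x).2.2 : Sing n T →₀ ℚ) = -x.2.1 + -x.2.2 := by simp [linearJ]
lemma coe_linearP {n : ℕ} (x) :
    (linearP A B D n x : Sing n T →₀ ℚ) = x.1 + (x.2.1 + x.2.2) := rfl

lemma linearI_injective (n : ℕ) : Function.Injective (linearI A B D n) := by
  intro x y h
  exact Subtype.ext (congrArg (fun z => (z.1 : Sing n T →₀ ℚ)) h)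

lemma exact_linearI_linearJ (n : ℕ) :
    Function.Exact (linearI A B D n) (linearJ A B D n) := by
  intro x
  constructor
  · intro h
    have h1 : (x.1 + x.2.1 : Sing n T →₀ ℚ) = 0 := by
      rw [← linearJ_1, h]; rfl
    have h2 : (-x.1 + x.2.2 : Sing n T →₀ ℚ) = 0 := by
      rw [← linearJ_2, h]; rfl
    have hm : (x.1 : Sing n T →₀ ℚ) ∈ smallChains {A ∩ B ∩ D} n := by
      rw [smallChains_inter]
      refine ⟨x.1.2, ?_⟩
      have h3 : (x.1 : Sing n T →₀ ℚ) = x.2.2 := neg_add_eq_zero.1 h2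
      exact h3 ▸ smallChains_singleton_mono Set.inter_subset_right n x.2.2.2
    refine ⟨⟨x.1, hm⟩, Prod.ext rfl (Prod.ext (Subtype.ext ?_) (Subtype.ext ?_))⟩
    · exact neg_eq_of_add_eq_zero_right h1
    · exact neg_add_eq_zero.1 h2
  · rintro ⟨c, rfl⟩
    refine Prod.ext (Subtype.ext ?_) (Prod.ext (Subtype.ext ?_) (Subtype.ext ?_))
    · rw [linearJ_1, linearI_1, linearI_2]; exact add_neg_cancel _
    · rw [linearJ_2, linearI_1, linearI_3]; exact neg_add_cancel _
    · rw [linearJ_3, linearI_2, linearI_3]; exact neg_add_cancel _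

lemma exact_linearJ_linearP (n : ℕ) :
    Function.Exact (linearJ A B D n) (linearP A B D n) := by
  rintro ⟨a, b, d⟩
  constructor
  · intro h
    have h1 : (a + b + d : Sing n T →₀ ℚ) = 0 := by
      rw [add_assoc]
      exact congrArg Subtype.val h
    obtain ⟨u, hu, v, hv, huv⟩ := exists_add_of_mem_inter a.2 b.2 d.2 h1
    -- The (B ∩ D)-component is forced to be b + u by the second coordinate; as it equals -(d + v),
    -- it is supported in D as well as in B.
    have hw : (b + u : Sing n T →₀ ℚ) ∈ smallChains {B ∩ D} n := by
      rw [smallChains_inter]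
      constructor
      · exact Submodule.add_mem _ b.2 (smallChains_singleton_mono Set.inter_subset_right n hu)
      · have : (b + u : Sing n T →₀ ℚ) = -(d + v) := by
          rw [← sub_eq_zero, ← h1, ← huv]; abel
        rw [this]
        exact Submodule.neg_mem _
          (Submodule.add_mem _ d.2 (smallChains_singleton_mono Set.inter_subset_right n hv))
    refine ⟨(⟨u, hu⟩, ⟨v, hv⟩, ⟨_, hw⟩),
      Prod.ext (Subtype.ext ?_) (Prod.ext (Subtype.ext ?_) (Subtype.ext ?_))⟩
    · rw [linearJ_1]; exact huv
    · rw [linearJ_2]; simp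
    · rw [linearJ_3]
      change -v + -((b : Sing n T →₀ ℚ) + u) = d
      rw [← sub_eq_zero, ← neg_eq_zero, ← h1, ← huv]; abel
  · rintro ⟨x, h⟩
    rw [← h]
    refine Subtype.ext ?_
    rw [coe_linearP, linearJ_1, linearJ_2, linearJ_3]
    change _ = (0 : Sing n T →₀ ℚ)
    abel

lemma linearP_surjective (n : ℕ) : Function.Surjective (linearP A B D n) := by
  rintro ⟨c, hc⟩
  rw [smallChains_triple] at hc
  obtain ⟨ab, hab, d, hd, rfl⟩ := Submodule.mem_sup.1 hc
  obtain ⟨a, ha, b, hb, rfl⟩ := Submodule.mem_sup.1 hab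
  exact ⟨(⟨a, ha⟩, ⟨b, hb⟩, ⟨d, hd⟩), Subtype.ext (add_assoc a b d).symm⟩

variable (A B D)

lemma linearI_comm (n : ℕ) :
    ((smallBd {A ∩ B} n).prodMap ((smallBd {A ∩ D} n).prodMap (smallBd {B ∩ D} n))) ∘ₗ linearI A B D (n + 1) =
      linearI A B D n ∘ₗ (smallBd {A ∩ B ∩ D} n) := by
  refine LinearMap.ext fun x => ?_
  refine Prod.ext rfl (Prod.ext (Subtype.ext ?_) rfl)
  exact map_neg (bd T n) _

/-- The first map of the resolution attached to three subsets. -/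
def resolutionI : smallComplex {A ∩ B ∩ D} ⟶ tripleComplex {A ∩ B} {A ∩ D} {B ∩ D} where
  f n := ModuleCat.ofHom (linearI A B D n)
  comm' := by
    rintro _ n rfl
    rw [smallComplex_d, tripleComplex_d]
    exact congrArg ModuleCat.ofHom (linearI_comm A B D n)

lemma linearJ_comm (n : ℕ) :
    ((smallBd {A} n).prodMap ((smallBd {B} n).prodMap (smallBd {D} n))) ∘ₗ linearJ A B D (n + 1) =
      linearJ A B D n ∘ₗ ((smallBd {A ∩ B} n).prodMap ((smallBd {A ∩ D} n).prodMap (smallBd {B ∩ D} n))) := by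
  refine LinearMap.ext fun x => ?_
  refine Prod.ext (Subtype.ext ?_) (Prod.ext (Subtype.ext ?_) (Subtype.ext ?_))
  · refine Eq.trans ?_ (linearJ_1 _).symm
    refine (congrArg (bd T n) (linearJ_1 _)).trans (map_add _ _ _)
  · refine Eq.trans ?_ (linearJ_2 _).symm
    refine (congrArg (bd T n) (linearJ_2 _)).trans ?_
    rw [map_add, map_neg]; rfl
  · refine Eq.trans ?_ (linearJ_3 _).symm
    refine (congrArg (bd T n) (linearJ_3 _)).trans ?_
    rw [map_add, map_neg, map_neg]; rfl

/-- The second map of the resolution attached to three subsets. -/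
def resolutionJ : tripleComplex {A ∩ B} {A ∩ D} {B ∩ D} ⟶ tripleComplex {A} {B} {D} where
  f n := ModuleCat.ofHom (linearJ A B D n)
  comm' := by
    rintro _ n rfl
    rw [tripleComplex_d, tripleComplex_d]
    exact congrArg ModuleCat.ofHom (linearJ_comm A B D n)

lemma linearP_comm (n : ℕ) :
    (smallBd {A, B, D} n) ∘ₗ linearP A B D (n + 1) =
      linearP A B D n ∘ₗ ((smallBd {A} n).prodMap ((smallBd {B} n).prodMap (smallBd {D} n))) := by
  refine LinearMap.ext fun x => Subtype.ext ?_
  refine Eq.trans ?_ (coe_linearP _).symm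
  refine (congrArg (bd T n) (coe_linearP _)).trans ?_
  rw [map_add, map_add]; rfl

/-- The last map of the resolution attached to three subsets. -/
def resolutionP : tripleComplex {A} {B} {D} ⟶ smallComplex {A, B, D} where
  f n := ModuleCat.ofHom (linearP A B D n)
  comm' := by
    rintro _ n rfl
    rw [tripleComplex_d, smallComplex_d]
    exact congrArg ModuleCat.ofHom (linearP_comm A B D n)

lemma resolutionI_comp : resolutionI A B D ≫ resolutionJ A B D = 0 := by
  ext n : 1
  exact ModuleCat.hom_ext (LinearMap.ext fun x =>
    (exact_linearI_linearJ n).apply_apply_eq_zero x)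

lemma resolutionJ_comp : resolutionJ A B D ≫ resolutionP A B D = 0 := by
  ext n : 1
  exact ModuleCat.hom_ext (LinearMap.ext fun x =>
    (exact_linearJ_linearP n).apply_apply_eq_zero x)

lemma mono_resolutionI : Mono (resolutionI A B D) :=
  HomologicalComplex.mono_of_mono_f _ fun n =>
    (ModuleCat.mono_iff_injective _).2 (linearI_injective n)

lemma epi_resolutionP : Epi (resolutionP A B D) :=
  HomologicalComplex.epi_of_epi_f _ fun n =>
    (ModuleCat.epi_iff_surjective _).2 (linearP_surjective n)

lemma exact_resolutionI : (ShortComplex.mk _ _ (resolutionI_comp A B D)).Exact :=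
  HomologicalComplex.exact_of_degreewise_exact _ fun n =>
    (ShortComplex.ShortExact.moduleCat_exact_iff_function_exact _).2 (exact_linearI_linearJ n)

lemma exact_resolutionJ : (ShortComplex.mk _ _ (resolutionJ_comp A B D)).Exact :=
  HomologicalComplex.exact_of_degreewise_exact _ fun n =>
    (ShortComplex.ShortExact.moduleCat_exact_iff_function_exact _).2 (exact_linearJ_linearP n)

end Resolution

end SquareTiled

end

/-! ### Small chains compute homology; the three-set theorem -/

noncomputable section

open CategoryTheory

namespace SquareTiled

variable {T : Type} [TopologicalSpace T]

/-- A subcomplex such that the quotient is acyclic has the same homology. -/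
lemma isIso_homologyMap_of_relative_exact {F G : ChainComplex (ModuleCat.{0} ℚ) ℕ} (φ : F ⟶ G)
    [Mono φ]
    (h₀ : ∀ c : G.X 0, ∃ e : G.X 1, ∃ w : F.X 0, c = (φ.f 0).hom w + (G.d 1 0).hom e)
    (h₁ : ∀ n, ∀ c : G.X (n + 1), ∀ w : F.X n, (G.d (n + 1) n).hom c = (φ.f n).hom w →
      ∃ e : G.X (n + 2), ∃ w : F.X (n + 1),
        c = (φ.f (n + 1)).hom w + (G.d (n + 2) (n + 1)).hom e) (n : ℕ) :
    IsIso (HomologicalComplex.homologyMap φ n) := by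
  -- The hypotheses say that every relative cycle is a relative boundary, so the cokernel is acyclic
  -- and the long exact sequence gives an isomorphism.
  let S : ShortComplex (ChainComplex (ModuleCat.{0} ℚ) ℕ) :=
    ShortComplex.mk φ (Limits.cokernel.π φ) (Limits.cokernel.condition φ)
  have hS : S.ShortExact :=
    { exact := ShortComplex.exact_of_g_is_cokernel _ (Limits.cokernelIsCokernel φ)
      mono_f := inferInstanceAs (Mono φ)
      epi_g := inferInstanceAs (Epi (Limits.cokernel.π φ)) }
  have hS' := fun n => (HomologicalComplex.shortExact_iff_degreewise_shortExact S).1 hS n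
  have hsurj : ∀ n, Function.Surjective (S.g.f n).hom := fun n => (hS' n).moduleCat_surjective_g
  have hzero : ∀ n (w : F.X n), (S.g.f n).hom ((φ.f n).hom w) = 0 := fun n w =>
    ShortComplex.moduleCat_zero_apply (S.map (HomologicalComplex.eval _ _ n)) w
  have hexact : ∀ n (c : G.X n), (S.g.f n).hom c = 0 → ∃ w : F.X n, (φ.f n).hom w = c :=
    fun n c hc => (ShortComplex.moduleCat_exact_iff _).1 (hS' n).exact c hc
  have hcomm : ∀ n (c : G.X (n + 1)),
      (S.X₃.d (n + 1) n).hom ((S.g.f (n + 1)).hom c) = (S.g.f n).hom ((G.d (n + 1) n).hom c) :=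
    fun n c => congrArg (fun f => f.hom c) (S.g.comm (n + 1) n)
  have hQ : ∀ n, S.X₃.ExactAt n := by
    intro n
    match n with
    | 0 =>
      rw [HomologicalComplex.exactAt_iff' S.X₃ 1 0 0 (by simp) (by simp),
        ShortComplex.moduleCat_exact_iff]
      intro x _
      obtain ⟨c, rfl⟩ := hsurj 0 x
      obtain ⟨e, w, rfl⟩ := h₀ c
      refine ⟨(S.g.f 1).hom e, ?_⟩
      refine (hcomm 0 e).trans ?_
      rw [map_add, hzero]
      exact (zero_add _).symm
    | n + 1 =>
      rw [exactAt_succ_iff]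
      intro x hx
      obtain ⟨c, rfl⟩ := hsurj (n + 1) x
      obtain ⟨w, hw⟩ := hexact n _ ((hcomm n c).symm.trans hx)
      obtain ⟨e, w, rfl⟩ := h₁ n c w hw.symm
      refine ⟨(S.g.f (n + 2)).hom e, ?_⟩
      refine (hcomm (n + 1) e).trans ?_
      rw [map_add, hzero, zero_add]
  have hz := fun n => (hQ n).isZero_homology
  have : Mono (HomologicalComplex.homologyMap φ n) :=
    (hS.homology_exact₁ (n + 1) n (by simp)).mono_g ((hz (n + 1)).eq_of_src _ _)
  have : Epi (HomologicalComplex.homologyMap φ n) :=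
    (hS.homology_exact₂ n).epi_f ((hz n).eq_of_tgt _ _)
  exact isIso_of_mono_of_epi _

/-- Small chains compute the homology of the union. -/
theorem isIso_homologyMap_smallComplexIncl {𝒰 : Set (Set T)} (h𝒰 : ∀ P ∈ 𝒰, IsOpen P)
    (h : ∀ P ∈ 𝒰, ∃ Q ∈ ({⋃₀ 𝒰} : Set (Set T)), P ⊆ Q) (n : ℕ) :
    IsIso (HomologicalComplex.homologyMap (smallComplexIncl h) n) := by
  have : Mono (smallComplexIncl h) := HomologicalComplex.mono_of_mono_f _ fun n =>
    (ModuleCat.mono_iff_injective _).2 (Submodule.inclusion_injective (smallChains_mono h n))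
  refine isIso_homologyMap_of_relative_exact _ ?_ ?_ n
  · intro c
    obtain ⟨e, he, hw⟩ := exists_sub_bd_mem_zero h𝒰 c.2
    refine ⟨⟨e, he⟩, ⟨_, hw⟩, Subtype.ext ?_⟩
    rw [smallComplex_d]
    exact (sub_add_cancel _ _).symm
  · intro n c w hcw
    rw [smallComplex_d] at hcw
    have hcw' : bd T n c.1 = w.1 := congrArg Subtype.val hcw
    obtain ⟨e, he, hw⟩ := exists_sub_bd_mem_succ h𝒰 c.2 (hcw' ▸ w.2)
    refine ⟨⟨e, he⟩, ⟨_, hw⟩, Subtype.ext ?_⟩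
    rw [smallComplex_d]
    exact (sub_add_cancel _ _).symm

/-- Singular homology of a union of three open sets all of whose intersections have homology
concentrated in degree zero. -/
theorem homology_of_three_sets {A B D : Set T} (hA : IsOpen A) (hB : IsOpen B) (hD : IsOpen D)
    {EA EB ED EAB EAD EBD E : Type}
    [AddCommGroup EA] [Module ℚ EA] [Module.Finite ℚ EA]
    [AddCommGroup EB] [Module ℚ EB] [Module.Finite ℚ EB]
    [AddCommGroup ED] [Module ℚ ED] [Module.Finite ℚ ED]
    [AddCommGroup EAB] [Module ℚ EAB] [Module.Finite ℚ EAB]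
    [AddCommGroup EAD] [Module ℚ EAD] [Module.Finite ℚ EAD]
    [AddCommGroup EBD] [Module ℚ EBD] [Module.Finite ℚ EBD]
    [AddCommGroup E] [Module ℚ E] [Module.Finite ℚ E]
    {fA : T → EA} {fB : T → EB} {fD : T → ED} {fAB : T → EAB} {fAD : T → EAD} {fBD : T → EBD}
    {f : T → E}
    (rA : AcyclicOver A EA fA) (rB : AcyclicOver B EB fB) (rD : AcyclicOver D ED fD)
    (rAB : AcyclicOver (A ∩ B) EAB fAB) (rAD : AcyclicOver (A ∩ D) EAD fAD)
    (rBD : AcyclicOver (B ∩ D) EBD fBD) (r : AcyclicOver (A ∩ B ∩ D) E f)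
    (mAB : E →ₗ[ℚ] EAB) (mAD : E →ₗ[ℚ] EAD) (mBD : E →ₗ[ℚ] EBD)
    (hAB : ∀ x ∈ A ∩ B ∩ D, mAB (f x) = fAB x) (hAD : ∀ x ∈ A ∩ B ∩ D, mAD (f x) = fAD x)
    (hBD : ∀ x ∈ A ∩ B ∩ D, mBD (f x) = fBD x) {X : Set T} (hX : A ∪ B ∪ D = X) :
    (∀ n, Module.Finite ℚ (H n X)) ∧ (∀ n, Subsingleton (H (n + 3) X)) ∧
    Module.finrank ℚ (H 2 X) =
      Module.finrank ℚ ↥(LinearMap.ker mAB ⊓ LinearMap.ker mAD ⊓ LinearMap.ker mBD) ∧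
    (Module.finrank ℚ (H 0 X) : ℤ) - Module.finrank ℚ (H 1 X) + Module.finrank ℚ (H 2 X) =
      (Module.finrank ℚ EA + Module.finrank ℚ EB + Module.finrank ℚ ED) -
      (Module.finrank ℚ EAB + Module.finrank ℚ EAD + Module.finrank ℚ EBD) +
      Module.finrank ℚ E := by
  have hU : ⋃₀ {A, B, D} = X := by
    rw [← hX, Set.sUnion_insert, Set.sUnion_pair, Set.union_assoc]
  have hincl : ∀ P ∈ ({A, B, D} : Set (Set T)), ∃ Q ∈ ({⋃₀ {A, B, D}} : Set (Set T)), P ⊆ Q :=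
    fun P hP => ⟨_, rfl, Set.subset_sUnion_of_mem hP⟩
  have hopen : ∀ P ∈ ({A, B, D} : Set (Set T)), IsOpen P := by
    rintro P (rfl | rfl | rfl) <;> assumption
  have e : ∀ n, (smallComplex {A, B, D}).homology n ≃ₗ[ℚ] H n X := by
    intro n
    have := isIso_homologyMap_smallComplexIncl hopen hincl n
    have e₁ := (asIso (HomologicalComplex.homologyMap (smallComplexIncl hincl) n)).toLinearEquiv
    rw [hU] at e₁
    have e₂ : (smallComplex {X}).homology n ≃ₗ[ℚ] H n X :=
      (HomologicalComplex.homologyMapIso (singularChainsIso X).symm n).toLinearEquiv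
    exact e₁.trans e₂
  have hpt : ∀ {E' : Type} [AddCommGroup E'] [Module ℚ E'] (m : E →ₗ[ℚ] E') (f' : T → E')
      (_ : ∀ x ∈ A ∩ B ∩ D, m (f x) = f' x) (c : smallChains {A ∩ B ∩ D} 0),
      m (pointEval f c) = pointEval f' c := by
    intro E' _ _ m f' h c
    have : c.1 ∈ LinearMap.ker (m ∘ₗ pointEval f - pointEval f') := by
      have : smallChains {A ∩ B ∩ D} 0 ≤ LinearMap.ker (m ∘ₗ pointEval f - pointEval f') := by
        rw [smallChains, Finsupp.supported_eq_span_single, Submodule.span_le]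
        rintro _ ⟨σ, ⟨_, rfl, hσ⟩, rfl⟩
        have := h _ (hσ ⟨default, rfl⟩)
        simp [pointEval, this]
      exact this c.2
    simpa [sub_eq_zero] using this
  obtain ⟨h1, h2, h3, h4⟩ := homology_of_resolution (resolutionI_comp A B D)
    (resolutionJ_comp A B D) (mono_resolutionI A B D) (epi_resolutionP A B D)
    (exact_resolutionI A B D) (exact_resolutionJ A B D) r.resolves (rAB.resolves_triple rAD rBD)
    -- The middle sign is that of `linearI`; it does not affect the kernel.
    (rA.resolves_triple rB rD) (mAB.prod ((-mAD).prod mBD)) (by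
      intro x
      refine Prod.ext (hpt mAB _ hAB x) (Prod.ext ?_ (hpt mBD _ hBD x))
      refine (congrArg Neg.neg (hpt mAD _ hAD x)).trans ?_
      exact (map_neg (pointEval fAD) _).symm)
  have hker : LinearMap.ker (mAB.prod ((-mAD).prod mBD)) =
      LinearMap.ker mAB ⊓ LinearMap.ker mAD ⊓ LinearMap.ker mBD := by
    ext x
    simp [and_assoc]
  rw [hker] at h3
  simp only [Module.finrank_prod, (e _).finrank_eq] at h3 h4
  refine ⟨fun n => ?_, fun n => ?_, h3, ?_⟩
  · have := h1 n
    exact Module.Finite.equiv (e n)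
  · have := h2 n
    exact (e (n + 3)).symm.toEquiv.subsingleton
  · omega

end SquareTiled

end

/-! ### Subspaces which deform onto discrete sets -/

noncomputable section

open CategoryTheory

namespace SquareTiled

variable {T : Type} [TopologicalSpace T]

/-- A deformation of the subspace `P` onto a discrete space `Z`. -/
structure DiscreteDeformation (P : Set T) (Z : Type) where
  /-- The label of a point. -/
  label : P → Z
  /-- The center of a piece. -/
  center : Z → P
  isLocallyConstant : IsLocallyConstant label
  label_center : ∀ z, label (center z) = z
  /-- The deformation. -/
  homotopy : unitInterval × P → P
  continuous_homotopy : Continuous homotopy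
  homotopy_zero : ∀ x, homotopy (0, x) = x
  homotopy_one : ∀ x, homotopy (1, x) = center (label x)

namespace DiscreteDeformation

variable {P : Set T} {Z : Type} (h : DiscreteDeformation P Z)

/-- The label of a point as a basis vector, extended by zero. -/
def vec (x : T) : Z →₀ ℚ :=
  Function.extend Subtype.val (fun x => Finsupp.single (h.label x) 1) 0 x

lemma vec_coe (x : P) : h.vec x = Finsupp.single (h.label x) 1 :=
  Subtype.val_injective.extend_apply _ _ x

/-- By homotopy invariance the identity of H_{n+1}(P) factors through the homology of the discrete
space Z, which vanishes in positive degrees. -/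
lemma isZero_homology (h : DiscreteDeformation P Z) (n : ℕ) : Limits.IsZero (H (n + 1) P) := by
  let _ : TopologicalSpace Z := ⊥
  have : DiscreteTopology Z := ⟨rfl⟩
  let F : TopCat.of P ⟶ TopCat.of Z := TopCat.ofHom ⟨h.label, h.isLocallyConstant.continuous⟩
  let G : TopCat.of Z ⟶ TopCat.of P := TopCat.ofHom ⟨h.center, continuous_of_discreteTopology⟩
  have hom : TopCat.Homotopy (𝟙 (TopCat.of P)) (F ≫ G) :=
    { toFun := h.homotopy
      continuous_toFun := h.continuous_homotopy
      map_zero_left := h.homotopy_zero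
      map_one_left := h.homotopy_one }
  have h1 := hom.congr_homologyMap_singularChainComplexFunctor (ModuleCat.of ℚ ℚ) (n + 1)
  rw [CategoryTheory.Functor.map_id, HomologicalComplex.homologyMap_id, Functor.map_comp,
    HomologicalComplex.homologyMap_comp] at h1
  have h2 : Limits.IsZero ((((AlgebraicTopology.singularChainComplexFunctor
      (ModuleCat.{0} ℚ)).obj (ModuleCat.of ℚ ℚ)).obj (TopCat.of Z)).homology (n + 1)) :=
    AlgebraicTopology.isZero_singularHomologyFunctor_of_totallyDisconnectedSpace
      (ModuleCat.{0} ℚ) (n + 1) (ModuleCat.of ℚ ℚ) (TopCat.of Z) (by omega)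
  rw [Limits.IsZero.iff_id_eq_zero]
  rw [h2.eq_of_tgt (HomologicalComplex.homologyMap _ (n + 1)) 0, Limits.zero_comp] at h1
  exact h1

/-- The constant singular simplex. -/
def pointSing (x : T) : Sing 0 T := ContinuousMap.const _ x

lemma pointSing_apply_default (σ : Sing 0 T) : pointSing (σ default) = σ := by
  ext t
  rw [Subsingleton.elim t default]
  rfl

lemma pointSing_mem {x : T} (hx : x ∈ P) : pointSing x ∈ smallSing {P} 0 :=
  ⟨P, rfl, by rintro _ ⟨t, rfl⟩; exact hx⟩

lemma pointEval_single {E : Type} [AddCommGroup E] [Module ℚ E] (f : T → E) (σ : Sing 0 T) :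
    pointEval f (Finsupp.single σ 1) = f (σ default) := by
  simp [pointEval]

lemma bd_single_zero (τ : Sing 1 T) : bd T 0 (Finsupp.single τ 1) =
    Finsupp.single (face τ 0) 1 - Finsupp.single (face τ 1) 1 := by
  rw [bd_single, Fin.sum_univ_two]
  simp [sub_eq_add_neg]

/-- The 1-simplex given by the trace of a point under the deformation. -/
def trace (x : P) : Sing 1 T :=
  ⟨fun t => h.homotopy (⟨t 1, stdSimplex.zero_le t 1, stdSimplex.le_one t 1⟩, x), by
    refine continuous_subtype_val.comp (h.continuous_homotopy.comp ?_)
    refine Continuous.prodMk (Continuous.subtype_mk ?_ _) continuous_const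
    exact (continuous_apply 1).comp continuous_subtype_val⟩

lemma bd_trace (x : P) : bd T 0 (Finsupp.single (h.trace x) 1) =
    Finsupp.single (pointSing (h.center (h.label x) : T)) 1 - Finsupp.single (pointSing x.1) 1 := by
  rw [bd_single_zero]
  have key : ∀ (i : Fin 2) (s : unitInterval),
      (∀ t : stdSimplex ℝ (Fin 1), stdSimplex.map i.succAbove t 1 = (s : ℝ)) →
      face (h.trace x) i = pointSing (h.homotopy (s, x) : T) := by
    intro i s hs
    ext t
    change (h.homotopy (⟨stdSimplex.map i.succAbove t 1, _⟩, x) : T) = h.homotopy (s, x)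
    congr 3
    exact Subtype.ext (hs t)
  rw [key 0 1, key 1 0, h.homotopy_zero, h.homotopy_one]
  · intro t
    rw [stdSimplex.map_coe, FunOnFinite.linearMap_apply_apply]
    rw [Finset.sum_eq_zero]
    · rfl
    · intro j hj
      have := (Finset.mem_filter.1 hj).2
      fin_cases j
      simp at this
  · intro t
    rw [stdSimplex.map_coe, FunOnFinite.linearMap_apply_apply]
    rw [Finset.sum_eq_single 0]
    · simp
    · intro j _ hj; fin_cases j; simp at hj
    · intro hj; simp at hj

theorem acyclicOver : AcyclicOver P (Z →₀ ℚ) h.vec where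
  exact n := by
    have e := (HomologicalComplex.homologyMapIso (singularChainsIso P) (n + 1))
    have h1 : (smallComplex {P}).ExactAt (n + 1) := by
      rw [HomologicalComplex.exactAt_iff_isZero_homology]
      exact (h.isZero_homology n).of_iso e.symm
    rw [exactAt_succ_iff, smallComplex_d, smallComplex_d] at h1
    exact h1
  bd_eq_zero e := by
    have h1 : smallChains {P} 1 ≤ LinearMap.ker (pointEval h.vec ∘ₗ bd T 0) := by
      rw [smallChains, Finsupp.supported_eq_span_single, Submodule.span_le]
      rintro _ ⟨τ, ⟨Q, hQ, hτ⟩, rfl⟩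
      rw [Set.mem_singleton_iff.1 hQ] at hτ
      change pointEval h.vec (bd T 0 (Finsupp.single τ 1)) = 0
      rw [bd_single_zero, map_sub, pointEval_single, pointEval_single, sub_eq_zero]
      -- The two endpoints of a path carry the same label, since a locally constant function is
      -- constant on the connected simplex.
      let τ' : stdSimplex ℝ (Fin 2) → P := fun t => ⟨τ t, hτ ⟨t, rfl⟩⟩
      have hc : IsLocallyConstant (h.label ∘ τ') :=
        h.isLocallyConstant.comp_continuous (τ.continuous.subtype_mk _)
      have h2 : ∀ t, h.vec (τ t) = Finsupp.single (h.label (τ' t)) 1 := fun t => h.vec_coe (τ' t)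
      change h.vec (τ _) = h.vec (τ _)
      rw [h2, h2]
      congr 1
      exact hc.apply_eq_of_isPreconnected isPreconnected_univ trivial trivial
    exact h1 e.2
  exists_bd c hc := by
    -- The traces of the deformation show that any 0-chain is homologous to the one obtained by
    -- moving its points to the centers. That chain depends only on the labels, so it is zero when
    -- the augmentation vanishes.
    let s : (Z →₀ ℚ) →ₗ[ℚ] (Sing 0 T →₀ ℚ) :=
      Finsupp.lmapDomain ℚ ℚ (fun z => pointSing (h.center z : T))
    have h1 : smallChains {P} 0 ≤
        ((smallChains {P} 1).map (bd T 0)).comap (s ∘ₗ pointEval h.vec - LinearMap.id) := by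
      rw [smallChains, Finsupp.supported_eq_span_single, Submodule.span_le]
      rintro _ ⟨σ, ⟨Q, hQ, hσ⟩, rfl⟩
      rw [Set.mem_singleton_iff.1 hQ] at hσ
      refine ⟨Finsupp.single (h.trace ⟨σ default, hσ ⟨default, rfl⟩⟩) 1, ?_, ?_⟩
      · refine single_mem_smallChains ⟨P, Set.mem_singleton P, ?_⟩ _
        rintro _ ⟨t, rfl⟩
        exact (h.homotopy _).2
      · rw [bd_trace, LinearMap.sub_apply, LinearMap.comp_apply, pointEval_single,
          pointSing_apply_default]
        have := h.vec_coe ⟨σ default, hσ ⟨default, rfl⟩⟩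
        rw [this]
        simp [s]
    obtain ⟨e, he, hb⟩ := h1 c.2
    -- A trace runs from the point to its center, so e bounds (centers) - c = -c.
    refine ⟨-⟨e, he⟩, Subtype.ext ?_⟩
    rw [coe_smallBd, Submodule.coe_neg, map_neg]
    change -(bd T 0 e) = _
    rw [hb, LinearMap.sub_apply, LinearMap.comp_apply, hc]
    simp
  surjective y := by
    induction y using Finsupp.induction_linear with
    | zero => exact ⟨0, by simp⟩
    | add y y' hy hy' =>
      obtain ⟨c, rfl⟩ := hy
      obtain ⟨c', rfl⟩ := hy'
      exact ⟨c + c', by simp⟩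
    | single z a =>
      refine ⟨a • ⟨_, single_mem_smallChains (pointSing_mem (h.center z).2) 1⟩, ?_⟩
      rw [Submodule.coe_smul, map_smul, pointEval_single]
      change a • h.vec (h.center z) = _
      rw [h.vec_coe, h.label_center]
      simp

end DiscreteDeformation

/-- The empty set has no homology. -/
lemma AcyclicOver.empty : AcyclicOver (∅ : Set T) (Empty →₀ ℚ) 0 := by
  have h : ∀ n (c : smallChains {(∅ : Set T)} n), c = 0 := by
    intro n c
    refine Subtype.ext (Finsupp.ext fun σ => ?_)
    by_contra hσ
    obtain ⟨_, rfl, h⟩ := c.2 (Finsupp.mem_support_iff.2 hσ)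
    exact h ⟨Classical.arbitrary _, rfl⟩
  exact ⟨fun n c _ => ⟨0, by rw [h _ c, map_zero]⟩, fun e => Subsingleton.elim _ _,
    fun c _ => ⟨0, by rw [h _ c, map_zero]⟩, fun y => ⟨0, Subsingleton.elim _ _⟩⟩

end SquareTiled

end

/-! ### Regions of the surface given by patterns in the square -/

noncomputable section

open CategoryTheory

namespace SquareTiled

open Topology

/-- Convex combination in the unit interval. -/
def lerp (t x a : unitInterval) : unitInterval :=
  ⟨(1 - t) * x + t * a, by
    have := t.2.1; have := t.2.2; have := x.2.1; have := a.2.1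
    have h : 0 ≤ 1 - (t : ℝ) := by linarith
    positivity, by
    have := t.2.1; have := t.2.2; have := x.2.2; have := a.2.2
    nlinarith⟩

lemma coe_lerp (t x a : unitInterval) : (lerp t x a : ℝ) = (1 - t) * x + t * a := rfl

@[simp] lemma lerp_zero (x a : unitInterval) : lerp 0 x a = x := Subtype.ext (by simp [lerp])
@[simp] lemma lerp_one (x a : unitInterval) : lerp 1 x a = a := Subtype.ext (by simp [lerp])
@[simp] lemma lerp_self (t x : unitInterval) : lerp t x x = x :=
  Subtype.ext (by simp only [lerp]; ring)

lemma Continuous.lerp {X : Type*} [TopologicalSpace X] {f g h : X → unitInterval}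
    (hf : Continuous f) (hg : Continuous g) (hh : Continuous h) :
    Continuous fun x => lerp (f x) (g x) (h x) := by
  unfold SquareTiled.lerp
  refine Continuous.subtype_mk ?_ _
  fun_prop

/-- The point of the segment from `p` to `c` with parameter `t`. -/
def seg (t : unitInterval) (p c : unitInterval × unitInterval) : unitInterval × unitInterval :=
  (lerp t p.1 c.1, lerp t p.2 c.2)

/-- A subset of the square cut into open convex pieces, distinguished by a label, which is
compatible with the gluing of opposite edges. -/
structure Pattern (κ : Type) where
  /-- The subset of the square. -/
  carrier : Set (unitInterval × unitInterval)
  /-- The label of a point. -/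
  label : unitInterval × unitInterval → κ
  left_right : ∀ t, (1, t) ∈ carrier ↔ (0, t) ∈ carrier
  bottom_top : ∀ t, (t, 0) ∈ carrier ↔ (t, 1) ∈ carrier
  nhds : ∀ p ∈ carrier, ∀ᶠ p' in 𝓝 p, p' ∈ carrier ∧ label p' = label p
  convex : ∀ p ∈ carrier, ∀ c ∈ carrier, label c = label p →
    ∀ t, seg t p c ∈ carrier ∧ label (seg t p c) = label p

/-- The intersection of two patterns. -/
def Pattern.inter {κ κ' : Type} (K : Pattern κ) (K' : Pattern κ') : Pattern (κ × κ') where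
  carrier := K.carrier ∩ K'.carrier
  label p := (K.label p, K'.label p)
  left_right t := and_congr (K.left_right t) (K'.left_right t)
  bottom_top t := and_congr (K.bottom_top t) (K'.bottom_top t)
  nhds p hp := by
    filter_upwards [K.nhds p hp.1, K'.nhds p hp.2] with p' h h'
    exact ⟨⟨h.1, h'.1⟩, Prod.ext h.2 h'.2⟩
  convex p hp c hc h t := by
    have h1 := K.convex p hp.1 c hc.1 (congrArg Prod.fst h) t
    have h2 := K'.convex p hp.2 c hc.2 (congrArg Prod.snd h) t
    exact ⟨⟨h1.1, h2.1⟩, Prod.ext h1.2 h2.2⟩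

variable {S : Type} (C₁ C₂ : Equiv.Perm S)

/-- The point of the surface given by a point of a square. -/
def pt (i : S) (p : unitInterval × unitInterval) : ClosedSurface C₁ C₂ := Quot.mk _ ⟨i, p⟩

lemma pt_right (i : S) (t : unitInterval) : pt C₁ C₂ i (1, t) = pt C₁ C₂ (C₁ i) (0, t) :=
  Quot.sound (Glue.right_left i t)

lemma pt_bottom (i : S) (t : unitInterval) : pt C₁ C₂ i (t, 0) = pt C₁ C₂ (C₂ i) (t, 1) :=
  Quot.sound (Glue.bottom_top i t)

variable {C₁ C₂} in
/-- Functions on the surface. -/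
def surfaceLift {α : Sort*} (f : S → unitInterval × unitInterval → α)
    (h₁ : ∀ i t, f i (1, t) = f (C₁ i) (0, t)) (h₂ : ∀ i t, f i (t, 0) = f (C₂ i) (t, 1)) :
    ClosedSurface C₁ C₂ → α :=
  Quot.lift (fun s : Squares S => f s.1 s.2) (by
    rintro _ _ (⟨i, t⟩ | ⟨i, t⟩)
    · exact h₁ i t
    · exact h₂ i t)

lemma surface_ind {p : ClosedSurface C₁ C₂ → Prop} (h : ∀ i x, p (pt C₁ C₂ i x)) (x) : p x := by
  obtain ⟨s, rfl⟩ := Quot.exists_rep x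
  exact h s.1 s.2

/-- The part of the surface given by a pattern. -/
def region {κ : Type} (K : Pattern κ) : Set (ClosedSurface C₁ C₂) :=
  surfaceLift (fun _ p => p ∈ K.carrier) (fun _ t => propext (K.left_right t))
    (fun _ t => propext (K.bottom_top t))

@[simp]
lemma pt_mem_region {κ : Type} (K : Pattern κ) (i : S) (p : unitInterval × unitInterval) :
    pt C₁ C₂ i p ∈ region C₁ C₂ K ↔ p ∈ K.carrier := Iff.rfl

lemma region_inter {κ κ' : Type} (K : Pattern κ) (K' : Pattern κ') :
    region C₁ C₂ (K.inter K') = region C₁ C₂ K ∩ region C₁ C₂ K' := by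
  ext x
  exact surface_ind (p := fun x => x ∈ region C₁ C₂ (K.inter K') ↔
    x ∈ region C₁ C₂ K ∩ region C₁ C₂ K') C₁ C₂ (fun i p => Iff.rfl) x

lemma Pattern.isOpen {κ : Type} (K : Pattern κ) : IsOpen K.carrier :=
  isOpen_iff_mem_nhds.2 fun p hp => (K.nhds p hp).mono fun _ h => h.1

lemma isOpen_region {κ : Type} (K : Pattern κ) : IsOpen (region C₁ C₂ K) := by
  refine isQuotientMap_quot_mk.isOpen_preimage.1 ?_
  refine isOpen_sigma_iff.2 fun i => ?_
  exact K.isOpen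

/-- The data which identify the pieces of a region: the center of each piece and the component
which contains it. -/
structure Centers {κ : Type} (K : Pattern κ) (Z : Type) where
  /-- The center of a piece. -/
  center : κ → unitInterval × unitInterval
  /-- The component containing a piece. -/
  comp : S → κ → Z
  /-- The center of a component. -/
  compCenter : Z → ClosedSurface C₁ C₂
  center_mem : ∀ p ∈ K.carrier, center (K.label p) ∈ K.carrier ∧
    K.label (center (K.label p)) = K.label p
  -- A piece which meets an edge has its center on that edge, at the same position in both glued
  -- squares. The segments from edge points then stay in the edge, so the straight-line deformations
  -- of the two squares agree there.
  right_left : ∀ t, (1, t) ∈ K.carrier → ∃ w, center (K.label (1, t)) = (1, w) ∧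
    center (K.label (0, t)) = (0, w) ∧ ∀ i, comp i (K.label (1, t)) = comp (C₁ i) (K.label (0, t))
  bottom_top : ∀ t, (t, 0) ∈ K.carrier → ∃ w, center (K.label (t, 0)) = (w, 0) ∧
    center (K.label (t, 1)) = (w, 1) ∧ ∀ i, comp i (K.label (t, 0)) = comp (C₂ i) (K.label (t, 1))
  pt_center : ∀ i, ∀ p ∈ K.carrier,
    pt C₁ C₂ i (center (K.label p)) = compCenter (comp i (K.label p))
  surjective : ∀ z, ∃ i, ∃ p ∈ K.carrier, comp i (K.label p) = z

namespace Centers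

variable {C₁ C₂} {κ Z : Type} {K : Pattern κ} (c : Centers C₁ C₂ K Z)

open Classical in
/-- The component of a point, with a default value outside of the region. -/
def compOption : ClosedSurface C₁ C₂ → Option Z :=
  surfaceLift (fun i p => if p ∈ K.carrier then some (c.comp i (K.label p)) else none)
    (fun i t => by
      by_cases h : (1, t) ∈ K.carrier
      · obtain ⟨w, _, _, h'⟩ := c.right_left t h
        rw [if_pos h, if_pos ((K.left_right t).1 h), h']
      · rw [if_neg h, if_neg (mt (K.left_right t).2 h)])
    (fun i t => by
      by_cases h : (t, 0) ∈ K.carrier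
      · obtain ⟨w, _, _, h'⟩ := c.bottom_top t h
        rw [if_pos h, if_pos ((K.bottom_top t).1 h), h']
      · rw [if_neg h, if_neg (mt (K.bottom_top t).2 h)])

lemma compOption_pt (i : S) {p : unitInterval × unitInterval} (hp : p ∈ K.carrier) :
    c.compOption (pt C₁ C₂ i p) = some (c.comp i (K.label p)) :=
  if_pos hp

lemma isSome_compOption (x : region C₁ C₂ K) : (c.compOption x).isSome := by
  obtain ⟨x, hx⟩ := x
  induction x using surface_ind with
  | h i p => rw [c.compOption_pt i hx]; rfl

/-- The component of a point of the region. -/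
def label (x : region C₁ C₂ K) : Z := (c.compOption x).get (c.isSome_compOption x)

lemma label_pt (i : S) {p : unitInterval × unitInterval} (hp : p ∈ K.carrier) :
    c.label ⟨pt C₁ C₂ i p, hp⟩ = c.comp i (K.label p) := by
  have := c.compOption_pt i hp
  unfold label
  simp [this]

open Classical in
/-- The deformation of the region onto the centers of its pieces, extended by the identity. -/
def deform : ClosedSurface C₁ C₂ → unitInterval → ClosedSurface C₁ C₂ :=
  surfaceLift (fun i p t => if p ∈ K.carrier then pt C₁ C₂ i (seg t p (c.center (K.label p)))
    else pt C₁ C₂ i p)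
    (fun i t => by
      funext s
      by_cases h : (1, t) ∈ K.carrier
      · obtain ⟨w, h1, h2, _⟩ := c.right_left t h
        rw [if_pos h, if_pos ((K.left_right t).1 h), h1, h2]
        simp [seg, pt_right]
      · rw [if_neg h, if_neg (mt (K.left_right t).2 h), pt_right])
    (fun i t => by
      funext s
      by_cases h : (t, 0) ∈ K.carrier
      · obtain ⟨w, h1, h2, _⟩ := c.bottom_top t h
        rw [if_pos h, if_pos ((K.bottom_top t).1 h), h1, h2]
        simp [seg, pt_bottom]
      · rw [if_neg h, if_neg (mt (K.bottom_top t).2 h), pt_bottom])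

lemma deform_pt (i : S) {p : unitInterval × unitInterval} (hp : p ∈ K.carrier) (t : unitInterval) :
    c.deform (pt C₁ C₂ i p) t = pt C₁ C₂ i (seg t p (c.center (K.label p))) :=
  if_pos hp

lemma deform_mem (x : region C₁ C₂ K) (t : unitInterval) : c.deform x t ∈ region C₁ C₂ K := by
  obtain ⟨x, hx⟩ := x
  induction x using surface_ind with
  | h i p =>
    rw [c.deform_pt i hx]
    exact (K.convex p hx _ (c.center_mem p hx).1 (c.center_mem p hx).2 t).1

/-- The region is open, so continuity questions on it can be checked on the disjoint squares. -/
lemma isQuotientMap_region : IsQuotientMap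
    ((region C₁ C₂ K).restrictPreimage (Quot.mk (Glue C₁ C₂))) :=
  isQuotientMap_quot_mk.restrictPreimage_isOpen (isOpen_region C₁ C₂ K)

lemma continuous_square : Continuous fun s : Squares S => s.2 :=
  continuous_sigma fun _ => continuous_id

lemma eventually_label (s : Quot.mk (Glue C₁ C₂) ⁻¹' region C₁ C₂ K) :
    ∀ᶠ s' in 𝓝 s, s'.1.1 = s.1.1 ∧ K.label s'.1.2 = K.label s.1.2 := by
  have h1 : ∀ᶠ s' : Squares S in 𝓝 s.1, s'.1 = s.1.1 := by
    obtain ⟨⟨i, p⟩, hs⟩ := s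
    rw [Sigma.nhds_mk, Filter.eventually_map]
    exact Filter.Eventually.of_forall fun _ => rfl
  have h2 : ∀ᶠ s' : Squares S in 𝓝 s.1, K.label s'.2 = K.label s.1.2 :=
    continuous_square.continuousAt.eventually ((K.nhds s.1.2 s.2).mono fun _ h => h.2)
  exact continuous_subtype_val.continuousAt.eventually (h1.and h2)

lemma isLocallyConstant_label : IsLocallyConstant c.label := by
  intro U
  refine isQuotientMap_region.isOpen_preimage.1 (isOpen_iff_mem_nhds.2 fun s hs => ?_)
  filter_upwards [eventually_label s] with s' h
  have e : c.label ⟨pt C₁ C₂ s'.1.1 s'.1.2, s'.2⟩ = c.label ⟨pt C₁ C₂ s.1.1 s.1.2, s.2⟩ := by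
    rw [c.label_pt _ s'.2, c.label_pt _ s.2, h.1, h.2]
  change c.label ⟨pt C₁ C₂ s'.1.1 s'.1.2, s'.2⟩ ∈ U
  rw [e]
  exact hs

/-- The unit interval is locally compact, so its product with the quotient map is again suitable for
testing continuity. -/
lemma continuous_deform : Continuous fun x : unitInterval × region C₁ C₂ K => c.deform x.2 x.1 := by
  refine isQuotientMap_region.continuous_lift_prod_right ?_
  refine continuous_iff_continuousAt.2 fun ⟨t, s⟩ => ?_
  -- Near s the square and the label are constant, so the deformation agrees there with the segment
  -- to one fixed center.
  have h : Continuous fun x : unitInterval × (Quot.mk (Glue C₁ C₂) ⁻¹' region C₁ C₂ K) =>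
      pt C₁ C₂ s.1.1 (seg x.1 x.2.1.2 (c.center (K.label s.1.2))) := by
    refine continuous_quot_mk.comp (continuous_sigmaMk.comp ?_)
    have : Continuous fun x : unitInterval × (Quot.mk (Glue C₁ C₂) ⁻¹' region C₁ C₂ K) =>
      x.2.1.2 := continuous_square.comp (continuous_subtype_val.comp continuous_snd)
    exact (Continuous.lerp continuous_fst (continuous_fst.comp this) continuous_const).prodMk
      (Continuous.lerp continuous_fst (continuous_snd.comp this) continuous_const)
  refine h.continuousAt.congr ?_
  filter_upwards [continuous_snd.continuousAt.eventually (eventually_label s)] with x hx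
  refine Eq.trans ?_ (c.deform_pt x.2.1.1 x.2.2 x.1).symm
  rw [hx.1, hx.2]

lemma compCenter_mem (z : Z) : c.compCenter z ∈ region C₁ C₂ K := by
  obtain ⟨i, p, hp, rfl⟩ := c.surjective z
  rw [← c.pt_center i p hp]
  exact (c.center_mem p hp).1

lemma label_compCenter (z : Z) : c.label ⟨c.compCenter z, c.compCenter_mem z⟩ = z := by
  obtain ⟨i, p, hp, rfl⟩ := c.surjective z
  have h := (c.label_pt i (c.center_mem p hp).1).trans
    (congrArg (c.comp i) (c.center_mem p hp).2)
  refine Eq.trans (congrArg c.label ?_) h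
  exact Subtype.ext (c.pt_center i p hp).symm

/-- The deformation of a region onto the centers of its components. -/
def deformation : DiscreteDeformation (region C₁ C₂ K) Z where
  label := c.label
  center z := ⟨c.compCenter z, c.compCenter_mem z⟩
  isLocallyConstant := c.isLocallyConstant_label
  label_center := c.label_compCenter
  homotopy x := ⟨c.deform x.2 x.1, c.deform_mem x.2 x.1⟩
  continuous_homotopy := c.continuous_deform.subtype_mk _
  homotopy_zero := by
    rintro ⟨x, hx⟩
    induction x using surface_ind with
    | h i p => exact Subtype.ext ((c.deform_pt i hx 0).trans (by simp [seg]))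
  homotopy_one := by
    rintro ⟨x, hx⟩
    induction x using surface_ind with
    | h i p =>
      refine Subtype.ext ((c.deform_pt i hx 1).trans ?_)
      change _ = c.compCenter (c.label _)
      rw [c.label_pt i hx, ← c.pt_center i p hx]
      simp [seg]

lemma vec_pt (i : S) {p : unitInterval × unitInterval} (hp : p ∈ K.carrier) :
    c.deformation.vec (pt C₁ C₂ i p) = Finsupp.single (c.comp i (K.label p)) 1 := by
  rw [← c.label_pt i hp]
  exact c.deformation.vec_coe ⟨pt C₁ C₂ i p, hp⟩

end Centers

end SquareTiled

end

/-! ### The three patterns: faces, edges and corners -/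

noncomputable section

open CategoryTheory

namespace SquareTiled

open Topology

lemma eventually_lt_iff {f : unitInterval × unitInterval → ℝ} (hf : Continuous f) {a : ℝ}
    {p : unitInterval × unitInterval} (hp : f p ≠ a) :
    ∀ᶠ p' in 𝓝 p, f p' ≠ a ∧ decide (a < f p') = decide (a < f p) := by
  rcases hp.lt_or_gt with h | h
  · filter_upwards [hf.continuousAt.eventually (gt_mem_nhds h)] with p' h'
    exact ⟨h'.ne, by simp [h.not_gt, h'.not_gt]⟩
  · filter_upwards [hf.continuousAt.eventually (lt_mem_nhds h)] with p' h'
    exact ⟨h'.ne', by simp [h, h']⟩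

/-- Both open half-lines bounded by a are convex; applied to affine functions of the coordinates,
this gives the convexity of the pieces. -/
lemma lerp_lt_iff {u v a t : ℝ} (ht0 : 0 ≤ t) (ht1 : t ≤ 1) (hu : u ≠ a) (hv : v ≠ a)
    (h : decide (a < v) = decide (a < u)) :
    (1 - t) * u + t * v ≠ a ∧ decide (a < (1 - t) * u + t * v) = decide (a < u) := by
  rw [decide_eq_decide] at h
  rcases hu.lt_or_gt with hu | hu
  · have hv : v < a := lt_of_le_of_ne (not_lt.1 fun h' => absurd (h.1 h') hu.not_gt) hv
    have : (1 - t) * u + t * v < a := by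
      rcases ht0.eq_or_lt with rfl | ht
      · linarith
      · nlinarith [mul_lt_mul_of_pos_left hv ht, mul_le_mul_of_nonneg_left hu.le (sub_nonneg.2 ht1)]
    exact ⟨this.ne, by simp [this.not_gt, hu.not_gt]⟩
  · have hv : a < v := h.2 hu
    have : a < (1 - t) * u + t * v := by
      rcases ht0.eq_or_lt with rfl | ht
      · linarith
      · nlinarith [mul_lt_mul_of_pos_left hv ht, mul_le_mul_of_nonneg_left hu.le (sub_nonneg.2 ht1)]
    exact ⟨this.ne', by simp [this, hu]⟩

/-- The interior of the square. -/
def interiorPattern : Pattern Unit where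
  carrier := {p | (0 < (p.1 : ℝ) ∧ (p.1 : ℝ) < 1) ∧ 0 < (p.2 : ℝ) ∧ (p.2 : ℝ) < 1}
  label _ := ()
  left_right t := by simp
  bottom_top t := by simp
  nhds p hp := by
    have : IsOpen {p : unitInterval × unitInterval |
        (0 < (p.1 : ℝ) ∧ (p.1 : ℝ) < 1) ∧ 0 < (p.2 : ℝ) ∧ (p.2 : ℝ) < 1} := by
      have h1 : Continuous fun p : unitInterval × unitInterval => (p.1 : ℝ) := by fun_prop
      have h2 : Continuous fun p : unitInterval × unitInterval => (p.2 : ℝ) := by fun_prop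
      exact (isOpen_Ioo.preimage h1).inter (isOpen_Ioo.preimage h2)
    filter_upwards [this.mem_nhds hp] with p' h
    exact ⟨h, rfl⟩
  convex p hp c hc _ t := by
    refine ⟨?_, rfl⟩
    obtain ⟨⟨h1, h2⟩, h3, h4⟩ := hp
    obtain ⟨⟨k1, k2⟩, k3, k4⟩ := hc
    have t0 := t.2.1
    have t1 := t.2.2
    have e := convex_Ioo (𝕜 := ℝ) (0 : ℝ) 1 ⟨h1, h2⟩ ⟨k1, k2⟩ (sub_nonneg.2 t1) t0 (by ring)
    have e' := convex_Ioo (𝕜 := ℝ) (0 : ℝ) 1 ⟨h3, h4⟩ ⟨k3, k4⟩ (sub_nonneg.2 t1) t0 (by ring)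
    exact ⟨e, e'⟩

/-- The square without its diagonals. -/
def diagonalPattern : Pattern (Bool × Bool) where
  carrier := {p | (p.1 : ℝ) - p.2 ≠ 0 ∧ (p.1 : ℝ) + p.2 ≠ 1}
  label p := (decide (0 < (p.1 : ℝ) - p.2), decide (1 < (p.1 : ℝ) + p.2))
  left_right t := by
    simp only [Set.mem_ofPred_eq, Set.Icc.coe_one, Set.Icc.coe_zero]
    constructor <;> rintro ⟨h, h'⟩ <;> constructor <;> intro e
    all_goals first | exact h (by linarith) | exact h' (by linarith)
  bottom_top t := by
    simp only [Set.mem_ofPred_eq, Set.Icc.coe_one, Set.Icc.coe_zero]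
    constructor <;> rintro ⟨h, h'⟩ <;> constructor <;> intro e
    all_goals first | exact h (by linarith) | exact h' (by linarith)
  nhds p hp := by
    filter_upwards [eventually_lt_iff (f := fun p => (p.1 : ℝ) - p.2) (by fun_prop) hp.1,
      eventually_lt_iff (f := fun p => (p.1 : ℝ) + p.2) (by fun_prop) hp.2] with p' h h'
    exact ⟨⟨h.1, h'.1⟩, Prod.ext h.2 h'.2⟩
  convex p hp c hc h t := by
    have h1 := lerp_lt_iff t.2.1 t.2.2 hp.1 hc.1 (congrArg Prod.fst h)
    have h2 := lerp_lt_iff t.2.1 t.2.2 hp.2 hc.2 (congrArg Prod.snd h)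
    have e1 : ((seg t p c).1 : ℝ) - (seg t p c).2 =
        (1 - t) * ((p.1 : ℝ) - p.2) + t * ((c.1 : ℝ) - c.2) := by
      simp only [seg, coe_lerp]; ring
    have e2 : ((seg t p c).1 : ℝ) + (seg t p c).2 =
        (1 - t) * ((p.1 : ℝ) + p.2) + t * ((c.1 : ℝ) + c.2) := by
      simp only [seg, coe_lerp]; ring
    simp only [Set.mem_ofPred_eq, e1, e2]
    exact ⟨⟨h1.1, h2.1⟩, Prod.ext h1.2 h2.2⟩

/-- The square without its middle lines. -/
def middlePattern : Pattern (Bool × Bool) where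
  carrier := {p | (p.1 : ℝ) ≠ 1 / 2 ∧ (p.2 : ℝ) ≠ 1 / 2}
  label p := (decide (1 / 2 < (p.1 : ℝ)), decide (1 / 2 < (p.2 : ℝ)))
  left_right t := by norm_num
  bottom_top t := by norm_num
  nhds p hp := by
    filter_upwards [eventually_lt_iff (f := fun p => (p.1 : ℝ)) (by fun_prop) hp.1,
      eventually_lt_iff (f := fun p => (p.2 : ℝ)) (by fun_prop) hp.2] with p' h h'
    exact ⟨⟨h.1, h'.1⟩, Prod.ext h.2 h'.2⟩
  convex p hp c hc h t := by
    have h1 := lerp_lt_iff t.2.1 t.2.2 hp.1 hc.1 (congrArg Prod.fst h)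
    have h2 := lerp_lt_iff t.2.1 t.2.2 hp.2 hc.2 (congrArg Prod.snd h)
    exact ⟨⟨h1.1, h2.1⟩, Prod.ext h1.2 h2.2⟩

/-- The coordinate of one of the two sides. -/
def side : Bool → unitInterval
  | true => 1
  | false => 0

/-- The coordinates `1/4` and `3/4`. -/
def quarter : Bool → unitInterval
  | true => ⟨3 / 4, by norm_num, by norm_num⟩
  | false => ⟨1 / 4, by norm_num, by norm_num⟩

/-- The coordinates `1/8` and `7/8`. -/
def outerEighth : Bool → unitInterval
  | true => ⟨7 / 8, by norm_num, by norm_num⟩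
  | false => ⟨1 / 8, by norm_num, by norm_num⟩

/-- The coordinates `3/8` and `5/8`. -/
def innerEighth : Bool → unitInterval
  | true => ⟨5 / 8, by norm_num, by norm_num⟩
  | false => ⟨3 / 8, by norm_num, by norm_num⟩

/-- The middle of the unit interval. -/
def half : unitInterval := ⟨1 / 2, by norm_num, by norm_num⟩

@[simp] lemma side_true : side true = 1 := rfl
@[simp] lemma side_false : side false = 0 := rfl
@[simp] lemma coe_half : (half : ℝ) = 1 / 2 := rfl
@[simp] lemma coe_quarter (s : Bool) : (quarter s : ℝ) = if s then 3 / 4 else 1 / 4 := by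
  cases s <;> rfl
@[simp] lemma coe_outerEighth (s : Bool) : (outerEighth s : ℝ) = if s then 7 / 8 else 1 / 8 := by
  cases s <;> rfl
@[simp] lemma coe_innerEighth (s : Bool) : (innerEighth s : ℝ) = if s then 5 / 8 else 3 / 8 := by
  cases s <;> rfl

end SquareTiled

end

/-! ### Components and centers of the patterns and of their intersections -/

noncomputable section

open CategoryTheory

namespace SquareTiled

variable {S : Type} (C₁ C₂ : Equiv.Perm S)

lemma mem_interior {x y : unitInterval} : (x, y) ∈ interiorPattern.carrier ↔
    (0 < (x : ℝ) ∧ (x : ℝ) < 1) ∧ 0 < (y : ℝ) ∧ (y : ℝ) < 1 := Iff.rfl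

lemma mem_diagonal {x y : unitInterval} : (x, y) ∈ diagonalPattern.carrier ↔
    (x : ℝ) - y ≠ 0 ∧ (x : ℝ) + y ≠ 1 := Iff.rfl

lemma mem_middle {x y : unitInterval} : (x, y) ∈ middlePattern.carrier ↔
    (x : ℝ) ≠ 1 / 2 ∧ (y : ℝ) ≠ 1 / 2 := Iff.rfl

lemma mem_inter {κ κ' : Type} {K : Pattern κ} {K' : Pattern κ'} {p : unitInterval × unitInterval} :
    p ∈ (K.inter K').carrier ↔ p ∈ K.carrier ∧ p ∈ K'.carrier := Iff.rfl

lemma label_inter {κ κ' : Type} {K : Pattern κ} {K' : Pattern κ'}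
    {p : unitInterval × unitInterval} : (K.inter K').label p = (K.label p, K'.label p) := rfl

lemma label_diagonal {x y : unitInterval} : diagonalPattern.label (x, y) =
    (decide (0 < (x : ℝ) - y), decide (1 < (x : ℝ) + y)) := rfl

lemma label_middle {x y : unitInterval} : middlePattern.label (x, y) =
    (decide (1 / 2 < (x : ℝ)), decide (1 / 2 < (y : ℝ))) := rfl

lemma label_diagonal_right {t : unitInterval} (h : (1, t) ∈ diagonalPattern.carrier) :
    diagonalPattern.label (1, t) = (true, true) ∧
      diagonalPattern.label (0, t) = (false, false) := by
  simp only [mem_diagonal, label_diagonal, Set.Icc.coe_one, Set.Icc.coe_zero] at h ⊢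
  have h0 := t.2.1
  have h1 := t.2.2
  have h0' : (t : ℝ) ≠ 0 := fun e => h.2 (by linarith)
  have h1' : (t : ℝ) ≠ 1 := fun e => h.1 (by linarith)
  have := lt_of_le_of_ne h0 h0'.symm
  have := lt_of_le_of_ne h1 h1'
  simp only [Prod.mk.injEq, decide_eq_true_eq, decide_eq_false_iff_not, not_lt]
  refine ⟨⟨?_, ?_⟩, ?_, ?_⟩ <;> linarith

lemma label_diagonal_bottom {t : unitInterval} (h : (t, 0) ∈ diagonalPattern.carrier) :
    diagonalPattern.label (t, 0) = (true, false) ∧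
      diagonalPattern.label (t, 1) = (false, true) := by
  simp only [mem_diagonal, label_diagonal, Set.Icc.coe_one, Set.Icc.coe_zero] at h ⊢
  have h0 := t.2.1
  have h1 := t.2.2
  have h0' : (t : ℝ) ≠ 0 := fun e => h.1 (by linarith)
  have h1' : (t : ℝ) ≠ 1 := fun e => h.2 (by linarith)
  have := lt_of_le_of_ne h0 h0'.symm
  have := lt_of_le_of_ne h1 h1'
  simp only [Prod.mk.injEq, decide_eq_true_eq, decide_eq_false_iff_not, not_lt]
  refine ⟨⟨?_, ?_⟩, ?_, ?_⟩ <;> linarith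

lemma label_middle_one (t : unitInterval) :
    middlePattern.label (1, t) = (true, decide (1 / 2 < (t : ℝ))) ∧
      middlePattern.label (0, t) = (false, decide (1 / 2 < (t : ℝ))) ∧
      middlePattern.label (t, 1) = (decide (1 / 2 < (t : ℝ)), true) ∧
      middlePattern.label (t, 0) = (decide (1 / 2 < (t : ℝ)), false) := by
  simp only [label_middle, Set.Icc.coe_one, Set.Icc.coe_zero]
  norm_num

/-- The label of a half of one of the four triangles in the square. -/
def halfLabel (s d : Bool × Bool) : Bool := if s.1 = s.2 then d.2 else d.1

/-- The quarter of the square which contains a half of one of the four triangles. -/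
def quarterLabel (s : Bool × Bool) (w : Bool) : Bool × Bool :=
  if s.1 = s.2 then (s.1, w) else (w, s.2)

/-- A left or right triangle already determines on which side of the vertical middle line it lies,
and a top or bottom triangle likewise for the horizontal one. Only one bit of the quarter is new, so
a triangle meets two quarters. -/
lemma quarterLabel_halfLabel {p : unitInterval × unitInterval}
    (hp : p ∈ (diagonalPattern.inter middlePattern).carrier) :
    quarterLabel (diagonalPattern.label p)
      (halfLabel (diagonalPattern.label p) (middlePattern.label p)) = middlePattern.label p := by
  obtain ⟨x, y⟩ := p
  simp only [mem_inter, mem_diagonal, mem_middle, label_diagonal, label_middle, quarterLabel,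
    halfLabel] at hp ⊢
  obtain ⟨⟨h1, h2⟩, h3, h4⟩ := hp
  by_cases h : 0 < (x : ℝ) - y <;> by_cases h' : 1 < (x : ℝ) + y <;>
    simp only [h, h', decide_true, decide_false, if_true, Prod.mk.injEq, and_true, true_and,
      reduceIte, Bool.true_eq_false, Bool.false_eq_true]
  · symm; rw [decide_eq_true_eq]; linarith
  · symm; rw [decide_eq_false_iff_not, not_lt]; linarith
  · symm; rw [decide_eq_true_eq]; linarith
  · symm; rw [decide_eq_false_iff_not, not_lt]; linarith

/-- The component of the complement of the diagonals, and of the corners, which contains a given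
triangle. -/
def edgeLabel (i : S) : Bool × Bool → S ⊕ S
  | (true, true) => Sum.inl i
  | (false, false) => Sum.inl (C₁⁻¹ i)
  | (true, false) => Sum.inr i
  | (false, true) => Sum.inr (C₂⁻¹ i)

/-- The point of an edge with a given coordinate. -/
def edgePoint (w : unitInterval) : S ⊕ S → ClosedSurface C₁ C₂ :=
  Sum.elim (fun i => pt C₁ C₂ i (1, w)) (fun i => pt C₁ C₂ i (w, 0))

/-- The point of the side of a triangle with a given coordinate. -/
def sidePoint (s : Bool × Bool) (w : unitInterval) : unitInterval × unitInterval :=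
  if s.1 = s.2 then (side s.1, w) else (w, side s.2)

lemma pt_sidePoint (i : S) (s : Bool × Bool) (w : unitInterval) :
    pt C₁ C₂ i (sidePoint s w) = edgePoint C₁ C₂ w (edgeLabel C₁ C₂ i s) := by
  obtain ⟨_ | _, _ | _⟩ := s
  · simp [sidePoint, edgePoint, edgeLabel, pt_right]
  · simp [sidePoint, edgePoint, edgeLabel, pt_bottom]
  · simp [sidePoint, edgePoint, edgeLabel]
  · simp [sidePoint, edgePoint, edgeLabel]

/-- The centers of the squares. -/
def interiorCenters : Centers C₁ C₂ interiorPattern S where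
  center _ := (half, half)
  comp i _ := i
  compCenter i := pt C₁ C₂ i (half, half)
  center_mem _ _ := ⟨by norm_num [mem_interior], rfl⟩
  right_left t h := by simp [mem_interior] at h
  bottom_top t h := by simp [mem_interior] at h
  pt_center _ _ _ := rfl
  surjective i := ⟨i, (half, half), by norm_num [mem_interior], rfl⟩

lemma diagonal_sidePoint (s : Bool × Bool) : sidePoint s half ∈ diagonalPattern.carrier ∧
    diagonalPattern.label (sidePoint s half) = s := by
  obtain ⟨_ | _, _ | _⟩ := s <;> norm_num [sidePoint, mem_diagonal, label_diagonal]

/-- The centers of the edges. -/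
def diagonalCenters : Centers C₁ C₂ diagonalPattern (S ⊕ S) where
  center s := sidePoint s half
  comp := edgeLabel C₁ C₂
  compCenter := edgePoint C₁ C₂ half
  center_mem p _ := diagonal_sidePoint _
  right_left t h := by
    rw [(label_diagonal_right h).1, (label_diagonal_right h).2]
    exact ⟨half, rfl, rfl, fun i => by simp [edgeLabel]⟩
  bottom_top t h := by
    rw [(label_diagonal_bottom h).1, (label_diagonal_bottom h).2]
    exact ⟨half, rfl, rfl, fun i => by simp [edgeLabel]⟩
  pt_center i p _ := pt_sidePoint _ _ _ _ _
  surjective := by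
    rintro (i | i)
    · exact ⟨i, _, (diagonal_sidePoint (true, true)).1, by rw [(diagonal_sidePoint _).2]; rfl⟩
    · exact ⟨i, _, (diagonal_sidePoint (true, false)).1, by rw [(diagonal_sidePoint _).2]; rfl⟩

/-- The cycles of the commutator. -/
abbrev Corners : Type := Quotient (Equiv.Perm.SameCycle.setoid (C₁ * C₂ * C₁⁻¹ * C₂⁻¹))

/-- The cycle which corresponds to a corner of a square. -/
def cornerLabel (i : S) : Bool × Bool → Corners C₁ C₂
  | (false, true) => Quotient.mk _ i
  | (true, true) => Quotient.mk _ (C₁ i)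
  | (false, false) => Quotient.mk _ (C₂ i)
  | (true, false) => Quotient.mk _ (C₂ (C₁ i))

/-- The bottom right corner of a square j is reached in two ways, as the top left corner of C₂C₁j
and of C₁C₂j; the commutator carries the first to the second. -/
lemma pt_commutator (i : S) : pt C₁ C₂ ((C₁ * C₂ * C₁⁻¹ * C₂⁻¹) i) (0, 1) = pt C₁ C₂ i (0, 1) := by
  obtain ⟨j, rfl⟩ : ∃ j, C₂ (C₁ j) = i := ⟨C₁⁻¹ (C₂⁻¹ i), by simp⟩
  have h : (C₁ * C₂ * C₁⁻¹ * C₂⁻¹) (C₂ (C₁ j)) = C₁ (C₂ j) := by simp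
  rw [h]
  rw [← pt_right, ← pt_bottom, ← pt_bottom, pt_right]

lemma pt_of_sameCycle {i j : S} (h : (C₁ * C₂ * C₁⁻¹ * C₂⁻¹).SameCycle i j) :
    pt C₁ C₂ i (0, 1) = pt C₁ C₂ j (0, 1) := by
  have key : ∀ (m : ℤ) (i : S),
      pt C₁ C₂ (((C₁ * C₂ * C₁⁻¹ * C₂⁻¹) ^ m) i) (0, 1) = pt C₁ C₂ i (0, 1) := by
    intro m
    induction m with
    | zero => simp
    | succ m ih => intro i; rw [zpow_add_one, Equiv.Perm.mul_apply, ih, pt_commutator]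
    | pred m ih =>
      intro i
      rw [zpow_sub_one, Equiv.Perm.mul_apply, ih, ← pt_commutator, ← Equiv.Perm.mul_apply,
        mul_inv_cancel, Equiv.Perm.one_apply]
  obtain ⟨m, rfl⟩ := h
  exact (key m i).symm

/-- The corner of a cycle. -/
def cornerPoint : Corners C₁ C₂ → ClosedSurface C₁ C₂ :=
  Quotient.lift (fun i => pt C₁ C₂ i (0, 1)) fun _ _ h => pt_of_sameCycle C₁ C₂ h

lemma middle_side (d : Bool × Bool) : (side d.1, side d.2) ∈ middlePattern.carrier ∧
    middlePattern.label (side d.1, side d.2) = d := by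
  obtain ⟨_ | _, _ | _⟩ := d <;> norm_num [mem_middle, label_middle]

lemma pt_side (i : S) (d : Bool × Bool) :
    pt C₁ C₂ i (side d.1, side d.2) = cornerPoint C₁ C₂ (cornerLabel C₁ C₂ i d) := by
  obtain ⟨_ | _, _ | _⟩ := d
  · exact pt_bottom _ _ _ _
  · rfl
  · exact (pt_right _ _ _ _).trans (pt_bottom _ _ _ _)
  · exact pt_right _ _ _ _

lemma cornerLabel_right (i : S) (b : Bool) :
    cornerLabel C₁ C₂ i (true, b) = cornerLabel C₁ C₂ (C₁ i) (false, b) := by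
  cases b <;> rfl

/-- Only the bottom right corner needs the quotient by cycles: there the two sides are the classes
of C₂C₁i and C₁C₂i, one step of the commutator apart. -/
lemma cornerLabel_bottom (i : S) (b : Bool) :
    cornerLabel C₁ C₂ i (b, false) = cornerLabel C₁ C₂ (C₂ i) (b, true) := by
  cases b
  · rfl
  · refine Quotient.sound ?_
    refine ⟨1, ?_⟩
    simp

/-- The corners of the squares. -/
def middleCenters : Centers C₁ C₂ middlePattern (Corners C₁ C₂) where
  center d := (side d.1, side d.2)
  comp := cornerLabel C₁ C₂
  compCenter := cornerPoint C₁ C₂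
  center_mem p _ := middle_side _
  right_left t h := by
    rw [(label_middle_one t).1, (label_middle_one t).2.1]
    exact ⟨_, rfl, rfl, fun i => cornerLabel_right _ _ _ _⟩
  bottom_top t h := by
    rw [(label_middle_one t).2.2.1, (label_middle_one t).2.2.2]
    exact ⟨_, rfl, rfl, fun i => cornerLabel_bottom _ _ _ _⟩
  pt_center i p _ := pt_side _ _ _ _
  surjective := by
    refine Quotient.ind fun i => ?_
    exact ⟨i, _, (middle_side (false, true)).1, by rw [(middle_side _).2]; rfl⟩

/-- The center of a triangle. -/
def trianglePoint (s : Bool × Bool) : unitInterval × unitInterval :=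
  if s.1 = s.2 then (quarter s.1, half) else (half, quarter s.2)

lemma interior_diagonal_trianglePoint (s : Unit × Bool × Bool) :
    trianglePoint s.2 ∈ (interiorPattern.inter diagonalPattern).carrier ∧
    (interiorPattern.inter diagonalPattern).label (trianglePoint s.2) = s := by
  obtain ⟨_, _ | _, _ | _⟩ := s <;>
  norm_num [trianglePoint, mem_inter, mem_interior, label_inter, mem_diagonal, label_diagonal]

/-- The centers of the triangles. -/
def interiorDiagonalCenters :
    Centers C₁ C₂ (interiorPattern.inter diagonalPattern) (S × Bool × Bool) where
  center s := trianglePoint s.2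
  comp i s := (i, s.2)
  compCenter z := pt C₁ C₂ z.1 (trianglePoint z.2)
  center_mem p _ := interior_diagonal_trianglePoint _
  right_left t h := by simp [mem_inter, mem_interior] at h
  bottom_top t h := by simp [mem_inter, mem_interior] at h
  pt_center i p _ := rfl
  surjective z := ⟨z.1, _, (interior_diagonal_trianglePoint ((), z.2)).1, by
    rw [(interior_diagonal_trianglePoint _).2]⟩

lemma interior_middle_quarter (s : Unit × Bool × Bool) :
    (quarter s.2.1, quarter s.2.2) ∈ (interiorPattern.inter middlePattern).carrier ∧
    (interiorPattern.inter middlePattern).label (quarter s.2.1, quarter s.2.2) = s := by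
  obtain ⟨_, _ | _, _ | _⟩ := s <;>
  norm_num [mem_inter, mem_interior, label_inter, mem_middle, label_middle]

/-- The centers of the quarters of the squares. -/
def interiorMiddleCenters :
    Centers C₁ C₂ (interiorPattern.inter middlePattern) (S × Bool × Bool) where
  center s := (quarter s.2.1, quarter s.2.2)
  comp i s := (i, s.2)
  compCenter z := pt C₁ C₂ z.1 (quarter z.2.1, quarter z.2.2)
  center_mem p _ := interior_middle_quarter _
  right_left t h := by simp [mem_inter, mem_interior] at h
  bottom_top t h := by simp [mem_inter, mem_interior] at h
  pt_center i p _ := rfl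
  surjective z := ⟨z.1, _, (interior_middle_quarter ((), z.2)).1, by
    rw [(interior_middle_quarter _).2]⟩

lemma diagonal_middle_sidePoint (s : Bool × Bool) (w : Bool) :
    sidePoint s (quarter w) ∈ (diagonalPattern.inter middlePattern).carrier ∧
    (diagonalPattern.inter middlePattern).label (sidePoint s (quarter w)) =
      (s, quarterLabel s w) := by
  obtain ⟨_ | _, _ | _⟩ := s <;> cases w <;>
  norm_num [sidePoint, mem_inter, label_inter, mem_diagonal, label_diagonal, mem_middle,
    label_middle, quarterLabel]

lemma halfLabel_quarterLabel (s : Bool × Bool) (w : Bool) :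
    halfLabel s (quarterLabel s w) = w := by
  unfold halfLabel quarterLabel
  split_ifs <;> rfl

/-- The centers of the halves of the edges. -/
def diagonalMiddleCenters :
    Centers C₁ C₂ (diagonalPattern.inter middlePattern) ((S ⊕ S) × Bool) where
  center s := sidePoint s.1 (quarter (halfLabel s.1 s.2))
  comp i s := (edgeLabel C₁ C₂ i s.1, halfLabel s.1 s.2)
  compCenter z := edgePoint C₁ C₂ (quarter z.2) z.1
  center_mem p hp := ⟨(diagonal_middle_sidePoint _ _).1, (diagonal_middle_sidePoint _ _).2.trans
    (Prod.ext rfl (quarterLabel_halfLabel hp))⟩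
  right_left t h := by
    simp only [label_inter]
    rw [(label_diagonal_right h.1).1, (label_diagonal_right h.1).2, (label_middle_one t).1,
      (label_middle_one t).2.1]
    exact ⟨_, rfl, rfl, fun i => by simp [edgeLabel, halfLabel]⟩
  bottom_top t h := by
    simp only [label_inter]
    rw [(label_diagonal_bottom h.1).1, (label_diagonal_bottom h.1).2, (label_middle_one t).2.2.1,
      (label_middle_one t).2.2.2]
    exact ⟨_, rfl, rfl, fun i => by simp [edgeLabel, halfLabel]⟩
  pt_center i p _ := pt_sidePoint _ _ _ _ _
  surjective := by
    rintro ⟨i | i, w⟩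
    · refine ⟨i, _, (diagonal_middle_sidePoint (true, true) w).1, ?_⟩
      rw [(diagonal_middle_sidePoint _ _).2]
      exact Prod.ext rfl (halfLabel_quarterLabel (true, true) w)
    · refine ⟨i, _, (diagonal_middle_sidePoint (true, false) w).1, ?_⟩
      rw [(diagonal_middle_sidePoint _ _).2]
      exact Prod.ext rfl (halfLabel_quarterLabel (true, false) w)

/-- The center of a half of a triangle. -/
def halfTrianglePoint (s : Bool × Bool) (w : Bool) : unitInterval × unitInterval :=
  if s.1 = s.2 then (outerEighth s.1, innerEighth w) else (innerEighth w, outerEighth s.2)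

lemma halfTrianglePoint_mem (s : Bool × Bool) (w : Bool) : halfTrianglePoint s w ∈
      ((interiorPattern.inter diagonalPattern).inter middlePattern).carrier ∧
    ((interiorPattern.inter diagonalPattern).inter middlePattern).label (halfTrianglePoint s w) =
      (((), s), quarterLabel s w) := by
  obtain ⟨_ | _, _ | _⟩ := s <;> cases w <;>
  norm_num [halfTrianglePoint, mem_inter, label_inter, mem_diagonal, label_diagonal, mem_middle,
    label_middle, quarterLabel, mem_interior]

/-- The centers of the halves of the triangles. -/
def tripleCenters : Centers C₁ C₂
    ((interiorPattern.inter diagonalPattern).inter middlePattern) (S × (Bool × Bool) × Bool) where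
  center s := halfTrianglePoint s.1.2 (halfLabel s.1.2 s.2)
  comp i s := (i, s.1.2, halfLabel s.1.2 s.2)
  compCenter z := pt C₁ C₂ z.1 (halfTrianglePoint z.2.1 z.2.2)
  center_mem p hp := ⟨(halfTrianglePoint_mem _ _).1, (halfTrianglePoint_mem _ _).2.trans
    (Prod.ext rfl (quarterLabel_halfLabel ⟨hp.1.2, hp.2⟩))⟩
  right_left t h := by simp [mem_inter, mem_interior] at h
  bottom_top t h := by simp [mem_inter, mem_interior] at h
  pt_center i p _ := rfl
  surjective := by
    rintro ⟨i, s, w⟩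
    refine ⟨i, _, (halfTrianglePoint_mem s w).1, ?_⟩
    rw [(halfTrianglePoint_mem _ _).2]
    exact Prod.ext rfl (Prod.ext rfl (halfLabel_quarterLabel _ _))

end SquareTiled

end

/-! ### The punctured surface, its corners and connectedness -/

noncomputable section

open CategoryTheory

namespace SquareTiled

open Topology

lemma exists_int_of_mem_closure {z : ℂ} (h : z ∈ AddSubgroup.closure ({1, Complex.I} : Set ℂ)) :
    (∃ m : ℤ, z.re = m) ∧ ∃ m : ℤ, z.im = m := by
  induction h using AddSubgroup.closure_induction with
  | mem z hz =>
    rcases hz with rfl | rfl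
    · exact ⟨⟨1, by simp⟩, 0, by simp⟩
    · exact ⟨⟨0, by simp⟩, 1, by simp⟩
  | zero => exact ⟨⟨0, by simp⟩, 0, by simp⟩
  | add z w _ _ hz hw =>
    obtain ⟨⟨a, ha⟩, b, hb⟩ := hz
    obtain ⟨⟨c, hc⟩, d, hd⟩ := hw
    exact ⟨⟨a + c, by simp [ha, hc]⟩, b + d, by simp [hb, hd]⟩
  | neg z _ hz =>
    obtain ⟨⟨a, ha⟩, b, hb⟩ := hz
    exact ⟨⟨-a, by simp [ha]⟩, -b, by simp [hb]⟩

lemma exists_side_eq {x : unitInterval} {m : ℤ} (h : (x : ℝ) = m) : ∃ b, side b = x := by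
  have h0 : (0 : ℝ) ≤ m := h ▸ x.2.1
  have h1 : (m : ℝ) ≤ 1 := h ▸ x.2.2
  have h0 : 0 ≤ m := by exact_mod_cast h0
  have h1 : m ≤ 1 := by exact_mod_cast h1
  obtain rfl | rfl : m = 0 ∨ m = 1 := by omega
  · exact ⟨false, Subtype.ext (by simp [h])⟩
  · exact ⟨true, Subtype.ext (by simp [h])⟩

variable {S : Type} (C₁ C₂ : Equiv.Perm S)

lemma proj_pt (i : S) (p : unitInterval × unitInterval) : proj C₁ C₂ (pt C₁ C₂ i p) =
    QuotientAddGroup.mk (((p.1 : ℝ) : ℂ) + ((p.2 : ℝ) : ℂ) * Complex.I) := rfl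

/-- Lattice points have integer coordinates, and the only integers in the unit interval are 0 and 1.
-/
lemma proj_pt_eq_zero_iff (i : S) (p : unitInterval × unitInterval) :
    proj C₁ C₂ (pt C₁ C₂ i p) = 0 ↔ ∃ d : Bool × Bool, p = (side d.1, side d.2) := by
  rw [proj_pt, QuotientAddGroup.eq_zero_iff]
  constructor
  · intro h
    obtain ⟨⟨a, ha⟩, b, hb⟩ := exists_int_of_mem_closure h
    simp only [Complex.add_re, Complex.ofReal_re, Complex.mul_re, Complex.I_re, mul_zero,
      Complex.ofReal_im, Complex.I_im, zero_mul, sub_zero, add_zero] at ha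
    simp only [Complex.add_im, Complex.ofReal_im, Complex.mul_im, Complex.ofReal_re, Complex.I_im,
      mul_one, Complex.I_re, mul_zero, add_zero, zero_add] at hb
    obtain ⟨d, hd⟩ := exists_side_eq ha
    obtain ⟨d', hd'⟩ := exists_side_eq hb
    exact ⟨(d, d'), by rw [hd, hd']⟩
  · have h1 : (1 : ℂ) ∈ AddSubgroup.closure ({1, Complex.I} : Set ℂ) :=
      AddSubgroup.subset_closure (by simp)
    have hI : Complex.I ∈ AddSubgroup.closure ({1, Complex.I} : Set ℂ) :=
      AddSubgroup.subset_closure (by simp)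
    rintro ⟨⟨_ | _, _ | _⟩, rfl⟩
    · simp
    · simpa using hI
    · simpa using h1
    · simpa using add_mem h1 hI

lemma pt_mem_openSurface (i : S) (p : unitInterval × unitInterval) :
    pt C₁ C₂ i p ∈ openSurface C₁ C₂ ↔ ¬∃ d : Bool × Bool, p = (side d.1, side d.2) :=
  not_congr (proj_pt_eq_zero_iff C₁ C₂ i p)

/-- A point on the boundary of the square which also lies on a diagonal is a corner. -/
lemma interior_or_diagonal (p : unitInterval × unitInterval) :
    (p ∈ interiorPattern.carrier ∨ p ∈ diagonalPattern.carrier) ↔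
      ¬∃ d : Bool × Bool, p = (side d.1, side d.2) := by
  obtain ⟨x, y⟩ := p
  constructor
  · rintro h ⟨⟨_ | _, _ | _⟩, h'⟩
    all_goals
      simp only [side_true, side_false, Prod.mk.injEq] at h'
      obtain ⟨rfl, rfl⟩ := h'
      simp [mem_interior, mem_diagonal] at h
  · intro h
    by_contra hc
    rw [not_or, mem_interior, mem_diagonal] at hc
    obtain ⟨h1, h2⟩ := hc
    have x0 := x.2.1
    have x1 := x.2.2
    have y0 := y.2.1
    have y1 := y.2.2
    have hxy : (x : ℝ) = y ∨ (x : ℝ) + y = 1 := by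
      by_contra hc
      rw [not_or] at hc
      exact h2 ⟨sub_ne_zero.2 hc.1, hc.2⟩
    have hx : ((x : ℝ) = 0 ∨ (x : ℝ) = 1) ∨ ((y : ℝ) = 0 ∨ (y : ℝ) = 1) := by
      by_contra hc
      simp only [not_or] at hc
      exact h1 ⟨⟨lt_of_le_of_ne x0 (Ne.symm hc.1.1), lt_of_le_of_ne x1 hc.1.2⟩,
        lt_of_le_of_ne y0 (Ne.symm hc.2.1), lt_of_le_of_ne y1 hc.2.2⟩
    have hx' : (∃ m : ℤ, (x : ℝ) = m) ∧ ∃ m : ℤ, (y : ℝ) = m := by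
      rcases hxy with e | e <;> rcases hx with (e' | e') | e' | e'
      · exact ⟨⟨0, by simp [e']⟩, 0, by push_cast; linarith⟩
      · exact ⟨⟨1, by simp [e']⟩, 1, by push_cast; linarith⟩
      · exact ⟨⟨0, by push_cast; linarith⟩, 0, by simp [e']⟩
      · exact ⟨⟨1, by push_cast; linarith⟩, 1, by simp [e']⟩
      · exact ⟨⟨0, by simp [e']⟩, 1, by push_cast; linarith⟩
      · exact ⟨⟨1, by simp [e']⟩, 0, by push_cast; linarith⟩
      · exact ⟨⟨1, by push_cast; linarith⟩, 0, by simp [e']⟩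
      · exact ⟨⟨0, by push_cast; linarith⟩, 1, by simp [e']⟩
    obtain ⟨⟨a, ha⟩, b, hb⟩ := hx'
    obtain ⟨d, hd⟩ := exists_side_eq ha
    obtain ⟨d', hd'⟩ := exists_side_eq hb
    exact h ⟨(d, d'), by rw [hd, hd']⟩

lemma region_union : region C₁ C₂ interiorPattern ∪ region C₁ C₂ diagonalPattern =
    openSurface C₁ C₂ := by
  ext x
  induction x using surface_ind with
  | h i p =>
    rw [pt_mem_openSurface, ← interior_or_diagonal]
    rfl

lemma region_union_univ : region C₁ C₂ interiorPattern ∪ region C₁ C₂ diagonalPattern ∪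
    region C₁ C₂ middlePattern = Set.univ := by
  rw [region_union, Set.eq_univ_iff_forall]
  intro x
  induction x using surface_ind with
  | h i p =>
    rw [Set.mem_union, pt_mem_openSurface, pt_mem_region]
    by_cases h : ∃ d : Bool × Bool, p = (side d.1, side d.2)
    · obtain ⟨d, rfl⟩ := h
      exact Or.inr (middle_side d).1
    · exact Or.inl h

/-- Distinct cycles give distinct points because the component label on the middle region is a left
inverse of `cornerPoint`. -/
lemma cornerPoint_injective : Function.Injective (cornerPoint C₁ C₂) := by
  intro z z' h
  rw [← (middleCenters C₁ C₂).label_compCenter z, ← (middleCenters C₁ C₂).label_compCenter z']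
  congr 2

lemma compl_openSurface : (openSurface C₁ C₂)ᶜ = Set.range (cornerPoint C₁ C₂) := by
  ext x
  constructor
  · induction x using surface_ind with
    | h i p =>
      rw [Set.mem_compl_iff, pt_mem_openSurface, not_not]
      rintro ⟨d, rfl⟩
      exact ⟨_, (pt_side C₁ C₂ i d).symm⟩
  · rintro ⟨z, rfl⟩
    induction z using Quotient.ind with
    | _ i =>
      refine fun h => (pt_mem_openSurface C₁ C₂ i (0, 1)).1 h ⟨(false, true), rfl⟩

lemma encard_compl_openSurface [Finite S] :
    (openSurface C₁ C₂)ᶜ.encard = Nat.card (Corners C₁ C₂) := by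
  rw [compl_openSurface, ← Set.image_univ, (cornerPoint_injective C₁ C₂).encard_image,
    Set.encard_univ, ENat.card_eq_coe_natCard]

/-- A set of squares which is invariant under both permutations is everything or nothing if the
open surface is connected. -/
lemma mem_of_invariant (hconn : IsConnected (openSurface C₁ C₂)) {p : S → Prop}
    (h₁ : ∀ i, p (C₁ i) ↔ p i) (h₂ : ∀ i, p (C₂ i) ↔ p i) {i j : S} (hi : p i) : p j := by
  -- Invariance makes the indicator of the set of squares well defined on the glued surface; it is
  -- locally constant, hence constant on the connected open surface.
  let f : ClosedSurface C₁ C₂ → Prop := surfaceLift (fun i _ => p i)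
    (fun i _ => propext (h₁ i).symm) (fun i _ => propext (h₂ i).symm)
  have hf : IsLocallyConstant f := by
    intro U
    refine isQuotientMap_quot_mk.isOpen_preimage.1 (isOpen_sigma_iff.2 fun i => ?_)
    exact isOpen_const (p := p i ∈ U)
  have hm : ∀ i, pt C₁ C₂ i (half, half) ∈ openSurface C₁ C₂ := fun i => by
    rw [← region_union]
    exact Or.inl ((interiorCenters C₁ C₂).compCenter_mem i)
  have : p i = p j := hf.apply_eq_of_isPreconnected hconn.isPreconnected (hm i) (hm j)
  exact this ▸ hi

/-- Each square is path connected and glued squares share points, so the squares reachable from a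
given one form an invariant set. -/
lemma isPathConnected_closedSurface (hconn : IsConnected (openSurface C₁ C₂)) :
    PathConnectedSpace (ClosedSurface C₁ C₂) := by
  have : PathConnectedSpace unitInterval := isPathConnected_iff_pathConnectedSpace.1
    ((convex_Icc (0 : ℝ) 1).isPathConnected ⟨0, by norm_num⟩)
  have hp : ∀ i p q, Joined (pt C₁ C₂ i p) (pt C₁ C₂ i q) := fun i p q =>
    Joined.map ⟨(PathConnectedSpace.somePath p.1 q.1).prod (PathConnectedSpace.somePath p.2 q.2)⟩
      (continuous_quot_mk.comp (continuous_sigmaMk (σ := fun _ : S => unitInterval × unitInterval)))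
  obtain ⟨x, hx⟩ := hconn.nonempty
  clear hx
  induction x using surface_ind with
  | h i p =>
    refine pathConnectedSpace_iff_eq.2 ⟨pt C₁ C₂ i p, Set.eq_univ_of_forall fun x => ?_⟩
    induction x using surface_ind with
    | h j q =>
      have e₁ : ∀ k, Joined (pt C₁ C₂ (C₁ k) (0, 0)) (pt C₁ C₂ k (0, 0)) := fun k => by
        rw [← pt_right]; exact hp _ _ _
      have e₂ : ∀ k, Joined (pt C₁ C₂ (C₂ k) (0, 1)) (pt C₁ C₂ k (0, 1)) := fun k => by
        rw [← pt_bottom]; exact hp _ _ _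
      refine mem_of_invariant C₁ C₂ hconn (p := fun k => ∀ q, Joined (pt C₁ C₂ i p) (pt C₁ C₂ k q))
        (fun k => ⟨fun h q => ?_, fun h q => ?_⟩) (fun k => ⟨fun h q => ?_, fun h q => ?_⟩)
        (hp i p) q
      · exact ((h _).trans (e₁ k)).trans (hp _ _ _)
      · exact ((h _).trans (e₁ k).symm).trans (hp _ _ _)
      · exact ((h _).trans (e₂ k)).trans (hp _ _ _)
      · exact ((h _).trans (e₂ k).symm).trans (hp _ _ _)

end SquareTiled

end

/-! ### The orientation cycle and the homology of the surfaces -/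

noncomputable section

open CategoryTheory

namespace SquareTiled

/-- Every triangle, quarter and half-edge neighbourhood contains exactly two half triangles, so
membership in `cycles` is a system of two-term equations. -/
lemma mapDomain_apply_of_fiber {α β : Type} {g : α → β} {a b : α} {z : β} (hab : a ≠ b)
    (h : ∀ y, g y = z ↔ y = a ∨ y = b) (v : α →₀ ℚ) : Finsupp.mapDomain g v z = v a + v b := by
  classical
  induction v using Finsupp.induction_linear with
  | zero => simp
  | add v v' hv hv' => rw [Finsupp.mapDomain_add, Finsupp.add_apply, hv, hv']; simp; ring
  | single y c =>
    rw [Finsupp.mapDomain_single, Finsupp.single_apply, Finsupp.single_apply, Finsupp.single_apply]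
    by_cases h1 : y = a
    · rw [if_pos ((h y).2 (Or.inl h1))]
      simp [h1, hab]
    · by_cases h2 : y = b
      · rw [if_pos ((h y).2 (Or.inr h2))]
        simp [h2, hab.symm]
      · have : g y ≠ z := fun e => ((h y).1 e).elim h1 h2
        simp [this, h1, h2]

variable {S : Type} (C₁ C₂ : Equiv.Perm S)

/-- The map from the halves of the triangles to the triangles. -/
def toTriangle (z : S × (Bool × Bool) × Bool) : S × Bool × Bool := (z.1, z.2.1)

/-- The map from the halves of the triangles to the quarters of the squares. -/
def toQuarter (z : S × (Bool × Bool) × Bool) : S × Bool × Bool :=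
  (z.1, quarterLabel z.2.1 z.2.2)

/-- The map from the halves of the triangles to the halves of the edges. -/
def toEdge (z : S × (Bool × Bool) × Bool) : (S ⊕ S) × Bool := (edgeLabel C₁ C₂ z.1 z.2.1, z.2.2)

lemma toTriangle_fiber (v : S × (Bool × Bool) × Bool →₀ ℚ) (i : S) (s : Bool × Bool) :
    Finsupp.mapDomain toTriangle v (i, s) = v (i, s, true) + v (i, s, false) := by
  refine mapDomain_apply_of_fiber (by simp) ?_ v
  rintro ⟨j, s', w⟩
  cases w <;> simp [toTriangle]

lemma toQuarter_fiber (v : S × (Bool × Bool) × Bool →₀ ℚ) (i : S) (d : Bool × Bool) :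
    Finsupp.mapDomain toQuarter v (i, d) =
      v (i, (d.1, d.1), d.2) + v (i, (!d.2, d.2), d.1) := by
  refine mapDomain_apply_of_fiber ?_ ?_ v
  · obtain ⟨_ | _, _ | _⟩ := d <;> simp
  rintro ⟨j, s', w⟩
  obtain ⟨_ | _, _ | _⟩ := d <;> obtain ⟨_ | _, _ | _⟩ := s' <;> cases w <;>
    simp [toQuarter, quarterLabel]

lemma toEdge_fiber_inl (v : S × (Bool × Bool) × Bool →₀ ℚ) (i : S) (w : Bool) :
    Finsupp.mapDomain (toEdge C₁ C₂) v (Sum.inl i, w) =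
      v (i, (true, true), w) + v (C₁ i, (false, false), w) := by
  refine mapDomain_apply_of_fiber (by simp) ?_ v
  rintro ⟨j, s', w'⟩
  obtain ⟨_ | _, _ | _⟩ := s' <;> simp [toEdge, edgeLabel, Equiv.symm_apply_eq]

lemma toEdge_fiber_inr (v : S × (Bool × Bool) × Bool →₀ ℚ) (i : S) (w : Bool) :
    Finsupp.mapDomain (toEdge C₁ C₂) v (Sum.inr i, w) =
      v (i, (true, false), w) + v (C₂ i, (false, true), w) := by
  refine mapDomain_apply_of_fiber (by simp) ?_ v
  rintro ⟨j, s', w'⟩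
  obtain ⟨_ | _, _ | _⟩ := s' <;> simp [toEdge, edgeLabel, Equiv.symm_apply_eq]

/-- The sign attached to a Boolean value. -/
def signOf (s : Bool) : ℚ := if s then 1 else -1

/-- The orientation cycle: the sum of the halves of the triangles with alternating signs. -/
def orientation [Finite S] : S × (Bool × Bool) × Bool →₀ ℚ :=
  Finsupp.equivFunOnFinite.symm fun z => signOf z.2.1.1 * signOf z.2.2

lemma orientation_apply [Finite S] (z : S × (Bool × Bool) × Bool) :
    orientation z = signOf z.2.1.1 * signOf z.2.2 := rfl

/-- The kernel of the maps from the halves of the triangles. -/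
abbrev cycles : Submodule ℚ (S × (Bool × Bool) × Bool →₀ ℚ) :=
  LinearMap.ker (Finsupp.lmapDomain ℚ ℚ toTriangle) ⊓
    LinearMap.ker (Finsupp.lmapDomain ℚ ℚ toQuarter) ⊓
    LinearMap.ker (Finsupp.lmapDomain ℚ ℚ (toEdge C₁ C₂))

lemma orientation_mem [Finite S] : orientation ∈ cycles C₁ C₂ := by
  refine ⟨⟨?_, ?_⟩, ?_⟩
  · refine Finsupp.ext fun ⟨i, s⟩ => ?_
    refine (toTriangle_fiber _ i s).trans ?_
    simp [orientation_apply, signOf]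
  · refine Finsupp.ext fun ⟨i, s⟩ => ?_
    refine (toQuarter_fiber _ i s).trans ?_
    obtain ⟨_ | _, _ | _⟩ := s <;> simp [orientation_apply, signOf]
  · refine Finsupp.ext fun ⟨i, w⟩ => ?_
    obtain i | i := i
    · refine (toEdge_fiber_inl C₁ C₂ _ i w).trans ?_
      cases w <;> simp [orientation_apply, signOf]
    · refine (toEdge_fiber_inr C₁ C₂ _ i w).trans ?_
      cases w <;> simp [orientation_apply, signOf]

/-- The eight half triangles of a square form a ring in which neighbours share a triangle or a
quarter, so the coefficients alternate and one of them determines the rest. The edge equations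
equate the coefficients of glued squares, and connectedness makes them global. -/
lemma exists_smul_orientation [Finite S] (hconn : IsConnected (openSurface C₁ C₂)) (i₀ : S)
    {v : S × (Bool × Bool) × Bool →₀ ℚ} (hv : v ∈ cycles C₁ C₂) :
    v (i₀, (true, true), true) • orientation = v := by
  obtain ⟨⟨h1, h2⟩, h3⟩ := hv
  have t : ∀ i s, v (i, s, true) + v (i, s, false) = 0 := fun i s =>
    (toTriangle_fiber v i s).symm.trans (DFunLike.congr_fun h1 (i, s))
  have q : ∀ i (d : Bool × Bool), v (i, (d.1, d.1), d.2) + v (i, (!d.2, d.2), d.1) = 0 := fun i d =>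
    (toQuarter_fiber v i d).symm.trans (DFunLike.congr_fun h2 (i, d))
  have e₁ : ∀ i, v (i, (true, true), true) + v (C₁ i, (false, false), true) = 0 := fun i =>
    (toEdge_fiber_inl C₁ C₂ v i true).symm.trans (DFunLike.congr_fun h3 (Sum.inl i, true))
  have e₂ : ∀ i, v (i, (true, false), true) + v (C₂ i, (false, true), true) = 0 := fun i =>
    (toEdge_fiber_inr C₁ C₂ v i true).symm.trans (DFunLike.congr_fun h3 (Sum.inr i, true))
  have key : ∀ i s w, v (i, s, w) = signOf s.1 * signOf w * v (i, (true, true), true) := by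
    intro i s w
    have a1 := t i (true, true)
    have a2 := t i (true, false)
    have a3 := t i (false, true)
    have a4 := t i (false, false)
    have q1 := q i (true, true)
    have q2 := q i (true, false)
    have q3 := q i (false, true)
    simp only [Bool.not_true, Bool.not_false] at q1 q2 q3
    -- Seven of the eight relations around the ring already connect all eight coefficients, so the
    -- fourth quarter is not needed.
    obtain ⟨_ | _, _ | _⟩ := s <;> cases w <;> simp [signOf] <;> linarith
  have const : ∀ i, v (i, (true, true), true) = v (i₀, (true, true), true) := by
    intro i
    refine mem_of_invariant C₁ C₂ hconn (i := i₀)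
      (p := fun i => v (i, (true, true), true) = v (i₀, (true, true), true)) ?_ ?_ rfl
    · intro i
      have := e₁ i
      rw [key (C₁ i)] at this
      simp only [signOf] at this
      constructor <;> intro h <;> simp at this <;> linarith
    · intro i
      have := e₂ i
      rw [key (C₂ i), key i] at this
      simp only [signOf] at this
      constructor <;> intro h <;> simp at this <;> linarith
  refine Finsupp.ext fun ⟨i, s, w⟩ => ?_
  rw [Finsupp.smul_apply, orientation_apply, smul_eq_mul, mul_comm, key i s w, const i]

lemma nonempty_squares (hconn : IsConnected (openSurface C₁ C₂)) : Nonempty S := by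
  obtain ⟨x, -⟩ := hconn.nonempty
  induction x using surface_ind with
  | h i p => exact ⟨i⟩

lemma finrank_cycles [Finite S] (hconn : IsConnected (openSurface C₁ C₂)) :
    Module.finrank ℚ (cycles C₁ C₂) = 1 := by
  obtain ⟨i₀⟩ := nonempty_squares C₁ C₂ hconn
  refine (finrank_eq_one_iff_of_nonzero' ⟨orientation, orientation_mem C₁ C₂⟩ ?_).2 fun v =>
    ⟨_, Subtype.ext (exists_smul_orientation C₁ C₂ hconn i₀ v.2)⟩
  intro h
  have := DFunLike.congr_fun (congrArg Subtype.val h) (i₀, (true, true), true)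
  simp [orientation_apply, signOf] at this

/-- The homology of a space is that of its improper subspace. -/
def homologyUniv (X : Type) [TopologicalSpace X] (n : ℕ) :
    H n (Set.univ : Set X) ≃ₗ[ℚ] H n X :=
  (HomologicalComplex.homologyMapIso
    (((AlgebraicTopology.singularChainComplexFunctor (ModuleCat.{0} ℚ)).obj
      (ModuleCat.of ℚ ℚ)).mapIso (TopCat.isoOfHomeo (X := TopCat.of (Set.univ : Set X))
        (Y := TopCat.of X) (Homeomorph.Set.univ X))) n).toLinearEquiv

lemma finrank_H_zero (X : Type) [TopologicalSpace X] [PathConnectedSpace X] :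
    Module.finrank ℚ (H 0 X) = 1 := by
  have : PathConnectedSpace (TopCat.of X) := ‹_›
  have e : H 0 X ≃ₗ[ℚ] ModuleCat.of ℚ ℚ :=
    (asIso ((TopCat.of X).singularHomology₀ε (ModuleCat.of ℚ ℚ))).toLinearEquiv
  rw [e.finrank_eq]
  exact Module.finrank_self ℚ

lemma finrank_finsupp_card (Z : Type) [Finite Z] : Module.finrank ℚ (Z →₀ ℚ) = Nat.card Z := by
  have := Fintype.ofFinite Z
  rw [Module.finrank_finsupp_self, Nat.card_eq_fintype_card]

theorem homology_closedSurface [Finite S] (hconn : IsConnected (openSurface C₁ C₂)) :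
    Module.Finite ℚ (H 1 (ClosedSurface C₁ C₂)) ∧
      (Module.finrank ℚ (H 1 (ClosedSurface C₁ C₂)) : ℤ) =
        Nat.card S - Nat.card (Corners C₁ C₂) + 2 := by
  have h := homology_of_three_sets (isOpen_region C₁ C₂ interiorPattern)
    (isOpen_region C₁ C₂ diagonalPattern) (isOpen_region C₁ C₂ middlePattern)
    (interiorCenters C₁ C₂).deformation.acyclicOver
    (diagonalCenters C₁ C₂).deformation.acyclicOver
    (middleCenters C₁ C₂).deformation.acyclicOver
    (by rw [← region_inter]; exact (interiorDiagonalCenters C₁ C₂).deformation.acyclicOver)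
    (by rw [← region_inter]; exact (interiorMiddleCenters C₁ C₂).deformation.acyclicOver)
    (by rw [← region_inter]; exact (diagonalMiddleCenters C₁ C₂).deformation.acyclicOver)
    (by
      rw [← region_inter, ← region_inter]
      exact (tripleCenters C₁ C₂).deformation.acyclicOver)
    (Finsupp.lmapDomain ℚ ℚ toTriangle) (Finsupp.lmapDomain ℚ ℚ toQuarter)
    (Finsupp.lmapDomain ℚ ℚ (toEdge C₁ C₂))
    (fun x hx => by
      induction x using surface_ind with
      | h i p =>
        rw [(tripleCenters C₁ C₂).vec_pt i hx, (interiorDiagonalCenters C₁ C₂).vec_pt i hx.1]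
        exact Finsupp.mapDomain_single)
    (fun x hx => by
      induction x using surface_ind with
      | h i p =>
        rw [(tripleCenters C₁ C₂).vec_pt i hx,
          (interiorMiddleCenters C₁ C₂).vec_pt i ⟨hx.1.1, hx.2⟩]
        refine Finsupp.mapDomain_single.trans (congrArg (fun z => Finsupp.single z 1) ?_)
        exact Prod.ext rfl (quarterLabel_halfLabel ⟨hx.1.2, hx.2⟩))
    (fun x hx => by
      induction x using surface_ind with
      | h i p =>
        rw [(tripleCenters C₁ C₂).vec_pt i hx,
          (diagonalMiddleCenters C₁ C₂).vec_pt i ⟨hx.1.2, hx.2⟩]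
        exact Finsupp.mapDomain_single)
    (region_union_univ C₁ C₂)
  obtain ⟨hfin, -, h2, hχ⟩ := h
  have := isPathConnected_closedSurface C₁ C₂ hconn
  have := hfin 1
  refine ⟨Module.Finite.equiv (homologyUniv _ 1), ?_⟩
  -- With h₀ = h₂ = 1, the count of components reads 2 - h₁ = (n + 2n + b) - 12n + 8n.
  rw [h2, finrank_cycles C₁ C₂ hconn, (homologyUniv _ 0).finrank_eq, finrank_H_zero,
    (homologyUniv _ 1).finrank_eq] at hχ
  simp only [finrank_finsupp_card, Nat.card_prod, Nat.card_sum, Nat.card_eq_fintype_card,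
    Fintype.card_prod, Fintype.card_bool] at hχ
  push_cast at hχ
  linarith

theorem hasEulerChar_openSurface [Finite S] :
    HasEulerChar (openSurface C₁ C₂) (-(Nat.card S : ℤ)) := by
  -- An empty third set turns the three-set theorem into the ordinary Mayer–Vietoris count for two
  -- sets: n + 2n - 4n. The triple intersection is empty, so H₂ vanishes.
  have h := homology_of_three_sets (isOpen_region C₁ C₂ interiorPattern)
    (isOpen_region C₁ C₂ diagonalPattern) isOpen_empty
    (interiorCenters C₁ C₂).deformation.acyclicOver
    (diagonalCenters C₁ C₂).deformation.acyclicOver AcyclicOver.empty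
    (by rw [← region_inter]; exact (interiorDiagonalCenters C₁ C₂).deformation.acyclicOver)
    (by rw [Set.inter_empty]; exact AcyclicOver.empty)
    (by rw [Set.inter_empty]; exact AcyclicOver.empty)
    (by rw [Set.inter_empty]; exact AcyclicOver.empty)
    0 0 0 (fun x hx => hx.2.elim) (fun x hx => hx.2.elim) (fun x hx => hx.2.elim)
    ((Set.union_empty _).trans (region_union C₁ C₂))
  obtain ⟨hfin, h3, h2, hχ⟩ := h
  have h2' : Module.finrank ℚ (H 2 (openSurface C₁ C₂)) = 0 := by
    rw [h2]
    exact Module.finrank_zero_of_subsingleton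
  rw [h2'] at hχ
  simp only [finrank_finsupp_card, Nat.card_prod, Nat.card_sum, Nat.card_eq_fintype_card,
    Fintype.card_prod, Fintype.card_bool, Fintype.card_empty] at hχ
  have hsub : ∀ i, 3 ≤ i → Subsingleton (H i (openSurface C₁ C₂)) := fun i hi => by
    obtain ⟨n, rfl⟩ := Nat.exists_eq_add_of_le' hi
    exact h3 n
  refine ⟨hfin, (Set.finite_Iio 3).subset fun i hi => ?_, ?_⟩
  · by_contra hc
    exact not_nontrivial_iff_subsingleton.2 (hsub i (not_lt.1 hc)) hi
  · rw [HomologicalComplex.homologyEulerChar_eq_sum_finSet_of_finrankSupport_subset _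
      (Finset.range 3)]
    · simp only [Finset.sum_range_succ, Finset.sum_range_zero,
        ComplexShape.eulerCharSignsDownNat_χ]
      rw [h2']
      push_cast at hχ ⊢
      linarith
    · rw [GradedObject.finrankSupport_subset_iff]
      intro i hi
      have := hsub i (not_lt.1 fun h => hi (Finset.mem_coe.2 (Finset.mem_range.2 h)))
      exact Module.finrank_zero_of_subsingleton

end SquareTiled

end

/-! ### Counting the cycles of an even permutation -/

noncomputable section

open CategoryTheory

namespace SquareTiled

open Equiv.Perm

variable {S : Type} [Fintype S] [DecidableEq S]

/-- The cycle of a permutation which contains a given element, or this element if it is fixed. -/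
def cycleAt (σ : Equiv.Perm S) (i : S) : {f // f ∈ σ.cycleFactorsFinset} ⊕ {i // i ∈ σ.supportᶜ} :=
  if h : i ∈ σ.support then Sum.inl ⟨σ.cycleOf i, cycleOf_mem_cycleFactorsFinset_iff.2 h⟩
  else Sum.inr ⟨i, Finset.mem_compl.2 h⟩

lemma cycleAt_eq_iff (σ : Equiv.Perm S) (i j : S) :
    cycleAt σ i = cycleAt σ j ↔ σ.SameCycle i j := by
  unfold cycleAt
  by_cases hi : i ∈ σ.support <;> by_cases hj : j ∈ σ.support
  · rw [dif_pos hi, dif_pos hj, sameCycle_iff_cycleOf_eq_of_mem_support hi hj]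
    simp
  · rw [dif_pos hi, dif_neg hj]
    simp only [reduceCtorEq, false_iff]
    exact fun h => hj (h.mem_support_iff.1 hi)
  · rw [dif_neg hi, dif_pos hj]
    simp only [reduceCtorEq, false_iff]
    exact fun h => hi (h.mem_support_iff.2 hj)
  · rw [dif_neg hi, dif_neg hj]
    simp only [Sum.inr.injEq, Subtype.mk.injEq]
    refine ⟨fun h => h ▸ SameCycle.refl _ _, fun h => ?_⟩
    exact h.eq_of_left (notMem_support.1 hi)

lemma cycleAt_surjective (σ : Equiv.Perm S) : Function.Surjective (cycleAt σ) := by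
  rintro (⟨f, hf⟩ | ⟨i, hi⟩)
  · obtain ⟨i, hi⟩ := (mem_cycleFactorsFinset_iff.1 hf).1.nonempty_support
    have h := mem_cycleFactorsFinset_support_le hf hi
    refine ⟨i, ?_⟩
    rw [cycleAt, dif_pos h]
    simp [cycle_is_cycleOf hi hf]
  · exact ⟨i, dif_neg (Finset.mem_compl.1 hi)⟩

/-- Orbits correspond to nontrivial cycle factors together with fixed points, which are the two
kinds of parts of the partition. -/
lemma card_sameCycle (σ : Equiv.Perm S) :
    Nat.card (Quotient (SameCycle.setoid σ)) = σ.partition.parts.card := by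
  have e : Quotient (SameCycle.setoid σ) ≃
      {f // f ∈ σ.cycleFactorsFinset} ⊕ {i // i ∈ σ.supportᶜ} :=
    Equiv.ofBijective (Quotient.lift (cycleAt σ) fun i j h => (cycleAt_eq_iff σ i j).2 h) ⟨by
      rintro ⟨i⟩ ⟨j⟩ h
      exact Quotient.sound ((cycleAt_eq_iff σ i j).1 h),
      (Quot.surjective_lift _).2 (cycleAt_surjective σ)⟩
  rw [Nat.card_congr e, Nat.card_sum, Nat.card_eq_fintype_card, Nat.card_eq_fintype_card,
    Fintype.card_coe, Fintype.card_coe, parts_partition, cycleType_def, Multiset.card_add,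
    Multiset.card_map, Multiset.card_replicate, Finset.card_compl]
  rfl

lemma sum_numCycles (σ : Equiv.Perm S) :
    ∑ k ∈ Finset.Icc 1 (Fintype.card S), numCycles σ k = σ.partition.parts.card := by
  refine Multiset.sum_count_eq_card fun k hk => Finset.mem_Icc.2 ⟨σ.partition.parts_pos hk, ?_⟩
  exact (Multiset.le_sum_of_mem hk).trans_eq σ.partition.parts_sum

lemma card_parts_add (σ : Equiv.Perm S) :
    σ.partition.parts.card + σ.cycleType.sum = σ.cycleType.card + Fintype.card S := by
  have h := sum_cycleType_le σ
  rw [parts_partition, Multiset.card_add, Multiset.card_replicate, ← sum_cycleType]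
  omega

lemma card_le_sum_cycleType (σ : Equiv.Perm S) : 2 * σ.cycleType.card ≤ σ.cycleType.sum := by
  rw [mul_comm, ← smul_eq_mul]
  exact Multiset.card_nsmul_le_sum fun k hk => two_le_of_mem_cycleType hk

/-- The defect n - b is the sum of (length - 1) over the nontrivial cycles; its parity is the sign,
and it is zero only if there are no such cycles. -/
lemma exists_card_eq {σ : Equiv.Perm S} (h : sign σ = 1) :
    ∃ m, Fintype.card S = σ.partition.parts.card + 2 * m ∧ (m = 0 ↔ σ = 1) := by
  have h1 := card_parts_add σ
  have h2 := card_le_sum_cycleType σ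
  rw [sign_of_cycleType, neg_one_pow_eq_one_iff_even (by decide)] at h
  obtain ⟨k, hk⟩ := h
  -- Evenness gives sum + card = 2k for the cycle type, so the defect sum - card is 2(k - card); the
  -- subtraction is not truncated since 2·card ≤ sum.
  refine ⟨k - σ.cycleType.card, by omega, ?_⟩
  constructor
  · intro h
    rw [← card_cycleType_eq_zero]
    omega
  · rintro rfl
    simp at hk ⊢
    omega

end SquareTiled

end

/-! ### The main theorem -/

theorem mainTheorem9 {S : Type} [Fintype S] [DecidableEq S] (C₁ C₂ : Equiv.Perm S)
    (hconn : IsConnected (SquareTiled.openSurface C₁ C₂)) (n b : ℕ) (hn : n = Fintype.card S)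
    (hb : b = ∑ k ∈ Finset.Icc 1 n, SquareTiled.numCycles (C₁ * C₂ * C₁⁻¹ * C₂⁻¹) k) :
    (SquareTiled.openSurface C₁ C₂)ᶜ.encard = b ∧
    SquareTiled.HasEulerChar (SquareTiled.openSurface C₁ C₂) (-(n : ℤ)) ∧
    ∃ g : ℕ, SquareTiled.HasGenus (SquareTiled.ClosedSurface C₁ C₂) g ∧
      2 - 2 * (g : ℤ) - (b : ℤ) = -(n : ℤ) ∧
      (g = 1 ↔ Commute C₁ C₂) := by
  have hb' : b = Nat.card (SquareTiled.Corners C₁ C₂) := by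
    rw [hb, hn, SquareTiled.sum_numCycles, SquareTiled.card_sameCycle]
  have hn' : n = Nat.card S := by rw [hn, Nat.card_eq_fintype_card]
  obtain ⟨hfin, hrank⟩ := SquareTiled.homology_closedSurface C₁ C₂ hconn
  have hsign : Equiv.Perm.sign (C₁ * C₂ * C₁⁻¹ * C₂⁻¹) = 1 := by
    simp only [Equiv.Perm.sign_mul, Equiv.Perm.sign_inv]
    rw [mul_right_comm (Equiv.Perm.sign C₁), Int.units_mul_self, one_mul, Int.units_mul_self]
  obtain ⟨m, hm, hm'⟩ := SquareTiled.exists_card_eq hsign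
  rw [← SquareTiled.card_sameCycle, ← hb', ← hn] at hm
  rw [← hn', ← hb'] at hrank
  -- With n = b + 2m, the first Betti number n - b + 2 equals 2(m + 1), so the genus is m + 1.
  refine ⟨by rw [SquareTiled.encard_compl_openSurface, hb'],
    hn' ▸ SquareTiled.hasEulerChar_openSurface C₁ C₂, m + 1, ⟨hfin, by omega⟩,
    by push_cast; omega, ?_⟩
  rw [Nat.add_eq_right, hm', mul_inv_eq_one, mul_inv_eq_iff_eq_mul]
  rfl
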